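/- Let $\mathbb K$ be a field of characteristic $0$. Let $\mathbf C$ be the category of finite dimensional nilpotent (graded-)commutative associative differential $\mathbb Z$-graded $\mathbb K$-algebras (without unit, differential of degree $+1$), and let $F:\mathbf C\to\mathbf{Set}$ be a functor. An acyclic small extension is a surjection $A\to B$ in $\mathbf C$ whose kernel $I$ satisfies $AI=0$ and is an acyclic complex. $F$ is a predeformation functor if (1) $F(0)$ is a one-point set; (2) for all $\alpha:A\to C$, $\beta:B\to C$ in $\mathbf C$ with $\alpha$ surjective, the map $F(A\times_CB)\to F(A)\times_{F(C)}F(B)$ is surjective, and it is bijective if moreover $C$ is acyclic with trivial multiplication; (3) $F(A)\to F(B)$ is surjective for every acyclic small extension $A\to B$. It is a deformation functor if, in addition, the maps in (3) are bijective. For $A\in\mathbf C$ and $\epsilon>0$ let $A[t,dt]_\epsilon=A\oplus\bigoplus_{n>0}A^{\lceil n\epsilon\rceil}\otimes(\mathbb K t^n\oplus\mathbb K t^{n-1}dt)\subset A\otimes\mathbb K[t,dt]$, with evaluations $e_0,e_1:A[t,dt]_\epsilon\to A$ at $t=0,1$ (and $dt=0$). Let $F^+(A)$ be the quotient of $F(A)$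 by the equivalence relation generated by: $a\sim b$ if there are $\epsilon>0$ and $x\in F(A[t,dt]_\epsilon)$ with $e_0(x)=a$, $e_1(x)=b$; let $\eta_F:F\to F^+$ be the projection. For a differential graded Lie algebra $L$ ($\mathbb Z$-graded, over $\mathbb K$) and $A\in\mathbf C$, the tensor product $L\otimes A$ is a differential graded Lie algebra with $d(x\otimes a)=dx\otimes a+(-1)^{\bar x}x\otimes da$ and $[x\otimes a,y\otimes b]=(-1)^{\bar a\bar y}[x,y]\otimes ab$. Let $MC_L(A)=\{x\in(L\otimes A)^1 \mid dx+\tfrac12[x,x]=0\}$, and let $\mathrm{Def}_L(A)$ be the quotient of $MC_L(A)$ by the gauge action of the group $\exp((L\otimes A)^0)$, $$e^u x=x+\sum_{n\ge0}\frac{(\mathrm{ad}\,u)^n}{(n+1)!}\bigl([u,x]-du\bigr);$$ let $\pi_L:MC_L\to\mathrm{Def}_L$ be the projection. Corollary 3.4. For every differential graded Lie algebra $L$, $MC_L$ is a predeformation functor and $MC_L^+$ is the deformation functor associated with it, that is, $MC_L^+$ is a deformation functor and every natural transformation from $MC_L$ to a deformation functor factors uniquely through $\eta_{MC_L}:MC_L\to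 MC_L^+$. Moreover there is an isomorphism of functors $\Phi_L:MC_L^+\to\mathrm{Def}_L$, natural in $L$, such that $\Phi_L\circ\eta_{MC_L}=\pi_L$. -/

import Mathlib

open CategoryTheory TensorProduct

universe u

namespace DefFun

section Graded

variable {K : Type u} [Field K] {V V' W W' : Type u}
  [AddCommGroup V] [Module K V] [AddCommGroup V'] [Module K V']
  [AddCommGroup W] [Module K W] [AddCommGroup W'] [Module K W']

/-- The linear map on a graded vector space which equals `f i` on the piece of degree `i`. -/
noncomputable def onPieces {gr : ℤ → Submodule K V} (h : DirectSum.IsInternal gr)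
    (f : ℤ → V →ₗ[K] W) : V →ₗ[K] W :=
  (DirectSum.toModule K ℤ W (fun i => (f i).comp (gr i).subtype)).comp
    (LinearEquiv.ofBijective (DirectSum.coeLinearMap gr) h).symm.toLinearMap

theorem onPieces_apply {gr : ℤ → Submodule K V} (h : DirectSum.IsInternal gr)
    (f : ℤ → V →ₗ[K] W) {i : ℤ} {v : V} (hv : v ∈ gr i) : onPieces h f v = f i v := by
  have : (LinearEquiv.ofBijective (DirectSum.coeLinearMap gr) h).symm v
      = DirectSum.lof K ℤ (fun i => gr i) i ⟨v, hv⟩ := by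
    rw [LinearEquiv.symm_apply_eq]
    change v = DirectSum.coeLinearMap gr (DirectSum.lof K ℤ (fun i => gr i) i ⟨v, hv⟩)
    rw [DirectSum.coeLinearMap_lof]
  simp [onPieces, this]

theorem graded_induction {gr : ℤ → Submodule K V} (h : DirectSum.IsInternal gr)
    {P : V → Prop} (v : V) (hom : ∀ i, ∀ v ∈ gr i, P v) (add : ∀ v w, P v → P w → P (v + w)) :
    P v := by
  have hv : v ∈ ⨆ i, gr i := by rw [h.submodule_iSup_eq_top]; trivial
  exact Submodule.iSup_induction gr (motive := P) hv hom (hom 0 0 (zero_mem _)) add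

theorem graded_ext {gr : ℤ → Submodule K V} (h : DirectSum.IsInternal gr)
    {f g : V →ₗ[K] W} (hfg : ∀ i, ∀ v ∈ gr i, f v = g v) (v : V) : f v = g v :=
  graded_induction h v hfg (fun v w hv hw => by rw [map_add, map_add, hv, hw])

theorem onPieces_natural {gr : ℤ → Submodule K V} (h : DirectSum.IsInternal gr)
    {gr' : ℤ → Submodule K V'} (h' : DirectSum.IsInternal gr')
    (φ : V →ₗ[K] V') (hφ : ∀ i, ∀ v ∈ gr i, φ v ∈ gr' i)
    (f : ℤ → V →ₗ[K] W) (g : ℤ → V' →ₗ[K] W') (ψ : W →ₗ[K] W')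
    (hfg : ∀ i v, ψ (f i v) = g i (φ v)) (v : V) :
    ψ (onPieces h f v) = onPieces h' g (φ v) := by
  refine graded_ext h (f := ψ.comp (onPieces h f)) (g := (onPieces h' g).comp φ) ?_ v
  intro i v hv
  simp [onPieces_apply h f hv, onPieces_apply h' g (hφ i v hv), hfg]

/-- The projection of a graded vector space onto its piece of degree `n`. -/
noncomputable def proj {gr : ℤ → Submodule K V} (h : DirectSum.IsInternal gr) (n : ℤ) :
    V →ₗ[K] V :=
  onPieces h (fun i => if i = n then LinearMap.id else 0)

/-- The parity operator `v ↦ (-1) ^ i • v` for `v` of degree `i`. -/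
noncomputable def parity {gr : ℤ → Submodule K V} (h : DirectSum.IsInternal gr) : V →ₗ[K] V :=
  onPieces h (fun i => ((-1 : K) ^ i) • LinearMap.id)

/-- The projection of a graded vector space onto the sum of its pieces of even degree. -/
noncomputable def evenPart {gr : ℤ → Submodule K V} (h : DirectSum.IsInternal gr) :
    V →ₗ[K] V :=
  onPieces h (fun i => if Even i then LinearMap.id else 0)

/-- The projection of a graded vector space onto the sum of its pieces of odd degree. -/
noncomputable def oddPart {gr : ℤ → Submodule K V} (h : DirectSum.IsInternal gr) :
    V →ₗ[K] V :=
  onPieces h (fun i => if Even i then 0 else LinearMap.id)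

theorem parity_apply {gr : ℤ → Submodule K V} (h : DirectSum.IsInternal gr)
    {i : ℤ} {v : V} (hv : v ∈ gr i) : parity h v = ((-1 : K) ^ i) • v := by
  simp [parity, onPieces_apply h _ hv]

theorem proj_same {gr : ℤ → Submodule K V} (h : DirectSum.IsInternal gr)
    {i : ℤ} {v : V} (hv : v ∈ gr i) : proj h i v = v := by
  simp [proj, onPieces_apply h _ hv]

theorem proj_ne {gr : ℤ → Submodule K V} (h : DirectSum.IsInternal gr)
    {i n : ℤ} (hn : i ≠ n) {v : V} (hv : v ∈ gr i) : proj h n v = 0 := by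
  simp [proj, onPieces_apply h _ hv, hn]

theorem proj_mem {gr : ℤ → Submodule K V} (h : DirectSum.IsInternal gr) (n : ℤ) (v : V) :
    proj h n v ∈ gr n := by
  refine graded_induction h (P := fun v => proj h n v ∈ gr n) v ?_ ?_
  · intro i v hv
    by_cases hn : i = n
    · subst hn; rw [proj_same h hv]; exact hv
    · rw [proj_ne h hn hv]; exact zero_mem _
  · intro v w hv hw
    rw [map_add]; exact add_mem hv hw

/-- A criterion for a family of subspaces to be a grading, in terms of projections. -/
theorem isInternal_of_proj {gr : ℤ → Submodule K V} (π : ℤ → V →ₗ[K] V) (s : Finset ℤ)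
    (mem : ∀ i v, π i v ∈ gr i) (same : ∀ i, ∀ v ∈ gr i, π i v = v)
    (ne : ∀ i j, i ≠ j → ∀ v ∈ gr i, π j v = 0) (sum : ∀ v, ∑ i ∈ s, π i v = v) :
    DirectSum.IsInternal gr := by
  rw [DirectSum.isInternal_submodule_iff_iSupIndep_and_iSup_eq_top]
  refine ⟨?_, ?_⟩
  · intro i
    rw [Submodule.disjoint_def]
    intro v hv hv'
    have h0 : (⨆ j, ⨆ (_ : j ≠ i), gr j) ≤ LinearMap.ker (π i) :=
      iSup_le fun j => iSup_le fun hj => fun w hw => ne j i hj w hw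
    rw [← same i v hv]
    exact h0 hv'
  · rw [eq_top_iff]
    intro v _
    rw [← sum v]
    exact Submodule.sum_mem _ fun i _ => (le_iSup gr i) (mem i v)

/-- In a finite dimensional graded vector space only finitely many pieces are nonzero. -/
theorem exists_finset_proj [FiniteDimensional K V] {gr : ℤ → Submodule K V}
    (h : DirectSum.IsInternal gr) :
    ∃ s : Finset ℤ, ∀ t : Finset ℤ, s ⊆ t → ∀ v, ∑ i ∈ t, proj h i v = v := by
  have hf : {i | gr i ≠ ⊥}.Finite :=
    WellFoundedGT.finite_ne_bot_of_iSupIndep h.submodule_iSupIndep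
  refine ⟨hf.toFinset, fun t ht v => ?_⟩
  refine graded_induction h (P := fun v => ∑ i ∈ t, proj h i v = v) v ?_ ?_
  · intro i v hv
    by_cases hi : i ∈ t
    · rw [Finset.sum_eq_single_of_mem i hi, proj_same h hv]
      intro j _ hj
      exact proj_ne h hj.symm hv
    · have hb : gr i = ⊥ := by
        by_contra hne
        exact hi (ht (by simpa using hne))
      rw [hb, Submodule.mem_bot] at hv
      simp [hv]
  · intro v w hv hw
    simp only [map_add, Finset.sum_add_distrib, hv, hw]

end Graded

section Powers

variable (K : Type u) [Field K] (A : Type u) [NonUnitalRing A] [Module K A]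

/-- The power `A ^ k` of an algebra without unit: the span of all products of `k` elements,
with the convention `A ^ 0 = A`. -/
def algPow : ℕ → Submodule K A
  | 0 => ⊤
  | 1 => ⊤
  | (k + 2) => Submodule.span K {c | ∃ a : A, ∃ b ∈ algPow (k + 1), c = a * b}

end Powers

/-- An object of the category `C`: a commutative associative differential `ℤ`-graded algebra
over `K` which is nilpotent and finite dimensional. -/
structure ArtDGA (K : Type u) [Field K] where
  carrier : Type u
  [ring : NonUnitalRing carrier]
  [module : Module K carrier]
  [tower : IsScalarTower K carrier carrier]
  [smulComm : SMulCommClass K carrier carrier]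
  gr : ℤ → Submodule K carrier
  internal : DirectSum.IsInternal gr
  mul_mem : ∀ i j a b, a ∈ gr i → b ∈ gr j → a * b ∈ gr (i + j)
  graded_comm : ∀ i j a b, a ∈ gr i → b ∈ gr j → a * b = ((-1 : K) ^ (i * j)) • (b * a)
  d : carrier →ₗ[K] carrier
  d_mem : ∀ i a, a ∈ gr i → d a ∈ gr (i + 1)
  d_d : ∀ a, d (d a) = 0
  leibniz : ∀ i a b, a ∈ gr i → d (a * b) = d a * b + ((-1 : K) ^ i) • (a * d b)
  finite : FiniteDimensional K carrier
  nilpotent : ∃ n, algPow K carrier n = ⊥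

/-- A differential graded Lie algebra over `K`, with underlying `ℤ`-graded vector space `gr`. -/
structure DGLA (K : Type u) [Field K] where
  carrier : Type u
  [group : AddCommGroup carrier]
  [module : Module K carrier]
  gr : ℤ → Submodule K carrier
  internal : DirectSum.IsInternal gr
  d : carrier →ₗ[K] carrier
  d_mem : ∀ i x, x ∈ gr i → d x ∈ gr (i + 1)
  d_d : ∀ x, d (d x) = 0
  br : carrier →ₗ[K] carrier →ₗ[K] carrier
  br_mem : ∀ i j x y, x ∈ gr i → y ∈ gr j → br x y ∈ gr (i + j)
  br_symm : ∀ i j x y, x ∈ gr i → y ∈ gr j → br x y + ((-1 : K) ^ (i * j)) • br y x = 0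
  jacobi : ∀ i j x y z, x ∈ gr i → y ∈ gr j →
    br x (br y z) = br (br x y) z + ((-1 : K) ^ (i * j)) • br y (br x z)
  leibniz : ∀ i x y, x ∈ gr i → d (br x y) = br (d x) y + ((-1 : K) ^ i) • br x (d y)

variable {K : Type u} [Field K]

namespace ArtDGA

instance : CoeSort (ArtDGA K) (Type u) := ⟨ArtDGA.carrier⟩

attribute [instance] ArtDGA.ring ArtDGA.module ArtDGA.tower ArtDGA.smulComm ArtDGA.finite

/-- Morphisms of differential graded algebras. -/
@[ext]
structure Hom (A B : ArtDGA K) where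
  lin : A →ₗ[K] B
  map_mul : ∀ a b, lin (a * b) = lin a * lin b
  map_gr : ∀ i, ∀ a ∈ A.gr i, lin a ∈ B.gr i
  map_d : ∀ a, lin (A.d a) = B.d (lin a)

instance : Category (ArtDGA K) where
  Hom := Hom
  id A := ⟨LinearMap.id, fun _ _ => rfl, fun _ _ h => h, fun _ => rfl⟩
  comp f g := ⟨g.lin.comp f.lin, fun a b => by simp [f.map_mul, g.map_mul],
    fun i a h => g.map_gr i _ (f.map_gr i a h), fun a => by simp [f.map_d, g.map_d]⟩

/-- The linear map underlying a morphism. -/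
def lin {A B : ArtDGA K} (f : A ⟶ B) : A →ₗ[K] B := Hom.lin f

@[ext]
theorem hom_ext {A B : ArtDGA K} {f g : A ⟶ B} (h : ∀ a, lin f a = lin g a) : f = g :=
  Hom.ext (LinearMap.ext h)

@[simp] theorem lin_id (A : ArtDGA K) : lin (𝟙 A) = LinearMap.id := rfl

@[simp] theorem lin_comp {A B C : ArtDGA K} (f : A ⟶ B) (g : B ⟶ C) :
    lin (f ≫ g) = (lin g).comp (lin f) := rfl

theorem map_mul {A B : ArtDGA K} (f : A ⟶ B) (a b : A) : lin f (a * b) = lin f a * lin f b :=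
  Hom.map_mul f a b

theorem map_gr {A B : ArtDGA K} (f : A ⟶ B) {i : ℤ} {a : A} (h : a ∈ A.gr i) :
    lin f a ∈ B.gr i := Hom.map_gr f i a h

theorem map_d {A B : ArtDGA K} (f : A ⟶ B) (a : A) : lin f (A.d a) = B.d (lin f a) :=
  Hom.map_d f a

theorem map_parity {A B : ArtDGA K} (f : A ⟶ B) (a : A) :
    lin f (parity A.internal a) = parity B.internal (lin f a) :=
  onPieces_natural _ _ _ (fun _ _ h => map_gr f h) _ _ _ (fun i v => by simp) a

/-- `A.pow k` is the power `A ^ k` of the algebra `A` (and `A.pow 0 = A`). -/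
def pow (A : ArtDGA K) (k : ℕ) : Submodule K A := algPow K A k

theorem mul_mem_pow_succ (A : ArtDGA K) {k : ℕ} (a : A) {b : A} (hb : b ∈ A.pow (k + 1)) :
    a * b ∈ A.pow (k + 2) := Submodule.subset_span ⟨a, b, hb, rfl⟩

theorem pow_induction (A : ArtDGA K) {P : ℕ → A → Prop} (h1 : ∀ k ≤ 1, ∀ a, P k a)
    (mul : ∀ k a b, b ∈ A.pow (k + 1) → P (k + 1) b → P (k + 2) (a * b))
    (add : ∀ k a b, P k a → P k b → P k (a + b)) (smul : ∀ k (c : K) a, P k a → P k (c • a)) :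
    ∀ k, ∀ a ∈ A.pow k, P k a := by
  intro k
  induction k with
  | zero => exact fun a _ => h1 0 (by omega) a
  | succ k ih =>
    rcases k with _ | k
    · exact fun a _ => h1 1 (by omega) a
    · intro a ha
      refine Submodule.span_induction (p := fun a _ => P (k + 2) a) ?_ ?_ ?_ ?_ ha
      · rintro _ ⟨a, b, hb, rfl⟩
        exact mul k a b hb (ih b hb)
      · have := smul (k + 2) 0 _ (mul k 0 0 (zero_mem _) (ih 0 (zero_mem _)))
        simpa using this
      · exact fun a b _ _ ha hb => add _ a b ha hb
      · exact fun c a _ ha => smul _ c a ha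

theorem pow_succ_le (A : ArtDGA K) (k : ℕ) : A.pow (k + 1) ≤ A.pow k := by
  induction k with
  | zero => exact fun _ _ => trivial
  | succ k ih =>
    rcases k with _ | k
    · exact fun _ _ => trivial
    · refine Submodule.span_mono ?_
      rintro _ ⟨a, b, hb, rfl⟩
      exact ⟨a, b, ih hb, rfl⟩

theorem pow_anti (A : ArtDGA K) {j k : ℕ} (h : j ≤ k) : A.pow k ≤ A.pow j := by
  induction h with
  | refl => exact le_rfl
  | step _ ih => exact (A.pow_succ_le _).trans ih

theorem mul_mem_pow_add (A : ArtDGA K) {j k : ℕ} {a b : A} (ha : a ∈ A.pow j)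
    (hb : b ∈ A.pow k) : a * b ∈ A.pow (j + k) := by
  have key : ∀ j, ∀ a ∈ A.pow j, ∀ k, ∀ b ∈ A.pow k, a * b ∈ A.pow (j + k) := by
    refine A.pow_induction (P := fun j a => ∀ k, ∀ b ∈ A.pow k, a * b ∈ A.pow (j + k)) ?_ ?_ ?_ ?_
    · intro j hj a k b hb
      rcases k with _ | k
      · exact A.pow_anti (k := 1) (by omega) trivial
      · exact A.pow_anti (k := k + 2) (by omega) (A.mul_mem_pow_succ a hb)
    · intro j a c _ ih k b hb
      rw [mul_assoc]
      have h1 := ih k b hb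
      rw [show j + 1 + k = j + k + 1 by omega] at h1
      rw [show j + 2 + k = j + k + 2 by omega]
      exact A.mul_mem_pow_succ a h1
    · intro j a c ha hc k b hb
      rw [add_mul]
      exact add_mem (ha k b hb) (hc k b hb)
    · intro j c a ha k b hb
      rw [smul_mul_assoc]
      exact Submodule.smul_mem _ _ (ha k b hb)
  exact key j a ha k b hb

theorem map_pow {A B : ArtDGA K} (f : A ⟶ B) : ∀ k, ∀ a ∈ A.pow k, lin f a ∈ B.pow k := by
  refine A.pow_induction (P := fun k a => lin f a ∈ B.pow k) ?_ ?_ ?_ ?_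
  · exact fun k hk a => B.pow_anti (k := 1) hk trivial
  · intro k a b _ hb
    rw [map_mul]
    exact B.mul_mem_pow_succ _ hb
  · intro k a b ha hb
    rw [map_add]; exact add_mem ha hb
  · intro k c a ha
    rw [map_smul]; exact Submodule.smul_mem _ _ ha

theorem parity_mul (A : ArtDGA K) (a b : A) :
    parity A.internal (a * b) = parity A.internal a * parity A.internal b := by
  refine graded_induction A.internal (P := fun a => parity A.internal (a * b) =
    parity A.internal a * parity A.internal b) a ?_ ?_
  · intro i a ha
    refine graded_induction A.internal (P := fun b => parity A.internal (a * b) =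
      parity A.internal a * parity A.internal b) b ?_ ?_
    · intro j b hb
      rw [parity_apply _ ha, parity_apply _ hb, parity_apply _ (A.mul_mem i j a b ha hb),
        zpow_add₀ (by simp), smul_mul_smul_comm]
    · intro b c hb hc
      rw [mul_add, map_add, map_add, mul_add, hb, hc]
  · intro a c ha hc
    rw [add_mul, map_add, map_add, add_mul, ha, hc]

theorem d_parity (A : ArtDGA K) (a : A) :
    A.d (parity A.internal a) = - parity A.internal (A.d a) := by
  refine graded_ext A.internal (f := A.d.comp (parity A.internal))
    (g := - (parity A.internal).comp A.d) ?_ a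
  intro i a ha
  simp [parity_apply _ ha, parity_apply _ (A.d_mem i a ha), zpow_add₀]

theorem d_mul (A : ArtDGA K) (a b : A) :
    A.d (a * b) = A.d a * b + parity A.internal a * A.d b := by
  refine graded_induction A.internal (P := fun a => A.d (a * b) =
    A.d a * b + parity A.internal a * A.d b) a ?_ ?_
  · intro i a ha
    rw [A.leibniz i a b ha, parity_apply _ ha, smul_mul_assoc]
  · intro a c ha hc
    simp only [add_mul, map_add, ha, hc]
    abel

theorem parity_pow (A : ArtDGA K) : ∀ k, ∀ a ∈ A.pow k, parity A.internal a ∈ A.pow k := by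
  refine A.pow_induction (P := fun k a => parity A.internal a ∈ A.pow k) ?_ ?_ ?_ ?_
  · exact fun k hk a => A.pow_anti (k := 1) hk trivial
  · intro k a b _ hb
    rw [parity_mul]
    exact A.mul_mem_pow_succ _ hb
  · intro k a b ha hb
    rw [map_add]; exact add_mem ha hb
  · intro k c a ha
    rw [map_smul]; exact Submodule.smul_mem _ _ ha

theorem d_pow (A : ArtDGA K) : ∀ k, ∀ a ∈ A.pow k, A.d a ∈ A.pow k := by
  refine A.pow_induction (P := fun k a => A.d a ∈ A.pow k) ?_ ?_ ?_ ?_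
  · exact fun k hk a => A.pow_anti (k := 1) hk trivial
  · intro k a b h hb
    rw [d_mul]
    exact add_mem (A.mul_mem_pow_succ _ h) (A.mul_mem_pow_succ _ hb)
  · intro k a b ha hb
    rw [map_add]; exact add_mem ha hb
  · intro k c a ha
    rw [map_smul]; exact Submodule.smul_mem _ _ ha

theorem proj_mul (A : ArtDGA K) {i : ℤ} {a : A} (ha : a ∈ A.gr i) (n : ℤ) (b : A) :
    proj A.internal n (a * b) = a * proj A.internal (n - i) b := by
  refine graded_induction A.internal (P := fun b => proj A.internal n (a * b) =
    a * proj A.internal (n - i) b) b ?_ ?_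
  · intro j b hb
    have hab := A.mul_mem i j a b ha hb
    by_cases h : i + j = n
    · obtain rfl : j = n - i := by omega
      rw [proj_same _ hb]
      rw [h] at hab
      exact proj_same _ hab
    · rw [proj_ne _ h hab, proj_ne _ (by omega) hb, mul_zero]
  · intro b c hb hc
    simp only [mul_add, map_add, hb, hc]

theorem proj_pow (A : ArtDGA K) :
    ∀ k, ∀ a ∈ A.pow k, ∀ n, proj A.internal n a ∈ A.pow k := by
  refine A.pow_induction (P := fun k a => ∀ n, proj A.internal n a ∈ A.pow k) ?_ ?_ ?_ ?_
  · exact fun k hk a n => A.pow_anti (k := 1) hk trivial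
  · intro k a b _ hb n
    refine graded_induction A.internal
      (P := fun a => proj A.internal n (a * b) ∈ A.pow (k + 2)) a ?_ ?_
    · intro i a ha
      rw [A.proj_mul ha]
      exact A.mul_mem_pow_succ _ (hb _)
    · intro a c ha hc
      rw [add_mul, map_add]; exact add_mem ha hc
  · intro k a b ha hb n
    rw [map_add]; exact add_mem (ha n) (hb n)
  · intro k c a ha n
    rw [map_smul]; exact Submodule.smul_mem _ _ (ha n)

end ArtDGA

section Convolution

variable {R : Type u} [NonUnitalRing R]

/-- The Cauchy product of two sequences of coefficients. -/
def conv (p q : ℕ → R) (n : ℕ) : R := ∑ ij ∈ Finset.HasAntidiagonal.antidiagonal n, p ij.1 * q ij.2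

theorem conv_add (p q r : ℕ → R) : conv p (q + r) = conv p q + conv p r := by
  funext n; simp [conv, mul_add, Finset.sum_add_distrib]

theorem add_conv (p q r : ℕ → R) : conv (p + q) r = conv p r + conv q r := by
  funext n; simp [conv, add_mul, Finset.sum_add_distrib]

theorem conv_zero (p : ℕ → R) : conv p 0 = 0 := by
  funext n; simp [conv]

theorem zero_conv (p : ℕ → R) : conv 0 p = 0 := by
  funext n; simp [conv]

theorem conv_assoc (p q r : ℕ → R) : conv (conv p q) r = conv p (conv q r) := by
  funext n
  simp only [conv, Finset.sum_mul, Finset.mul_sum, Finset.sum_sigma']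
  refine Finset.sum_nbij' (fun x => ⟨(x.2.1, x.2.2 + x.1.2), (x.2.2, x.1.2)⟩)
    (fun x => ⟨(x.1.1 + x.2.1, x.2.2), (x.1.1, x.2.1)⟩) ?_ ?_ ?_ ?_ ?_
  · rintro ⟨⟨a, b⟩, ⟨c, e⟩⟩ h
    simp only [Finset.mem_sigma, Finset.HasAntidiagonal.mem_antidiagonal] at h ⊢
    change a + b = n ∧ c + e = a at h
    exact ⟨by change c + (e + b) = n; omega, trivial⟩
  · rintro ⟨⟨a, b⟩, ⟨c, e⟩⟩ h
    simp only [Finset.mem_sigma, Finset.HasAntidiagonal.mem_antidiagonal] at h ⊢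
    change a + b = n ∧ c + e = b at h
    exact ⟨by change a + c + e = n; omega, trivial⟩
  · rintro ⟨⟨a, b⟩, ⟨c, e⟩⟩ h
    simp only [Finset.mem_sigma, Finset.HasAntidiagonal.mem_antidiagonal] at h
    obtain ⟨h1, rfl⟩ := h
    rfl
  · rintro ⟨⟨a, b⟩, ⟨c, e⟩⟩ h
    simp only [Finset.mem_sigma, Finset.HasAntidiagonal.mem_antidiagonal] at h
    obtain ⟨h1, rfl⟩ := h
    rfl
  · rintro ⟨⟨a, b⟩, ⟨c, e⟩⟩ _
    exact mul_assoc _ _ _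

/-- The coefficients of the derivative of `∑ pₙ tⁿ`. -/
def deriv (p : ℕ → R) (n : ℕ) : R := (n + 1) • p (n + 1)

theorem deriv_conv (p q : ℕ → R) : deriv (conv p q) = conv (deriv p) q + conv p (deriv q) := by
  funext n
  have h : deriv (conv p q) n
      = ∑ ij ∈ Finset.HasAntidiagonal.antidiagonal (n + 1), ij.1 • (p ij.1 * q ij.2)
        + ∑ ij ∈ Finset.HasAntidiagonal.antidiagonal (n + 1), ij.2 • (p ij.1 * q ij.2) := by
    rw [← Finset.sum_add_distrib]
    simp only [deriv, conv, Finset.smul_sum]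
    refine Finset.sum_congr rfl fun ij hij => ?_
    rw [← add_smul, Finset.HasAntidiagonal.mem_antidiagonal.1 hij]
  rw [h, Finset.Nat.sum_antidiagonal_succ, Finset.Nat.sum_antidiagonal_succ']
  simp [conv, deriv, smul_mul_assoc, mul_smul_comm]

theorem sum_conv {p q : ℕ → R} {N : ℕ} (hp : ∀ n, N ≤ n → p n = 0) (hq : ∀ n, N ≤ n → q n = 0) :
    ∑ n ∈ Finset.range (N + N), conv p q n
      = (∑ n ∈ Finset.range N, p n) * ∑ n ∈ Finset.range N, q n := by
  rw [Finset.sum_mul_sum, ← Finset.sum_product']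
  rw [← Finset.sum_fiberwise_of_maps_to (s := Finset.range N ×ˢ Finset.range N)
    (t := Finset.range (N + N)) (g := fun x => x.1 + x.2)]
  · refine Finset.sum_congr rfl fun n _ => ?_
    symm
    refine Finset.sum_subset ?_ ?_
    · intro x hx
      simp only [Finset.mem_filter] at hx
      simpa using hx.2
    · intro x hx hx'
      simp only [Finset.mem_filter, Finset.mem_product, Finset.mem_range,
        Finset.HasAntidiagonal.mem_antidiagonal] at hx hx'
      by_cases h1 : N ≤ x.1
      · rw [hp _ h1, zero_mul]
      · rw [hq _ (by omega), mul_zero]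
  · intro x hx
    simp only [Finset.mem_product, Finset.mem_range] at hx ⊢
    omega

end Convolution

namespace ArtDGA

section Path

variable (A : ArtDGA K) (ε : ℝ)

/-- The underlying vector space of `A[t, dt]_ε = A ⊕ ⨁_{n > 0} A ^ ⌈n ε⌉ ⊗ (K tⁿ ⊕ K tⁿ⁻¹ dt)`.
A pair of sequences `(p, q)` stands for `∑ pₙ tⁿ + ∑ qₙ tⁿ dt`. As `A` is nilpotent and `ε > 0`,
the sequences satisfying the conditions below are finitely supported. -/
noncomputable def pathSubmodule : Submodule K ((ℕ → A) × (ℕ → A)) where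
  carrier := {x | (∀ n : ℕ, x.1 n ∈ A.pow ⌈(n : ℝ) * ε⌉₊) ∧
    ∀ n : ℕ, x.2 n ∈ A.pow ⌈((n + 1 : ℕ) : ℝ) * ε⌉₊}
  add_mem' := fun hx hy => ⟨fun n => add_mem (hx.1 n) (hy.1 n), fun n => add_mem (hx.2 n) (hy.2 n)⟩
  zero_mem' := ⟨fun _ => zero_mem _, fun _ => zero_mem _⟩
  smul_mem' := fun c _ hx =>
    ⟨fun n => Submodule.smul_mem _ c (hx.1 n), fun n => Submodule.smul_mem _ c (hx.2 n)⟩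

/-- The underlying vector space of `A[t, dt]_ε`. -/
abbrev Path : Type u := A.pathSubmodule ε

variable {A ε}

theorem weight_mul {a b : A} {x y z : ℝ} (h : z ≤ x + y) (ha : a ∈ A.pow ⌈x⌉₊)
    (hb : b ∈ A.pow ⌈y⌉₊) : a * b ∈ A.pow ⌈z⌉₊ := by
  refine A.pow_anti ?_ (A.mul_mem_pow_add ha hb)
  exact (Nat.ceil_mono h).trans (Nat.ceil_add_le x y)

theorem conv_mem_left {p p' : ℕ → A} (hp : ∀ n : ℕ, p n ∈ A.pow ⌈(n : ℝ) * ε⌉₊)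
    (hp' : ∀ n : ℕ, p' n ∈ A.pow ⌈(n : ℝ) * ε⌉₊) (n : ℕ) :
    conv p p' n ∈ A.pow ⌈(n : ℝ) * ε⌉₊ := by
  refine Submodule.sum_mem _ fun ij hij => weight_mul ?_ (hp _) (hp' _)
  rw [← Finset.HasAntidiagonal.mem_antidiagonal.1 hij]
  push_cast; linarith

theorem conv_mem_right {p q : ℕ → A} (hp : ∀ n : ℕ, p n ∈ A.pow ⌈(n : ℝ) * ε⌉₊)
    (hq : ∀ n : ℕ, q n ∈ A.pow ⌈((n + 1 : ℕ) : ℝ) * ε⌉₊) (n : ℕ) :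
    conv p q n ∈ A.pow ⌈((n + 1 : ℕ) : ℝ) * ε⌉₊ := by
  refine Submodule.sum_mem _ fun ij hij => weight_mul ?_ (hp _) (hq _)
  rw [← Finset.HasAntidiagonal.mem_antidiagonal.1 hij]
  push_cast; linarith

theorem conv_mem_right' {p q : ℕ → A} (hp : ∀ n : ℕ, p n ∈ A.pow ⌈(n : ℝ) * ε⌉₊)
    (hq : ∀ n : ℕ, q n ∈ A.pow ⌈((n + 1 : ℕ) : ℝ) * ε⌉₊) (n : ℕ) :
    conv q p n ∈ A.pow ⌈((n + 1 : ℕ) : ℝ) * ε⌉₊ := by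
  refine Submodule.sum_mem _ fun ij hij => weight_mul ?_ (hq _) (hp _)
  rw [← Finset.HasAntidiagonal.mem_antidiagonal.1 hij]
  push_cast; linarith

/-- The parity operator applied to a sequence of coefficients. -/
noncomputable def par (p : ℕ → A) (n : ℕ) : A := parity A.internal (p n)

theorem par_add (p q : ℕ → A) : par (p + q) = par p + par q := by
  funext n; simp [par]

theorem par_zero : par (0 : ℕ → A) = 0 := by
  funext n; simp [par]

theorem par_conv (p q : ℕ → A) : par (conv p q) = conv (par p) (par q) := by
  funext n; simp [par, conv, parity_mul]

/-- The product `(p + q dt) (r + s dt) = p r + (p s + q (par r)) dt` of `A ⊗ K[t, dt]`: moving `dt`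
past an element of degree `i` gives the sign `(-1) ^ i`, and `dt dt = 0`. -/
noncomputable instance : Mul (A.Path ε) where
  mul x y := ⟨(conv x.1.1 y.1.1, conv x.1.1 y.1.2 + conv x.1.2 (par y.1.1)),
    fun n => conv_mem_left x.2.1 y.2.1 n,
    fun n => add_mem (conv_mem_right x.2.1 y.2.2 n)
      (conv_mem_right' (fun m => A.parity_pow _ _ (y.2.1 m)) x.2.2 n)⟩

theorem path_mul_fst (x y : A.Path ε) : (x * y).1.1 = conv x.1.1 y.1.1 := rfl

theorem path_mul_snd (x y : A.Path ε) :
    (x * y).1.2 = conv x.1.1 y.1.2 + conv x.1.2 (par y.1.1) := rfl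

theorem path_ext {x y : A.Path ε} (h1 : x.1.1 = y.1.1) (h2 : x.1.2 = y.1.2) : x = y :=
  Subtype.ext (Prod.ext h1 h2)

noncomputable instance : NonUnitalRing (A.Path ε) :=
  { (inferInstance : AddCommGroup (A.Path ε)), (inferInstance : Mul (A.Path ε)) with
    left_distrib := fun x y z => path_ext (conv_add _ _ _) (by
      change conv x.1.1 (y.1.2 + z.1.2) + conv x.1.2 (par (y.1.1 + z.1.1)) =
        conv x.1.1 y.1.2 + conv x.1.2 (par y.1.1) + (conv x.1.1 z.1.2 + conv x.1.2 (par z.1.1))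
      rw [conv_add, par_add, conv_add]; abel)
    right_distrib := fun x y z => path_ext (add_conv _ _ _) (by
      change conv (x.1.1 + y.1.1) z.1.2 + conv (x.1.2 + y.1.2) (par z.1.1) =
        conv x.1.1 z.1.2 + conv x.1.2 (par z.1.1) + (conv y.1.1 z.1.2 + conv y.1.2 (par z.1.1))
      rw [add_conv, add_conv]; abel)
    zero_mul := fun x => path_ext (zero_conv _) (by
      change conv 0 x.1.2 + conv 0 (par x.1.1) = 0
      rw [zero_conv, zero_conv, add_zero])
    mul_zero := fun x => path_ext (conv_zero _) (by
      change conv x.1.1 0 + conv x.1.2 (par 0) = 0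
      rw [par_zero, conv_zero, conv_zero, add_zero])
    mul_assoc := fun x y z => path_ext (conv_assoc _ _ _) (by
      simp only [path_mul_fst, path_mul_snd, conv_add, add_conv, conv_assoc, par_conv]
      abel) }

instance : IsScalarTower K (A.Path ε) (A.Path ε) where
  smul_assoc c x y := path_ext
    (by
      change conv (c • x.1.1) y.1.1 = c • conv x.1.1 y.1.1
      funext n; simp [conv, Finset.smul_sum, smul_mul_assoc])
    (by
      change conv (c • x.1.1) y.1.2 + conv (c • x.1.2) (par y.1.1) =
        c • (conv x.1.1 y.1.2 + conv x.1.2 (par y.1.1))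
      funext n; simp [conv, Finset.smul_sum, smul_mul_assoc])

instance : SMulCommClass K (A.Path ε) (A.Path ε) where
  smul_comm c x y := path_ext
    (by
      change c • conv x.1.1 y.1.1 = conv x.1.1 (c • y.1.1)
      funext n; simp [conv, Finset.smul_sum, mul_smul_comm])
    (by
      change c • (conv x.1.1 y.1.2 + conv x.1.2 (par y.1.1)) =
        conv x.1.1 (c • y.1.2) + conv x.1.2 (par (c • y.1.1))
      funext n; simp [conv, par, Finset.smul_sum, mul_smul_comm])

variable (A ε)

/-- The grading of `A[t, dt]_ε`: `t` has degree `0` and `dt` has degree `1`. -/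
noncomputable def pathGr (i : ℤ) : Submodule K (A.Path ε) where
  carrier := {x | (∀ n, x.1.1 n ∈ A.gr i) ∧ ∀ n, x.1.2 n ∈ A.gr (i - 1)}
  add_mem' := fun hx hy => ⟨fun n => add_mem (hx.1 n) (hy.1 n), fun n => add_mem (hx.2 n) (hy.2 n)⟩
  zero_mem' := ⟨fun _ => zero_mem _, fun _ => zero_mem _⟩
  smul_mem' := fun c _ hx =>
    ⟨fun n => Submodule.smul_mem _ c (hx.1 n), fun n => Submodule.smul_mem _ c (hx.2 n)⟩

/-- The projection of `A[t, dt]_ε` onto its piece of degree `i`. -/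
noncomputable def pathProj (i : ℤ) : A.Path ε →ₗ[K] A.Path ε where
  toFun x := ⟨(fun n => proj A.internal i (x.1.1 n), fun n => proj A.internal (i - 1) (x.1.2 n)),
    fun n => A.proj_pow _ _ (x.2.1 n) _, fun n => A.proj_pow _ _ (x.2.2 n) _⟩
  map_add' _ _ := path_ext (funext fun _ => map_add _ _ _) (funext fun _ => map_add _ _ _)
  map_smul' _ _ := path_ext (funext fun _ => map_smul _ _ _) (funext fun _ => map_smul _ _ _)

theorem path_internal : DirectSum.IsInternal (A.pathGr ε) := by
  obtain ⟨s, hs⟩ := exists_finset_proj A.internal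
  have hs' : s ⊆ s ∪ s.image (· + 1) := Finset.subset_union_left
  refine isInternal_of_proj (A.pathProj ε) (s ∪ s.image (· + 1)) ?_ ?_ ?_ ?_
  · exact fun i x => ⟨fun n => proj_mem _ _ _, fun n => proj_mem _ _ _⟩
  · exact fun i x hx => path_ext (funext fun n => proj_same _ (hx.1 n))
      (funext fun n => proj_same _ (hx.2 n))
  · exact fun i j hij x hx => path_ext (funext fun n => proj_ne _ hij (hx.1 n))
      (funext fun n => proj_ne _ (by omega) (hx.2 n))
  · intro x
    have h1 : (∑ i ∈ s ∪ s.image (· + 1), A.pathProj ε i x).1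
        = ∑ i ∈ s ∪ s.image (· + 1), (A.pathProj ε i x).1 := by
      rw [← Submodule.subtype_apply, map_sum]; rfl
    refine path_ext ?_ ?_
    · rw [h1, Prod.fst_sum]
      funext n
      rw [Finset.sum_apply]
      exact hs _ hs' _
    · rw [h1, Prod.snd_sum]
      funext n
      rw [Finset.sum_apply]
      have h2 : s ⊆ (s ∪ s.image (· + 1)).image (· - 1) := by
        intro i hi
        simp only [Finset.mem_image, Finset.mem_union]
        exact ⟨i + 1, Or.inr ⟨i, hi, rfl⟩, by omega⟩
      have h3 := hs _ h2 (x.1.2 n)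
      rw [Finset.sum_image (fun a _ b _ h => by simpa using h)] at h3
      exact h3

/-- The differential of `A[t, dt]_ε`:
`d (a tⁿ) = (d a) tⁿ + (-1) ^ i n a tⁿ⁻¹ dt` and `d (a tⁿ dt) = (d a) tⁿ dt`, for `a` of
degree `i`. -/
noncomputable def pathD : A.Path ε →ₗ[K] A.Path ε where
  toFun x := ⟨(fun n => A.d (x.1.1 n), fun n => par (deriv x.1.1) n + A.d (x.1.2 n)),
    fun n => A.d_pow _ _ (x.2.1 n),
    fun n => add_mem (A.parity_pow _ _ (nsmul_mem (x.2.1 (n + 1)) _)) (A.d_pow _ _ (x.2.2 n))⟩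
  map_add' x y := path_ext (funext fun n => map_add _ _ _) (by
    funext n
    change par (deriv (x.1.1 + y.1.1)) n + A.d (x.1.2 n + y.1.2 n) =
      (par (deriv x.1.1) n + A.d (x.1.2 n)) + (par (deriv y.1.1) n + A.d (y.1.2 n))
    simp only [par, deriv, Pi.add_apply, smul_add, map_add]; abel)
  map_smul' c x := path_ext (funext fun n => map_smul _ _ _) (by
    funext n
    change par (deriv (c • x.1.1)) n + A.d (c • x.1.2 n) =
      c • (par (deriv x.1.1) n + A.d (x.1.2 n))
    simp only [par, deriv, Pi.smul_apply, map_smul, smul_add, map_nsmul, smul_comm c])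

theorem pathD_fst (x : A.Path ε) : (A.pathD ε x).1.1 = fun n => A.d (x.1.1 n) := rfl

theorem pathD_snd (x : A.Path ε) :
    (A.pathD ε x).1.2 = fun n => par (deriv x.1.1) n + A.d (x.1.2 n) := rfl

theorem exists_bound (hε : 0 < ε) :
    ∃ N : ℕ, ∀ x : A.Path ε, (∀ n, N ≤ n → x.1.1 n = 0) ∧ ∀ n, N ≤ n → x.1.2 n = 0 := by
  obtain ⟨m, hm⟩ := A.nilpotent
  obtain ⟨N, hN⟩ := exists_nat_ge ((m : ℝ) / ε)
  have key : ∀ n : ℕ, N ≤ n → ∀ a ∈ A.pow ⌈(n : ℝ) * ε⌉₊, a = 0 := by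
    intro n hn a ha
    have h1 : m ≤ ⌈(n : ℝ) * ε⌉₊ := by
      have h2 : (m : ℝ) ≤ (n : ℝ) * ε := by
        rw [div_le_iff₀ hε] at hN
        have : (N : ℝ) ≤ n := by exact_mod_cast hn
        nlinarith
      exact_mod_cast h2.trans (Nat.le_ceil _)
    have h3 := A.pow_anti h1 ha
    rw [pow, hm] at h3
    simpa using h3
  exact ⟨N, fun x => ⟨fun n hn => key n hn _ (x.2.1 n),
    fun n hn => key (n + 1) (by omega) _ (x.2.2 n)⟩⟩

theorem path_finite (hε : 0 < ε) : FiniteDimensional K (A.Path ε) := by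
  obtain ⟨N, hN⟩ := A.exists_bound ε hε
  let φ : A.Path ε →ₗ[K] (Fin N → A) × (Fin N → A) :=
    { toFun := fun x => (fun n => x.1.1 n, fun n => x.1.2 n)
      map_add' := fun _ _ => rfl
      map_smul' := fun _ _ => rfl }
  refine FiniteDimensional.of_injective φ ?_
  intro x y hxy
  refine path_ext ?_ ?_
  · funext n
    by_cases hn : n < N
    · exact congrFun (congrArg Prod.fst hxy) ⟨n, hn⟩
    · rw [(hN x).1 n (by omega), (hN y).1 n (by omega)]
  · funext n
    by_cases hn : n < N
    · exact congrFun (congrArg Prod.snd hxy) ⟨n, hn⟩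
    · rw [(hN x).2 n (by omega), (hN y).2 n (by omega)]

theorem path_pow : ∀ k, ∀ x ∈ algPow K (A.Path ε) k,
    (∀ n, x.1.1 n ∈ A.pow k) ∧ ∀ n, x.1.2 n ∈ A.pow k := by
  intro k
  induction k with
  | zero => exact fun _ _ => ⟨fun _ => trivial, fun _ => trivial⟩
  | succ k ih =>
    rcases k with _ | k
    · exact fun _ _ => ⟨fun _ => trivial, fun _ => trivial⟩
    · intro x hx
      refine Submodule.span_induction
        (p := fun x _ => (∀ n, x.1.1 n ∈ A.pow (k + 2)) ∧ ∀ n, x.1.2 n ∈ A.pow (k + 2))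
        ?_ ?_ ?_ ?_ hx
      · rintro _ ⟨a, b, hb, rfl⟩
        obtain ⟨h1, h2⟩ := ih b hb
        refine ⟨fun n => ?_, fun n => add_mem ?_ ?_⟩
        · change conv a.1.1 b.1.1 n ∈ _
          exact Submodule.sum_mem _ fun ij _ => A.mul_mem_pow_succ _ (h1 _)
        · exact Submodule.sum_mem _ fun ij _ => A.mul_mem_pow_succ _ (h2 _)
        · exact Submodule.sum_mem _ fun ij _ => A.mul_mem_pow_succ _ (A.parity_pow _ _ (h1 _))
      · exact ⟨fun _ => zero_mem _, fun _ => zero_mem _⟩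
      · exact fun x y _ _ hx hy =>
          ⟨fun n => add_mem (hx.1 n) (hy.1 n), fun n => add_mem (hx.2 n) (hy.2 n)⟩
      · exact fun c x _ hx => ⟨fun n => Submodule.smul_mem _ c (hx.1 n),
          fun n => Submodule.smul_mem _ c (hx.2 n)⟩

theorem path_parity {i : ℤ} {x : A.Path ε} (hx : x ∈ A.pathGr ε i) :
    par x.1.1 = ((-1 : K) ^ i) • x.1.1 ∧ par x.1.2 = ((-1 : K) ^ (i - 1)) • x.1.2 :=
  ⟨funext fun n => parity_apply _ (hx.1 n), funext fun n => parity_apply _ (hx.2 n)⟩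

variable {A} in
theorem conv_swap {i j : ℤ} {p q : ℕ → A} (hp : ∀ n, p n ∈ A.gr i) (hq : ∀ n, q n ∈ A.gr j) :
    conv p q = ((-1 : K) ^ (i * j)) • conv q p := by
  funext n
  have h : conv q p n = ∑ ij ∈ Finset.HasAntidiagonal.antidiagonal n, q ij.2 * p ij.1 :=
    (Finset.Nat.sum_antidiagonal_swap (f := fun ij => q ij.1 * p ij.2)).symm
  rw [Pi.smul_apply, h, Finset.smul_sum]
  exact Finset.sum_congr rfl fun ij _ => A.graded_comm i j _ _ (hp _) (hq _)

variable {A} in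
theorem d_conv (p q : ℕ → A) : (fun n => A.d (conv p q n)) =
    conv (fun n => A.d (p n)) q + conv (par p) (fun n => A.d (q n)) := by
  funext n
  simp [conv, par, d_mul, Finset.sum_add_distrib]

theorem neg_one_zpow_self (i : ℤ) : ((-1 : K) ^ i) * ((-1 : K) ^ i) = 1 := by
  rw [← mul_zpow]; simp

theorem path_graded_comm (i j : ℤ) (x y : A.Path ε) (hx : x ∈ A.pathGr ε i)
    (hy : y ∈ A.pathGr ε j) : x * y = ((-1 : K) ^ (i * j)) • (y * x) := by
  refine path_ext (conv_swap hx.1 hy.1) ?_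
  change conv x.1.1 y.1.2 + conv x.1.2 (par y.1.1) =
    ((-1 : K) ^ (i * j)) • (conv y.1.1 x.1.2 + conv y.1.2 (par x.1.1))
  have smul_conv : ∀ (c : K) (p q : ℕ → A), conv p (c • q) = c • conv p q := by
    intro c p q; funext n; simp [conv, Finset.smul_sum, mul_smul_comm]
  rw [(A.path_parity ε hx).1, (A.path_parity ε hy).1, smul_conv, smul_conv,
    conv_swap hx.1 hy.2, conv_swap hx.2 hy.1, smul_add, smul_smul, smul_smul, add_comm]
  congr 2
  · rw [sub_mul, one_mul, zpow_sub₀ (by simp), mul_div_assoc', mul_comm, mul_div_assoc,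
      div_self (zpow_ne_zero _ (by simp)), mul_one]
  · rw [mul_sub, mul_one, zpow_sub₀ (by simp), div_eq_mul_inv, ← inv_zpow]
    norm_num

theorem path_leibniz (i : ℤ) (x y : A.Path ε) (hx : x ∈ A.pathGr ε i) :
    A.pathD ε (x * y) = A.pathD ε x * y + ((-1 : K) ^ i) • (x * A.pathD ε y) := by
  have conv_smul : ∀ (c : K) (p q : ℕ → A), conv (c • p) q = c • conv p q := by
    intro c p q; funext n; simp [conv, Finset.smul_sum, smul_mul_assoc]
  refine path_ext ?_ ?_
  · change (fun n => A.d (conv x.1.1 y.1.1 n)) = conv (fun n => A.d (x.1.1 n)) y.1.1 +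
      ((-1 : K) ^ i) • conv x.1.1 (fun n => A.d (y.1.1 n))
    rw [d_conv, (A.path_parity ε hx).1, conv_smul]
  · change par (deriv (conv x.1.1 y.1.1)) + (fun n => A.d ((conv x.1.1 y.1.2 +
        conv x.1.2 (par y.1.1)) n)) =
      (conv (fun n => A.d (x.1.1 n)) y.1.2 +
        conv (par (deriv x.1.1) + fun n => A.d (x.1.2 n)) (par y.1.1)) +
      ((-1 : K) ^ i) • (conv x.1.1 (par (deriv y.1.1) + fun n => A.d (y.1.2 n)) +
        conv x.1.2 (par fun n => A.d (y.1.1 n)))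
    have e1 : (fun n => A.d ((conv x.1.1 y.1.2 + conv x.1.2 (par y.1.1)) n)) =
        (fun n => A.d (conv x.1.1 y.1.2 n)) + fun n => A.d (conv x.1.2 (par y.1.1) n) := by
      funext n; simp
    have e2 : (fun n => A.d (par y.1.1 n)) = - par fun n => A.d (y.1.1 n) := by
      funext n; exact A.d_parity _
    have e3 : ∀ p q : ℕ → A, conv p (-q) = - conv p q := by
      intro p q; funext n; simp [conv]
    have e4 : ((-1 : K) ^ (i - 1)) = - ((-1 : K) ^ i) := by
      rw [zpow_sub₀ (by simp), zpow_one, div_neg, div_one]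
    rw [e1, d_conv, d_conv, e2, e3, (A.path_parity ε hx).1, (A.path_parity ε hx).2, deriv_conv,
      par_add, par_conv, par_conv, (A.path_parity ε hx).1, conv_smul, conv_smul, conv_smul, e4,
      conv_add, add_conv, smul_add, smul_add, neg_smul]
    abel

/-- The object `A[t, dt]_ε` of the category `C`, for `ε > 0`. -/
noncomputable def path (hε : 0 < ε) : ArtDGA K where
  carrier := A.Path ε
  gr := A.pathGr ε
  internal := A.path_internal ε
  mul_mem := by
    intro i j x y hx hy
    refine ⟨fun n => ?_, fun n => add_mem ?_ ?_⟩
    · change conv x.1.1 y.1.1 n ∈ _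
      exact Submodule.sum_mem _ fun ij _ => A.mul_mem _ _ _ _ (hx.1 _) (hy.1 _)
    · refine Submodule.sum_mem _ fun ij _ => ?_
      rw [show i + j - 1 = i + (j - 1) by ring]
      exact A.mul_mem _ _ _ _ (hx.1 _) (hy.2 _)
    · refine Submodule.sum_mem _ fun ij _ => ?_
      rw [show i + j - 1 = i - 1 + j by ring, (A.path_parity ε hy).1]
      exact A.mul_mem _ _ _ _ (hx.2 _) (Submodule.smul_mem _ _ (hy.1 _))
  graded_comm := A.path_graded_comm ε
  d := A.pathD ε
  d_mem := by
    intro i x hx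
    refine ⟨fun n => A.d_mem _ _ (hx.1 n), fun n => add_mem ?_ ?_⟩
    · rw [add_sub_cancel_right]
      change parity A.internal (deriv x.1.1 n) ∈ _
      have h : deriv x.1.1 n ∈ A.gr i := nsmul_mem (hx.1 (n + 1)) _
      rw [parity_apply _ h]
      exact Submodule.smul_mem _ _ h
    · have h := A.d_mem _ _ (hx.2 n)
      rwa [sub_add_cancel, ← add_sub_cancel_right i 1] at h
  d_d := by
    intro x
    refine path_ext (funext fun n => A.d_d _) ?_
    funext n
    change parity A.internal ((n + 1) • A.d (x.1.1 (n + 1))) +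
      A.d (parity A.internal ((n + 1) • x.1.1 (n + 1)) + A.d (x.1.2 n)) = 0
    rw [map_add, A.d_d, d_parity, map_nsmul A.d]
    abel
  leibniz := A.path_leibniz ε
  finite := A.path_finite ε hε
  nilpotent := by
    obtain ⟨m, hm⟩ := A.nilpotent
    refine ⟨m, (Submodule.eq_bot_iff _).2 fun x hx => ?_⟩
    obtain ⟨h1, h2⟩ := A.path_pow ε m x hx
    simp only [pow, hm, Submodule.mem_bot] at h1 h2
    exact path_ext (funext h1) (funext h2)

variable {ε}

/-- The evaluation `e₀ : A[t, dt]_ε ⟶ A` at `t = 0`, `dt = 0`. -/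
noncomputable def evalZero (hε : 0 < ε) : A.path ε hε ⟶ A :=
  Hom.mk (A := A.path ε hε) (B := A)
    { toFun := fun x : A.Path ε => x.1.1 0
      map_add' := fun _ _ => rfl
      map_smul' := fun _ _ => rfl }
    (fun x y => by
      change conv x.1.1 y.1.1 0 = x.1.1 0 * y.1.1 0
      simp [conv])
    (fun i x hx => hx.1 0)
    (fun x => rfl)

/-- A bound for the degree in `t` of the elements of `A[t, dt]_ε`. -/
noncomputable def bound (hε : 0 < ε) : ℕ := (A.exists_bound ε hε).choose

/-- The linear map `∑ pₙ tⁿ + ∑ qₙ tⁿ dt ↦ ∑ pₙ`. -/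
noncomputable def evalOneLin (hε : 0 < ε) : A.Path ε →ₗ[K] A where
  toFun x := ∑ n ∈ Finset.range (A.bound hε), x.1.1 n
  map_add' _ _ := Finset.sum_add_distrib
  map_smul' c x :=
    (Finset.smul_sum (r := c) (f := fun n => x.1.1 n) (s := Finset.range (A.bound hε))).symm

theorem evalOneLin_apply (hε : 0 < ε) (x : A.Path ε) :
    A.evalOneLin hε x = ∑ n ∈ Finset.range (A.bound hε), x.1.1 n := rfl

theorem evalOneLin_mul (hε : 0 < ε) (x y : A.Path ε) :
    A.evalOneLin hε (x * y) = A.evalOneLin hε x * A.evalOneLin hε y := by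
  have hb := (A.exists_bound ε hε).choose_spec
  rw [evalOneLin_apply, evalOneLin_apply, evalOneLin_apply]
  refine Eq.trans ?_ (sum_conv (hb x).1 (hb y).1)
  refine Finset.sum_subset (fun n hn => ?_) (fun n _ hn => ?_)
  · simp only [Finset.mem_range] at hn ⊢
    exact Nat.lt_add_right _ hn
  · exact (hb (x * y)).1 n (by simpa [bound] using hn)

theorem evalOneLin_gr (hε : 0 < ε) (i : ℤ) (x : A.Path ε) (hx : x ∈ A.pathGr ε i) :
    A.evalOneLin hε x ∈ A.gr i := by
  rw [evalOneLin_apply]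
  exact Submodule.sum_mem _ fun n _ => hx.1 n

theorem evalOneLin_d (hε : 0 < ε) (x : A.Path ε) :
    A.evalOneLin hε (A.pathD ε x) = A.d (A.evalOneLin hε x) := by
  rw [evalOneLin_apply, evalOneLin_apply, map_sum, pathD_fst]

/-- The evaluation `e₁ : A[t, dt]_ε ⟶ A` at `t = 1`, `dt = 0`: the sum `∑ pₙ` of all the
coefficients (they vanish for `n ≥ A.bound hε`). -/
noncomputable def evalOne (hε : 0 < ε) : A.path ε hε ⟶ A :=
  Hom.mk (A := A.path ε hε) (B := A) (A.evalOneLin hε) (A.evalOneLin_mul hε)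
    (A.evalOneLin_gr hε) (A.evalOneLin_d hε)

variable {A}

/-- The linear map `A[t, dt]_ε → B[t, dt]_ε` induced by a morphism `A ⟶ B`. -/
noncomputable def pathMapLin {B : ArtDGA K} (f : A ⟶ B) (ε : ℝ) : A.Path ε →ₗ[K] B.Path ε where
  toFun x := ⟨(fun n => lin f (x.1.1 n), fun n => lin f (x.1.2 n)),
    fun n => map_pow f _ _ (x.2.1 n), fun n => map_pow f _ _ (x.2.2 n)⟩
  map_add' _ _ := path_ext (funext fun _ => map_add _ _ _) (funext fun _ => map_add _ _ _)
  map_smul' _ _ := path_ext (funext fun _ => map_smul _ _ _) (funext fun _ => map_smul _ _ _)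

/-- The morphism `A[t, dt]_ε ⟶ B[t, dt]_ε` induced by a morphism `A ⟶ B`. -/
noncomputable def pathMap {B : ArtDGA K} (f : A ⟶ B) (hε : 0 < ε) : A.path ε hε ⟶ B.path ε hε :=
  Hom.mk (A := A.path ε hε) (B := B.path ε hε) (pathMapLin f ε)
    (fun x y => by
      refine path_ext (x := (_ : B.Path ε)) ?_ ?_
      · funext n
        change lin f (conv x.1.1 y.1.1 n) =
          conv (fun n => lin f (x.1.1 n)) (fun n => lin f (y.1.1 n)) n
        simp [conv, map_mul]
      · funext n
        change lin f (conv x.1.1 y.1.2 n + conv x.1.2 (par y.1.1) n) =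
          conv (fun n => lin f (x.1.1 n)) (fun n => lin f (y.1.2 n)) n +
          conv (fun n => lin f (x.1.2 n)) (par fun n => lin f (y.1.1 n)) n
        simp [conv, par, map_mul, map_parity])
    (fun i x hx => ⟨fun n => map_gr f (hx.1 n), fun n => map_gr f (hx.2 n)⟩)
    (fun x => by
      refine path_ext (x := (_ : B.Path ε)) (funext fun n => map_d f _) (funext fun n => ?_)
      change lin f (parity A.internal ((n + 1) • x.1.1 (n + 1)) + A.d (x.1.2 n)) =
        parity B.internal ((n + 1) • lin f (x.1.1 (n + 1))) + B.d (lin f (x.1.2 n))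
      rw [map_add, map_parity, map_nsmul (lin f), map_d])

theorem pathMap_evalZero {B : ArtDGA K} (f : A ⟶ B) (hε : 0 < ε) :
    pathMap f hε ≫ B.evalZero hε = A.evalZero hε ≫ f := rfl

theorem pathMapLin_evalOne {B : ArtDGA K} (f : A ⟶ B) (hε : 0 < ε) (x : A.Path ε) :
    B.evalOneLin hε (pathMapLin f ε x) = lin f (A.evalOneLin hε x) := by
  have hA := ((A.exists_bound ε hε).choose_spec x).1
  have hB := ((B.exists_bound ε hε).choose_spec (pathMapLin f ε x)).1
  have hA' : ∀ n, A.bound hε ≤ n → lin f (x.1.1 n) = 0 := fun n hn => by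
    rw [hA n hn, map_zero]
  rw [evalOneLin_apply, evalOneLin_apply, map_sum]
  change ∑ n ∈ Finset.range (B.bound hε), lin f (x.1.1 n) = _
  rw [Finset.sum_subset (s₁ := Finset.range (B.bound hε))
    (s₂ := Finset.range (max (B.bound hε) (A.bound hε))),
    Finset.sum_subset (s₁ := Finset.range (A.bound hε))
    (s₂ := Finset.range (max (B.bound hε) (A.bound hε)))]
  · exact fun n hn => by simp only [Finset.mem_range] at hn ⊢; omega
  · exact fun n _ hn => hA' n (by simpa using hn)
  · exact fun n hn => by simp only [Finset.mem_range] at hn ⊢; omega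
  · exact fun n _ hn => hB n (by simpa [bound] using hn)

theorem pathMap_evalOne {B : ArtDGA K} (f : A ⟶ B) (hε : 0 < ε) :
    pathMap f hε ≫ B.evalOne hε = A.evalOne hε ≫ f :=
  hom_ext (pathMapLin_evalOne f hε)

end Path

end ArtDGA

section DeformationFunctors

open ArtDGA

/-- The commutative square formed by `p : P ⟶ A`, `q : P ⟶ B`, `α : A ⟶ C`, `β : B ⟶ C` exhibits
`P` as the fibred product `A ×_C B = {(a, b) | α a = β b}`. -/
def IsFibreProduct {P A B C : ArtDGA K} (p : P ⟶ A) (q : P ⟶ B) (α : A ⟶ C) (β : B ⟶ C) : Prop :=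
  p ≫ α = q ≫ β ∧ ∀ a b, lin α a = lin β b → ∃! x, lin p x = a ∧ lin q x = b

/-- `A` is an acyclic complex, i.e. an acyclic object with trivial multiplication. -/
def IsAcyclicComplex (A : ArtDGA K) : Prop :=
  (∀ a b : A, a * b = 0) ∧ ∀ a : A, A.d a = 0 → ∃ b, A.d b = a

/-- `α : A ⟶ B` is an acyclic small extension: it is surjective and its kernel `I` satisfies
`A I = 0` and is an acyclic complex. -/
def IsAcyclicSmall {A B : ArtDGA K} (α : A ⟶ B) : Prop :=
  Function.Surjective (lin α) ∧
  (∀ a x : A, lin α x = 0 → a * x = 0) ∧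
  ∀ x : A, lin α x = 0 → A.d x = 0 → ∃ y, lin α y = 0 ∧ A.d y = x

/-- Predeformation functors. -/
structure IsPredeformation (F : ArtDGA K ⥤ Type u) : Prop where
  zero : ∀ A : ArtDGA K, Subsingleton A → Nonempty (Unique (F.obj A))
  surj : ∀ {P A B C : ArtDGA K} (p : P ⟶ A) (q : P ⟶ B) (α : A ⟶ C) (β : B ⟶ C),
    IsFibreProduct p q α β → Function.Surjective (lin α) →
    ∀ (a : F.obj A) (b : F.obj B), F.map α a = F.map β b →
      ∃ x : F.obj P, F.map p x = a ∧ F.map q x = b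
  bij : ∀ {P A B C : ArtDGA K} (p : P ⟶ A) (q : P ⟶ B) (α : A ⟶ C) (β : B ⟶ C),
    IsFibreProduct p q α β → Function.Surjective (lin α) → IsAcyclicComplex C →
    ∀ (a : F.obj A) (b : F.obj B), F.map α a = F.map β b →
      ∃! x : F.obj P, F.map p x = a ∧ F.map q x = b
  quasismooth : ∀ {A B : ArtDGA K} (α : A ⟶ B), IsAcyclicSmall α →
    Function.Surjective (F.map α : F.obj A → F.obj B)

/-- Deformation functors: predeformation functors which send acyclic small extensions to
bijections. -/
structure IsDeformation (F : ArtDGA K ⥤ Type u) : Prop extends IsPredeformation F where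
  bijective : ∀ {A B : ArtDGA K} (α : A ⟶ B), IsAcyclicSmall α →
    Function.Bijective (F.map α : F.obj A → F.obj B)

/-- The relation `a ∼ b` on `F(A)`: there are `ε > 0` and `x ∈ F(A[t, dt]_ε)` with `e₀(x) = a` and
`e₁(x) = b`. -/
def Homotopic (F : ArtDGA K ⥤ Type u) (A : ArtDGA K) (a b : F.obj A) : Prop :=
  ∃ (ε : ℝ) (hε : 0 < ε) (x : F.obj (A.path ε hε)),
    F.map (A.evalZero hε) x = a ∧ F.map (A.evalOne hε) x = b

theorem Homotopic.map {F : ArtDGA K ⥤ Type u} {A B : ArtDGA K} (f : A ⟶ B) {a b : F.obj A}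
    (h : Homotopic F A a b) : Homotopic F B (F.map f a) (F.map f b) := by
  obtain ⟨ε, hε, x, rfl, rfl⟩ := h
  refine ⟨ε, hε, F.map (pathMap f hε) x, ?_, ?_⟩
  · rw [← CategoryTheory.Functor.map_comp_apply, ← CategoryTheory.Functor.map_comp_apply, pathMap_evalZero]
  · rw [← CategoryTheory.Functor.map_comp_apply, ← CategoryTheory.Functor.map_comp_apply, pathMap_evalOne]

theorem Homotopic.app {F G : ArtDGA K ⥤ Type u} (φ : F ⟶ G) {A : ArtDGA K} {a b : F.obj A}
    (h : Homotopic F A a b) : Homotopic G A (φ.app A a) (φ.app A b) := by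
  obtain ⟨ε, hε, x, rfl, rfl⟩ := h
  exact ⟨ε, hε, φ.app _ x, (NatTrans.naturality_apply φ _ x).symm,
    (NatTrans.naturality_apply φ _ x).symm⟩

/-- The functor `F⁺`: the quotient of `F` by the equivalence relation generated by `∼`. -/
def plus (F : ArtDGA K ⥤ Type u) : ArtDGA K ⥤ Type u where
  obj A := Quot (Homotopic F A)
  map f := ↾(Quot.map (F.map f) fun _ _ h => h.map f)
  map_id A := by
    ext x
    induction x using Quot.ind
    simp [Quot.map]
  map_comp f g := by
    ext x
    induction x using Quot.ind
    simp [Quot.map]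

/-- The natural projection `F ⟶ F⁺`. -/
def plusProj (F : ArtDGA K ⥤ Type u) : F ⟶ plus F where
  app A := ↾(Quot.mk (Homotopic F A))

/-- The morphism `F⁺ ⟶ G⁺` induced by a morphism `F ⟶ G`. -/
def plusMap {F G : ArtDGA K ⥤ Type u} (φ : F ⟶ G) : plus F ⟶ plus G where
  app A := ↾(Quot.map (φ.app A) fun _ _ h => h.app φ)
  naturality A B f := by
    ext x
    induction x using Quot.ind
    exact congrArg (Quot.mk _) (NatTrans.naturality_apply φ f _)

/-- The construction `F ↦ F⁺` as a functor. -/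
def plusFunctor (K : Type u) [Field K] : (ArtDGA K ⥤ Type u) ⥤ (ArtDGA K ⥤ Type u) where
  obj F := plus F
  map φ := plusMap φ
  map_id F := by
    ext A x
    induction x using Quot.ind
    rfl
  map_comp φ ψ := by
    ext A x
    induction x using Quot.ind
    rfl

/-- `η : F ⟶ G` exhibits `G` as the deformation functor associated with `F`: the functor `G` is a
deformation functor, and every morphism from `F` to a deformation functor factors uniquely
through `η`. -/
def IsAssociatedDeformation {F G : ArtDGA K ⥤ Type u} (η : F ⟶ G) : Prop :=
  IsDeformation G ∧
  ∀ H : ArtDGA K ⥤ Type u, IsDeformation H → ∀ φ : F ⟶ H, ∃! ψ : G ⟶ H, φ = η ≫ ψ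

end DeformationFunctors

namespace DGLA

instance : CoeSort (DGLA K) (Type u) := ⟨DGLA.carrier⟩

attribute [instance] DGLA.group DGLA.module

/-- Morphisms of differential graded Lie algebras. -/
@[ext]
structure Hom (L N : DGLA K) where
  lin : L →ₗ[K] N
  map_gr : ∀ i, ∀ x ∈ L.gr i, lin x ∈ N.gr i
  map_d : ∀ x, lin (L.d x) = N.d (lin x)
  map_br : ∀ x y, lin (L.br x y) = N.br (lin x) (lin y)

instance : Category (DGLA K) where
  Hom := Hom
  id L := ⟨LinearMap.id, fun _ _ h => h, fun _ => rfl, fun _ _ => rfl⟩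
  comp f g := ⟨g.lin.comp f.lin, fun i a h => g.map_gr i _ (f.map_gr i a h),
    fun a => by simp [f.map_d, g.map_d], fun a b => by simp [f.map_br, g.map_br]⟩

/-- The linear map underlying a morphism. -/
def lin {L N : DGLA K} (f : L ⟶ N) : L →ₗ[K] N := Hom.lin f

@[simp] theorem lin_id (L : DGLA K) : lin (𝟙 L) = LinearMap.id := rfl

@[simp] theorem lin_comp {L M N : DGLA K} (f : L ⟶ M) (g : M ⟶ N) :
    lin (f ≫ g) = (lin g).comp (lin f) := rfl

theorem map_gr {L N : DGLA K} (f : L ⟶ N) {i : ℤ} {x : L} (h : x ∈ L.gr i) :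
    lin f x ∈ N.gr i := Hom.map_gr f i x h

theorem map_d {L N : DGLA K} (f : L ⟶ N) (x : L) : lin f (L.d x) = N.d (lin f x) :=
  Hom.map_d f x

theorem map_br {L N : DGLA K} (f : L ⟶ N) (x y : L) :
    lin f (L.br x y) = N.br (lin f x) (lin f y) := Hom.map_br f x y

theorem map_parity {L N : DGLA K} (f : L ⟶ N) (x : L) :
    lin f (parity L.internal x) = parity N.internal (lin f x) :=
  onPieces_natural _ _ _ (fun _ _ h => map_gr f h) _ _ _ (fun i v => by simp) x

end DGLA

section Tensor

variable (L : DGLA K) (A : ArtDGA K)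

/-- The piece `⨁_i L^i ⊗ A_{n - i}` of degree `n` of `L ⊗ A`. -/
noncomputable def tensGr (n : ℤ) : Submodule K (L ⊗[K] A) :=
  ⨆ i : ℤ, LinearMap.range (TensorProduct.map (L.gr i).subtype (A.gr (n - i)).subtype)

/-- The differential `d (x ⊗ a) = d x ⊗ a + (-1) ^ i x ⊗ d a` of `L ⊗ A`, for `x` of degree `i`. -/
noncomputable def tensD : L ⊗[K] A →ₗ[K] L ⊗[K] A :=
  TensorProduct.map L.d LinearMap.id + TensorProduct.map (parity L.internal) A.d

/-- The bracket `[x ⊗ a, y ⊗ b] = (-1) ^ (i j) [x, y] ⊗ a b` of `L ⊗ A`, for `a` of degree `i` and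
`y` of degree `j`. The sign is trivial for `a` even and is the parity of `y` for `a` odd. -/
noncomputable def tensBr : L ⊗[K] A →ₗ[K] L ⊗[K] A →ₗ[K] L ⊗[K] A :=
  TensorProduct.map₂ L.br ((LinearMap.mul K A).comp (evenPart A.internal)) +
  TensorProduct.map₂ (L.br.compl₂ (parity L.internal))
    ((LinearMap.mul K A).comp (oddPart A.internal))

theorem tensD_tmul {i : ℤ} {x : L} (hx : x ∈ L.gr i) (a : A) :
    tensD L A (x ⊗ₜ a) = L.d x ⊗ₜ a + ((-1 : K) ^ i) • (x ⊗ₜ A.d a) := by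
  simp [tensD, parity_apply _ hx, TensorProduct.smul_tmul']

theorem tensBr_tmul {i j : ℤ} {a : A} {y : L} (ha : a ∈ A.gr i) (hy : y ∈ L.gr j) (x : L) (b : A) :
    tensBr L A (x ⊗ₜ a) (y ⊗ₜ b) = ((-1 : K) ^ (i * j)) • (L.br x y ⊗ₜ (a * b)) := by
  by_cases hi : Even i
  · have h : ((-1 : K) ^ (i * j)) = 1 := (hi.mul_right j).neg_one_zpow
    simp [tensBr, evenPart, oddPart, onPieces_apply _ _ ha, hi, h]
  · have h : ((-1 : K) ^ (i * j)) = (-1) ^ j := by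
      rw [zpow_mul, (Int.not_even_iff_odd.1 hi).neg_one_zpow]
    simp [tensBr, evenPart, oddPart, onPieces_apply _ _ ha, parity_apply _ hy, hi, h,
      TensorProduct.smul_tmul']

/-- `MC(L ⊗ A)`: the elements `x` of degree `1` of `L ⊗ A` with `d x + [x, x] / 2 = 0`. -/
def MCSet : Set (L ⊗[K] A) :=
  {x | x ∈ tensGr L A 1 ∧ tensD L A x + (2 : K)⁻¹ • tensBr L A x x = 0}

/-- The gauge action `e^u x = x + ∑_{n ≥ 0} (ad u)^n ([u, x] - d u) / (n + 1)!`. In the extension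
`(L ⊗ A) ⊕ K d` this is `e^{ad u} (x + d) - d`. As `ad u` is nilpotent, the sum is finite. -/
noncomputable def gauge (u x : L ⊗[K] A) : L ⊗[K] A :=
  x + ∑ᶠ n : ℕ, ((n + 1).factorial : K)⁻¹ •
    ((tensBr L A u) ^ n) (tensBr L A u x - tensD L A u)

/-- Two Maurer-Cartan elements in relation by an element `e^u` of the group
`exp((L ⊗ A)^0) = {e^u | u ∈ (L ⊗ A)^0}`. -/
def GaugeRel (x y : MCSet L A) : Prop :=
  ∃ u ∈ tensGr L A 0, y.1 = gauge L A u x.1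

/-- `L ⊗ A ^ k`, as a subspace of `L ⊗ A`. -/
noncomputable def tensPow (k : ℕ) : Submodule K (L ⊗[K] A) :=
  LinearMap.range (TensorProduct.map (LinearMap.id : L →ₗ[K] L) (A.pow k).subtype)

theorem tensBr_pow (k : ℕ) (u x : L ⊗[K] A) (hx : x ∈ tensPow L A (k + 1)) :
    tensBr L A u x ∈ tensPow L A (k + 2) := by
  have key : ∀ (y : L) (b : A), b ∈ A.pow (k + 2) → y ⊗ₜ[K] b ∈ tensPow L A (k + 2) :=
    fun y b hb => ⟨y ⊗ₜ ⟨b, hb⟩, by simp⟩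
  obtain ⟨z, rfl⟩ := hx
  induction u using TensorProduct.induction_on with
  | zero => simp
  | add u v hu hv => rw [map_add, LinearMap.add_apply]; exact add_mem hu hv
  | tmul l a =>
    induction z using TensorProduct.induction_on with
    | zero => simp
    | add u v hu hv => rw [map_add, map_add]; exact add_mem hu hv
    | tmul m b =>
      simp only [tensBr, TensorProduct.map_tmul, LinearMap.add_apply, TensorProduct.map₂_apply_tmul]
      exact add_mem (key _ _ (A.mul_mem_pow_succ _ b.2)) (key _ _ (A.mul_mem_pow_succ _ b.2))

theorem tensBr_nilpotent : ∃ N : ℕ, ∀ n, N ≤ n → ∀ u x : L ⊗[K] A, ((tensBr L A u) ^ n) x = 0 := by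
  obtain ⟨N, hN⟩ := A.nilpotent
  refine ⟨N, fun n hn u x => ?_⟩
  have h : ((tensBr L A u) ^ n) x ∈ tensPow L A (n + 1) := by
    clear hn
    induction n with
    | zero =>
      have hs : Function.Surjective (A.pow (0 + 1)).subtype := fun a => ⟨⟨a, trivial⟩, rfl⟩
      exact TensorProduct.map_surjective Function.surjective_id hs x
    | succ n ih =>
      rw [pow_succ', Module.End.mul_apply]
      exact tensBr_pow L A n u _ ih
  obtain ⟨z, hz⟩ := h
  rw [← hz]
  have h0 : (A.pow (n + 1)).subtype = 0 := by
    ext b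
    have hb := A.pow_anti (show N ≤ n + 1 by omega) b.2
    rw [ArtDGA.pow, hN] at hb
    simpa using hb
  rw [h0, TensorProduct.map_zero_right, LinearMap.zero_apply]

variable {L A} {N : DGLA K} {B : ArtDGA K}

/-- The map `L ⊗ A → N ⊗ B` induced by morphisms `L ⟶ N` and `A ⟶ B`. -/
noncomputable def tensMap (φ : L ⟶ N) (f : A ⟶ B) : L ⊗[K] A →ₗ[K] N ⊗[K] B :=
  TensorProduct.map (DGLA.lin φ) (ArtDGA.lin f)

theorem tensMap_gr (φ : L ⟶ N) (f : A ⟶ B) {n : ℤ} {x : L ⊗[K] A} (hx : x ∈ tensGr L A n) :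
    tensMap φ f x ∈ tensGr N B n := by
  have h : tensGr L A n ≤ (tensGr N B n).comap (tensMap φ f) := by
    refine iSup_le fun i => ?_
    rintro _ ⟨z, rfl⟩
    rw [Submodule.mem_comap]
    refine (le_iSup (fun i : ℤ => LinearMap.range
      (TensorProduct.map (N.gr i).subtype (B.gr (n - i)).subtype)) i) ?_
    refine ⟨TensorProduct.map ((DGLA.lin φ).restrict fun x hx => DGLA.map_gr φ hx)
      ((ArtDGA.lin f).restrict fun x hx => ArtDGA.map_gr f hx) z, ?_⟩
    rw [tensMap, ← LinearMap.comp_apply, ← LinearMap.comp_apply, ← TensorProduct.map_comp,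
      ← TensorProduct.map_comp]
    rfl
  exact h hx

theorem tensMap_d (φ : L ⟶ N) (f : A ⟶ B) (x : L ⊗[K] A) :
    tensMap φ f (tensD L A x) = tensD N B (tensMap φ f x) := by
  induction x using TensorProduct.induction_on with
  | zero => simp
  | add x y hx hy => simp only [map_add, hx, hy]
  | tmul x a =>
    simp [tensMap, tensD, DGLA.map_d, ArtDGA.map_d, DGLA.map_parity]

theorem tensMap_br (φ : L ⟶ N) (f : A ⟶ B) (x y : L ⊗[K] A) :
    tensMap φ f (tensBr L A x y) = tensBr N B (tensMap φ f x) (tensMap φ f y) := by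
  have he : ∀ a, ArtDGA.lin f (evenPart A.internal a) = evenPart B.internal (ArtDGA.lin f a) :=
    onPieces_natural _ _ _ (fun _ _ h => ArtDGA.map_gr f h) _ _ _
      (fun i v => by split_ifs <;> simp)
  have ho : ∀ a, ArtDGA.lin f (oddPart A.internal a) = oddPart B.internal (ArtDGA.lin f a) :=
    onPieces_natural _ _ _ (fun _ _ h => ArtDGA.map_gr f h) _ _ _
      (fun i v => by split_ifs <;> simp)
  induction x using TensorProduct.induction_on with
  | zero => simp
  | add x x' hx hx' => simp only [map_add, LinearMap.add_apply, hx, hx']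
  | tmul x a =>
    induction y using TensorProduct.induction_on with
    | zero => simp
    | add y y' hy hy' => simp only [map_add, hy, hy']
    | tmul y b =>
      simp [tensMap, tensBr, DGLA.map_br, ArtDGA.map_mul, DGLA.map_parity, he, ho]

theorem tensMap_gauge (φ : L ⟶ N) (f : A ⟶ B) (u x : L ⊗[K] A) :
    tensMap φ f (gauge L A u x) = gauge N B (tensMap φ f u) (tensMap φ f x) := by
  have hpow : ∀ (n : ℕ) (z : L ⊗[K] A), tensMap φ f (((tensBr L A u) ^ n) z) =
      ((tensBr N B (tensMap φ f u)) ^ n) (tensMap φ f z) := by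
    intro n z
    induction n with
    | zero => rfl
    | succ n ih =>
      rw [pow_succ', pow_succ', Module.End.mul_apply, Module.End.mul_apply, tensMap_br, ih]
  obtain ⟨M, hM⟩ := tensBr_nilpotent L A
  have hfin : (Function.support fun n : ℕ => ((n + 1).factorial : K)⁻¹ •
      ((tensBr L A u) ^ n) (tensBr L A u x - tensD L A u)).Finite := by
    refine (Set.finite_lt_nat M).subset fun n hn => ?_
    by_contra h
    exact hn (by simp [hM n (not_lt.1 h)])
  rw [gauge, gauge, map_add, map_finsum _ hfin]
  simp only [map_smul, hpow, map_sub, tensMap_br, tensMap_d]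

theorem tensMap_MC (φ : L ⟶ N) (f : A ⟶ B) {x : L ⊗[K] A} (hx : x ∈ MCSet L A) :
    tensMap φ f x ∈ MCSet N B := by
  refine ⟨tensMap_gr φ f hx.1, ?_⟩
  rw [← tensMap_d, ← tensMap_br, ← map_smul, ← map_add, hx.2, map_zero]

/-- The map `MC(L ⊗ A) → MC(N ⊗ B)` induced by morphisms `L ⟶ N` and `A ⟶ B`. -/
noncomputable def mcMap (φ : L ⟶ N) (f : A ⟶ B) (x : MCSet L A) : MCSet N B :=
  ⟨tensMap φ f x.1, tensMap_MC φ f x.2⟩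

theorem mcMap_id (x : MCSet L A) : mcMap (𝟙 L) (𝟙 A) x = x :=
  Subtype.ext (by simp [mcMap, tensMap])

theorem mcMap_comp {M : DGLA K} {C : ArtDGA K} (φ : L ⟶ N) (ψ : N ⟶ M) (f : A ⟶ B) (g : B ⟶ C)
    (x : MCSet L A) : mcMap (φ ≫ ψ) (f ≫ g) x = mcMap ψ g (mcMap φ f x) :=
  Subtype.ext (by simp [mcMap, tensMap, TensorProduct.map_comp])

theorem mcMap_rel (φ : L ⟶ N) (f : A ⟶ B) {x y : MCSet L A} (h : GaugeRel L A x y) :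
    GaugeRel N B (mcMap φ f x) (mcMap φ f y) := by
  obtain ⟨u, hu, h⟩ := h
  exact ⟨tensMap φ f u, tensMap_gr φ f hu, by simp [mcMap, h, tensMap_gauge]⟩

end Tensor

/-- The Maurer-Cartan functor `MC_L`, with `MC_L(A) = MC(L ⊗ A)`. -/
noncomputable def MC (L : DGLA K) : ArtDGA K ⥤ Type u where
  obj A := MCSet L A
  map f := ↾(mcMap (𝟙 L) f)
  map_id A := by
    ext x
    exact congrArg Subtype.val (mcMap_id x)
  map_comp f g := by
    ext x
    exact congrArg Subtype.val (mcMap_comp (𝟙 L) (𝟙 L) f g x)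

/-- The functor `Def_L`: the quotient of `MC(L ⊗ A)` by the gauge action of `exp((L ⊗ A)^0)`. -/
noncomputable def Def (L : DGLA K) : ArtDGA K ⥤ Type u where
  obj A := Quot (GaugeRel L A)
  map f := ↾(Quot.map (mcMap (𝟙 L) f) fun _ _ h => mcMap_rel (𝟙 L) f h)
  map_id A := by
    ext x
    induction x using Quot.ind
    exact congrArg (Quot.mk _) (mcMap_id _)
  map_comp f g := by
    ext x
    induction x using Quot.ind
    exact congrArg (Quot.mk _) (mcMap_comp (𝟙 L) (𝟙 L) f g _)

/-- The natural projection `MC_L ⟶ Def_L`. -/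
noncomputable def defProj (L : DGLA K) : MC L ⟶ Def L where
  app A := ↾(Quot.mk (GaugeRel L A))

/-- The construction `L ↦ MC_L` as a functor. -/
noncomputable def MCFunctor (K : Type u) [Field K] : DGLA K ⥤ (ArtDGA K ⥤ Type u) where
  obj L := MC L
  map {L N} φ :=
    { app := fun A => ↾(mcMap φ (𝟙 A))
      naturality := fun A B f => by
        ext x
        exact (mcMap_comp (𝟙 L) φ f (𝟙 B) x).symm.trans (mcMap_comp φ (𝟙 N) (𝟙 A) f x) }
  map_id L := by
    ext A x
    exact mcMap_id x
  map_comp φ ψ := by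
    ext A x
    exact mcMap_comp φ ψ (𝟙 A) (𝟙 A) x

/-- The construction `L ↦ Def_L` as a functor. -/
noncomputable def DefFunctor (K : Type u) [Field K] : DGLA K ⥤ (ArtDGA K ⥤ Type u) where
  obj L := Def L
  map {L N} φ :=
    { app := fun A => ↾(Quot.map (mcMap φ (𝟙 A)) fun _ _ h => mcMap_rel φ (𝟙 A) h)
      naturality := fun A B f => by
        ext x
        induction x using Quot.ind
        exact congrArg (Quot.mk _) ((mcMap_comp (𝟙 L) φ f (𝟙 B) _).symm.trans
          (mcMap_comp φ (𝟙 N) (𝟙 A) f _)) }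
  map_id L := by
    ext A x
    induction x using Quot.ind
    exact congrArg (Quot.mk _) (mcMap_id _)
  map_comp φ ψ := by
    ext A x
    induction x using Quot.ind
    exact congrArg (Quot.mk _) (mcMap_comp φ ψ (𝟙 A) (𝟙 A) _)

end DefFun

/-! The statement rests on two facts: `Def L` is a deformation functor, and a deformation functor
identifies homotopic elements.

The second fact (`IsDeformation.eq_of_homotopic`) is a polynomial Poincaré lemma. The kernel of `e₀
: A[t, dt]_ε ⟶ A` is filtered by the polynomials with coefficients in `A ^ k`, and integration in
`t` shows that every step is acyclic. So `e₀` is a composition of acyclic small extensions and a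
deformation functor makes it bijective. The constants are a common section of `e₀` and `e₁`, hence
both induce the same map. Applied to the images in `Def L`, this says that homotopic Maurer-Cartan
elements are gauge equivalent, without solving a differential equation. Conversely `t ↦ e^{tu} x` is
a homotopy from `x` to `e^u x` (`GaugeRel.homotopic`). Thus `MC_L⁺` and `Def L` are the same
quotient of `MC L`; the isomorphism is the identity on representatives, which gives its naturality
and compatibility with the projections. The universal property of `MC_L⁺` is the second fact again.

For the axioms, `L ⊗ A` is treated as a differential graded Lie algebra enlarged by a symbol `d`
with `[d, v] = d v`. There the Maurer-Cartan equation reads `[x + d, x + d] = 0`, and the gauge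
action is `x + d ↦ exp(ad u)(x + d)`, so it preserves solutions and is undone by `-u`. The functor
`L ⊗ -` preserves fibre products, and it sends the kernel of an acyclic small extension to an
acyclic complex with zero brackets; obstructions to lifting, and differences of lifts, are then
exact (`MC_quasismooth`, `Def_bijective`).

The hard axiom is injectivity of `Def L` on `P = A ×_C B` for `C` an acyclic complex
(`Def_injective`). The object `P` is replaced by its mapping path object `A[t, dt]_1 ×_A P`, whose
map to `A × B` is again a composition of acyclic small extensions; for the product `A × B`
injectivity is elementary. -/

namespace DefFun

/-! ### The gauge action in a differential graded Lie algebra. -/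

/-- If `E` and `D` satisfy the Leibniz rule for a bilinear map, then their exponentials are
compatible with it. -/
theorem exp_bilinear {R X Z : Type*} [CommRing R] [AddCommGroup X] [Module R X] [AddCommGroup Z]
    [Module R Z] [Module ℚ X] [Module ℚ Z] (B : X →ₗ[R] X →ₗ[R] Z) (D : Module.End R X)
    (E : Module.End R Z) (h : ∀ x y, E (B x y) = B (D x) y + B x (D y))
    (hD : IsNilpotent D) (hE : IsNilpotent E) (x y : X) :
    IsNilpotent.exp E (B x y) = B (IsNilpotent.exp D x) (IsNilpotent.exp D y) := by
  let DL : Module.End R (X ⊗[R] X) := D.lTensor X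
  let DR : Module.End R (X ⊗[R] X) := D.rTensor X
  have hL : IsNilpotent DL := hD.map <| Module.End.lTensorAlgHom R X X
  have hR : IsNilpotent DR := hD.map <| Module.End.rTensorAlgHom R X X
  have hc : Commute DL DR := by ext; simp [DL, DR]
  let m : X ⊗[R] X →ₗ[R] Z := TensorProduct.lift B
  have h1 : IsNilpotent.exp E (B x y) = m (IsNilpotent.exp (DL + DR) (x ⊗ₜ[R] y)) := by
    suffices IsNilpotent.exp E ∘ₗ m = m ∘ₗ IsNilpotent.exp (DL + DR) by
      simpa [m] using LinearMap.congr_fun this (x ⊗ₜ[R] y)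
    refine Module.End.commute_exp_left_of_commute (hc.isNilpotent_add hL hR) hE ?_
    ext
    simp [DL, DR, m, h, add_comm]
  have h2 : IsNilpotent.exp DL = (IsNilpotent.exp D).lTensor X :=
    (hD.map_exp (Module.End.lTensorAlgHom R X X)).symm
  have h3 : IsNilpotent.exp DR = (IsNilpotent.exp D).rTensor X :=
    (hD.map_exp (Module.End.rTensorAlgHom R X X)).symm
  simp [h1, IsNilpotent.exp_add_of_commute hc hL hR, h2, h3, m]

variable {K : Type u} [Field K]

namespace DGLA

variable (V : DGLA K)

/-- Maurer-Cartan elements of a differential graded Lie algebra. -/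
def IsMC (x : V) : Prop := x ∈ V.gr 1 ∧ V.d x + (2 : K)⁻¹ • V.br x x = 0

/-- The gauge action `e^u x` in a differential graded Lie algebra. -/
noncomputable def gaugeAct (u x : V) : V :=
  x + ∑ᶠ n : ℕ, ((n + 1).factorial : K)⁻¹ • ((V.br u) ^ n) (V.br u x - V.d u)

variable {V}

theorem br_mem_one {u x : V} (hu : u ∈ V.gr 0) (hx : x ∈ V.gr 1) : V.br u x ∈ V.gr 1 := by
  simpa using V.br_mem 0 1 u x hu hx

theorem d_mem_one {u : V} (hu : u ∈ V.gr 0) : V.d u ∈ V.gr 1 := by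
  simpa using V.d_mem 0 u hu

theorem br_comm_one {x y : V} (hx : x ∈ V.gr 1) (hy : y ∈ V.gr 1) : V.br x y = V.br y x := by
  have h := V.br_symm 1 1 x y hx hy
  simpa [← sub_eq_add_neg, sub_eq_zero] using h

/-- The operator `ad u` on the degree one part of `V ⊕ K d`, for `u` of degree `0`. -/
noncomputable def adExt {u : V} (hu : u ∈ V.gr 0) : Module.End K (V.gr 1 × K) where
  toFun y := (⟨V.br u y.1 - y.2 • V.d u,
    sub_mem (br_mem_one hu y.1.2) (Submodule.smul_mem _ _ (d_mem_one hu))⟩, 0)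
  map_add' y z := Prod.ext (Subtype.ext (by simp [add_smul]; abel)) (by simp)
  map_smul' c y := Prod.ext (Subtype.ext (by simp [mul_smul, smul_sub])) (by simp)

/-- The bracket on the degree one part of `V ⊕ K d`. -/
noncomputable def brExt (V : DGLA K) : V.gr 1 × K →ₗ[K] V.gr 1 × K →ₗ[K] V :=
  LinearMap.mk₂ K (fun y z => V.br y.1 z.1 + y.2 • V.d z.1 + z.2 • V.d y.1)
    (fun y y' z => by simp [add_smul]; abel)
    (fun c y z => by simp [mul_smul, smul_add, smul_comm c])
    (fun y z z' => by simp [add_smul]; abel)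
    (fun c y z => by simp [mul_smul, smul_add, smul_comm c])

theorem brExt_apply (y z : V.gr 1 × K) :
    brExt V y z = V.br y.1 z.1 + y.2 • V.d z.1 + z.2 • V.d y.1 := rfl

/-- This is the Jacobi identity in `V ⊕ K d`. The terms containing `d` are instances of the Leibniz
rule, `d d = 0`, and the symmetry of the bracket in degree `1`. -/
theorem adExt_brExt {u : V} (hu : u ∈ V.gr 0) (y z : V.gr 1 × K) :
    V.br u (brExt V y z) = brExt V (adExt hu y) z + brExt V y (adExt hu z) := by
  have h1 := V.jacobi 0 1 u y.1 z.1 hu y.1.2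
  have h2 := V.leibniz 0 u y.1 hu
  have h3 := V.leibniz 0 u z.1 hu
  have h4 := br_comm_one y.1.2 (d_mem_one hu)
  simp only [zero_mul, zpow_zero, one_smul] at h1 h2 h3
  simp only [brExt_apply, adExt, LinearMap.coe_mk, AddHom.coe_mk, map_add, map_sub, map_smul,
    LinearMap.sub_apply, LinearMap.smul_apply, h1, h2, h3, h4, V.d_d, smul_zero, sub_zero, zero_smul,
    add_zero, smul_add]
  abel

/-- The first application of `adExt` kills the coefficient of `d`; from then on only `ad u` acts.
This explains the shift between `(ad u)^n` and `(n + 1)!` in the gauge formula. -/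
theorem adExt_pow_succ {u : V} (hu : u ∈ V.gr 0) (n : ℕ) (y : V.gr 1 × K) :
    ((((adExt hu) ^ (n + 1)) y).1 : V) = ((V.br u) ^ n) (V.br u y.1 - y.2 • V.d u) ∧
    (((adExt hu) ^ (n + 1)) y).2 = 0 := by
  induction n with
  | zero => simp [adExt]
  | succ n ih =>
    rw [pow_succ', pow_succ' (V.br u), Module.End.mul_apply, Module.End.mul_apply, ← ih.1]
    refine ⟨?_, rfl⟩
    change V.br u _ - (((adExt hu) ^ (n + 1)) y).2 • V.d u = _
    rw [ih.2, zero_smul, sub_zero]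

theorem adExt_nilpotent {u : V} (hu : u ∈ V.gr 0) (hn : IsNilpotent (V.br u : Module.End K V)) :
    IsNilpotent (adExt hu) := by
  obtain ⟨n, hn⟩ := hn
  refine ⟨n + 1, LinearMap.ext fun y => ?_⟩
  obtain ⟨h1, h2⟩ := adExt_pow_succ hu n y
  rw [hn] at h1
  exact Prod.ext (Subtype.ext (by simpa using h1)) (by simpa using h2)

theorem adExt_neg {u : V} (hu : u ∈ V.gr 0) : adExt (neg_mem hu) = - adExt hu :=
  LinearMap.ext fun y => Prod.ext (Subtype.ext (by simp [adExt]; abel)) (by simp [adExt])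

section Exp

variable [CharZero K] [Module ℚ (V.gr 1 × K)]

/-- Needed because `IsNilpotent.exp` has rational coefficients while the gauge action has
coefficients in `K`. An abelian group carries at most one structure of rational vector space, so the
choice of instance is harmless. -/
theorem rat_smul_eq {X : Type*} [AddCommGroup X] [Module K X] [i : Module ℚ X] (q : ℚ)
    (x : X) : q • x = (q : K) • x := by
  obtain rfl : i = Module.compHom X (algebraMap ℚ K) := Subsingleton.elim _ _
  change algebraMap ℚ K q • x = _
  rw [eq_ratCast]

theorem exp_adExt {u : V} (hu : u ∈ V.gr 0) (hn : IsNilpotent (V.br u : Module.End K V))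
    (x : V.gr 1) :
    ((IsNilpotent.exp (adExt hu) (x, 1)).1 : V) = V.gaugeAct u x ∧
      (IsNilpotent.exp (adExt hu) (x, 1)).2 = 1 := by
  obtain ⟨n, hn⟩ := hn
  have h0 : (adExt hu) ^ (n + 1) = 0 := by
    refine LinearMap.ext fun y => ?_
    obtain ⟨h1, h2⟩ := adExt_pow_succ hu n y
    rw [hn] at h1
    exact Prod.ext (Subtype.ext (by simpa using h1)) (by simpa using h2)
  have hs : (Function.support fun m : ℕ => ((m + 1).factorial : K)⁻¹ •
      ((V.br u) ^ m) (V.br u x - V.d u)) ⊆ (Finset.range n : Set ℕ) := by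
    intro m hm
    by_contra hmn
    refine hm ?_
    simp only [Finset.coe_range, Set.mem_Iio, not_lt] at hmn
    obtain ⟨k, rfl⟩ := Nat.exists_eq_add_of_le hmn
    simp only [pow_add, hn, zero_mul, LinearMap.zero_apply, smul_zero]
  have key : IsNilpotent.exp (adExt hu) (x, (1 : K)) =
      ∑ m ∈ Finset.range (n + 1), ((m.factorial : K)⁻¹) • (((adExt hu) ^ m) (x, (1 : K))) := by
    rw [IsNilpotent.exp_eq_sum h0, LinearMap.sum_apply]
    refine Finset.sum_congr rfl fun m _ => ?_
    rw [LinearMap.smul_apply, rat_smul_eq (K := K)]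
    simp
  -- The term `m = 0` is `(x, 1)` itself; the remaining ones are the terms of the gauge series.
  rw [key, Finset.sum_range_succ', gaugeAct, finsum_eq_sum_of_support_subset _ hs]
  refine ⟨?_, ?_⟩
  · simp only [Prod.fst_add, Prod.fst_sum, Submodule.coe_add, Submodule.coe_sum, Prod.smul_fst,
      Submodule.coe_smul, (adExt_pow_succ hu _ _).1]
    simp [add_comm]
  · simp only [Prod.snd_add, Prod.snd_sum, Prod.smul_snd, (adExt_pow_succ hu _ _).2]
    simp

end Exp

/-- Since `[d, d] = 0`, the square `[x + d, x + d]` is `[x, x] + 2 d x`, twice the curvature. -/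
theorem two_smul_half [CharZero K] {x : V} (hx : x ∈ V.gr 1) :
    V.d x + (2 : K)⁻¹ • V.br x x = (2 : K)⁻¹ • brExt V (⟨x, hx⟩, 1) (⟨x, hx⟩, 1) := by
  rw [brExt_apply]
  simp only [one_smul, smul_add]
  rw [add_assoc, ← add_smul, ← two_mul, mul_inv_cancel₀ two_ne_zero, one_smul, add_comm]

theorem gaugeAct_mem [CharZero K] {u x : V} (hu : u ∈ V.gr 0)
    (hn : IsNilpotent (V.br u : Module.End K V)) (hx : x ∈ V.gr 1) :
    V.gaugeAct u x ∈ V.gr 1 := by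
  let _ : Module ℚ V := Module.compHom V (algebraMap ℚ K)
  let _ : Module ℚ (V.gr 1 × K) := Module.compHom _ (algebraMap ℚ K)
  rw [← (exp_adExt hu hn ⟨x, hx⟩).1]
  exact Subtype.prop _

/-- As `ad u` is a derivation of the bracket, its exponential preserves it: the square of `e^u x +
d` is the image under `exp(ad u)` of the square of `x + d`, which is zero. -/
theorem gaugeAct_isMC [CharZero K] {u x : V} (hu : u ∈ V.gr 0)
    (hn : IsNilpotent (V.br u : Module.End K V)) (hx : V.IsMC x) : V.IsMC (V.gaugeAct u x) := by
  let _ : Module ℚ V := Module.compHom V (algebraMap ℚ K)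
  let _ : Module ℚ (V.gr 1 × K) := Module.compHom _ (algebraMap ℚ K)
  refine ⟨gaugeAct_mem hu hn hx.1, ?_⟩
  obtain ⟨h1, h2⟩ := exp_adExt hu hn ⟨x, hx.1⟩
  have e : ((⟨V.gaugeAct u x, gaugeAct_mem hu hn hx.1⟩, 1) : V.gr 1 × K) =
      IsNilpotent.exp (adExt hu) (⟨x, hx.1⟩, 1) := Prod.ext (Subtype.ext h1.symm) h2.symm
  have h3 := hx.2
  rw [two_smul_half hx.1] at h3
  have h4 : brExt V (⟨x, hx.1⟩, 1) (⟨x, hx.1⟩, 1) = 0 := by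
    simpa using h3
  rw [two_smul_half (gaugeAct_mem hu hn hx.1), e,
    ← exp_bilinear (brExt V) (adExt hu) (V.br u) (adExt_brExt hu) (adExt_nilpotent hu hn) hn, h4,
    map_zero, smul_zero]

theorem gaugeAct_neg [CharZero K] {u x : V} (hu : u ∈ V.gr 0)
    (hn : IsNilpotent (V.br u : Module.End K V)) (hx : x ∈ V.gr 1) :
    V.gaugeAct (-u) (V.gaugeAct u x) = x := by
  let _ : Module ℚ V := Module.compHom V (algebraMap ℚ K)
  let _ : Module ℚ (V.gr 1 × K) := Module.compHom _ (algebraMap ℚ K)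
  obtain ⟨h1, h2⟩ := exp_adExt hu hn ⟨x, hx⟩
  have e : ((⟨V.gaugeAct u x, gaugeAct_mem hu hn hx⟩, 1) : V.gr 1 × K) =
      IsNilpotent.exp (adExt hu) (⟨x, hx⟩, 1) := Prod.ext (Subtype.ext h1.symm) h2.symm
  have hn' : IsNilpotent (V.br (-u) : Module.End K V) := by
    rw [map_neg]; exact hn.neg
  have h3 := (exp_adExt (neg_mem hu) hn' ⟨V.gaugeAct u x, gaugeAct_mem hu hn hx⟩).1
  rw [← h3, e, adExt_neg hu, ← Module.End.mul_apply,
    IsNilpotent.exp_neg_mul_exp_self (adExt_nilpotent hu hn)]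
  rfl

/-- If `ad u` vanishes then `e^u x = x - d u`. -/
theorem gaugeAct_of_br_eq_zero {u : V} (hu : ∀ w, V.br u w = 0) (x : V) :
    V.gaugeAct u x = x - V.d u := by
  have hu' : V.br u = 0 := LinearMap.ext hu
  rw [gaugeAct, finsum_eq_single _ 0, hu']
  · simp [sub_eq_add_neg]
  · intro n hn
    simp [hu', zero_pow hn]

/-- For three equal elements of degree `1` the Jacobi identity reads `3 [[x, x], x] = 0`. -/
theorem br_br_self [CharZero K] {x : V} (hx : x ∈ V.gr 1) : V.br (V.br x x) x = 0 := by
  have h1 := V.jacobi 1 1 x x x hx hx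
  have h2 := V.br_symm 1 2 x (V.br x x) hx (by simpa using V.br_mem 1 1 x x hx hx)
  simp only [mul_one, one_mul, zpow_one, neg_smul, one_smul] at h1 h2
  rw [show ((-1 : K) ^ (2 : ℤ)) = 1 by norm_num, one_smul] at h2
  have h3 : V.br x (V.br x x) = - V.br (V.br x x) x := eq_neg_of_add_eq_zero_left h2
  rw [h3, neg_neg] at h1
  have h4 : (3 : K) • V.br (V.br x x) x = 0 := by
    rw [show (3 : K) = 1 + 1 + 1 by norm_num, add_smul, add_smul, one_smul]
    nth_rewrite 1 [← neg_neg (V.br (V.br x x) x)]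
    rw [h1]; abel
  simpa using h4

/-- The curvature `d x + [x, x] / 2` satisfies the Bianchi identity. -/
theorem d_curvature [CharZero K] {x : V} (hx : x ∈ V.gr 1) :
    V.d (V.d x + (2 : K)⁻¹ • V.br x x) = V.br (V.d x + (2 : K)⁻¹ • V.br x x) x := by
  have h1 := V.leibniz 1 x x hx
  have h2 := V.br_symm 1 2 x (V.d x) hx (V.d_mem 1 x hx)
  rw [show ((-1 : K) ^ ((1 : ℤ) * 2)) = 1 by norm_num, one_smul] at h2
  have h3 : V.br x (V.d x) = - V.br (V.d x) x := eq_neg_of_add_eq_zero_left h2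
  rw [map_add, V.d_d, map_smul, h1, h3]
  -- The Leibniz rule only produces `[d x, x]`; the extra term `[[x, x], x] / 2` of the right hand
  -- side is zero.
  simp only [zpow_one, neg_smul, one_smul, neg_neg, smul_neg, map_add, map_smul,
    LinearMap.add_apply, LinearMap.smul_apply, br_br_self hx, smul_zero, add_zero, zero_add]
  rw [← two_smul K, smul_smul, inv_mul_cancel₀ two_ne_zero, one_smul]

end DGLA
-- The differential graded Lie algebra `L ⊗ A`.
-- Each comparison of Koszul signs below comes down to two exponents with even difference, and `k`
-- is the explicit half of that difference.
theorem neg_one_zpow_congr {m n : ℤ} (k : ℤ) (h : m = n + 2 * k) : (-1 : K) ^ m = (-1) ^ n := by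
  rw [h, zpow_add₀ (by simp), (even_two_mul k).neg_one_zpow, mul_one]

section

variable (L : DGLA K) (A : ArtDGA K)

theorem tmul_mem_tensGr {i j n : ℤ} {x : L} {a : A} (hx : x ∈ L.gr i) (ha : a ∈ A.gr j)
    (h : i + j = n) : x ⊗ₜ[K] a ∈ tensGr L A n := by
  obtain rfl : j = n - i := by omega
  exact (le_iSup (fun i : ℤ => LinearMap.range
    (TensorProduct.map (L.gr i).subtype (A.gr (n - i)).subtype)) i) ⟨⟨x, hx⟩ ⊗ₜ ⟨a, ha⟩, rfl⟩

theorem tensGr_induction {n : ℤ} {P : L ⊗[K] A → Prop} {z : L ⊗[K] A} (hz : z ∈ tensGr L A n)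
    (zero : P 0) (add : ∀ z w, P z → P w → P (z + w))
    (tmul : ∀ i j x a, x ∈ L.gr i → a ∈ A.gr j → i + j = n → P (x ⊗ₜ a)) : P z := by
  refine Submodule.iSup_induction _ (motive := P) hz ?_ zero add
  rintro i _ ⟨w, rfl⟩
  induction w using TensorProduct.induction_on with
  | zero => simpa using zero
  | add v w hv hw => rw [map_add]; exact add _ _ hv hw
  | tmul x a => exact tmul i (n - i) _ _ x.2 a.2 (by omega)

/-- `L` may have infinitely many nonzero degrees, so `isInternal_of_proj` does not apply. The
projection to degree `n` is still a finite sum, because only finitely many degrees of `A` occur. -/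
theorem tens_internal : DirectSum.IsInternal (tensGr L A) := by
  obtain ⟨s, hs⟩ := exists_finset_proj A.internal
  have hs := hs s subset_rfl
  let π : ℤ → L ⊗[K] A →ₗ[K] L ⊗[K] A := fun n =>
    ∑ j ∈ s, TensorProduct.map (proj L.internal (n - j)) (proj A.internal j)
  have same : ∀ n, ∀ z ∈ tensGr L A n, π n z = z := by
    intro n z hz
    refine tensGr_induction L A (P := fun z => π n z = z) hz (map_zero _)
      (fun z w h1 h2 => by rw [map_add, h1, h2]) ?_
    intro i j x a hx ha h
    simp only [π, LinearMap.sum_apply, TensorProduct.map_tmul]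
    conv_rhs => rw [← hs a, TensorProduct.tmul_sum]
    refine Finset.sum_congr rfl fun k _ => ?_
    by_cases hk : j = k
    · rw [← hk, show n - j = i by omega, proj_same _ hx]
    · rw [proj_ne _ hk ha, TensorProduct.tmul_zero, TensorProduct.tmul_zero]
  have ne : ∀ m n, m ≠ n → ∀ z ∈ tensGr L A m, π n z = 0 := by
    intro m n hmn z hz
    refine tensGr_induction L A (P := fun z => π n z = 0) hz (map_zero _)
      (fun z w h1 h2 => by rw [map_add, h1, h2, add_zero]) ?_
    intro i j x a hx ha h
    simp only [π, LinearMap.sum_apply, TensorProduct.map_tmul]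
    refine Finset.sum_eq_zero fun k _ => ?_
    by_cases hk : j = k
    · rw [proj_ne _ (by omega) hx, TensorProduct.zero_tmul]
    · rw [proj_ne _ hk ha, TensorProduct.tmul_zero]
  rw [DirectSum.isInternal_submodule_iff_iSupIndep_and_iSup_eq_top]
  refine ⟨fun n => ?_, ?_⟩
  · rw [Submodule.disjoint_def]
    intro v hv hv'
    have h0 : (⨆ j, ⨆ (_ : j ≠ n), tensGr L A j) ≤ LinearMap.ker (π n) :=
      iSup_le fun j => iSup_le fun hj => fun w hw => ne j n hj w hw
    rw [← same n v hv]
    exact h0 hv'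
  · rw [eq_top_iff]
    intro z _
    induction z using TensorProduct.induction_on with
    | zero => exact zero_mem _
    | add z w hz hw => exact add_mem (hz trivial) (hw trivial)
    | tmul x a =>
      refine graded_induction L.internal (P := fun x => x ⊗ₜ[K] a ∈ ⨆ i, tensGr L A i) x ?_ ?_
      · intro i x hx
        refine graded_induction A.internal (P := fun a => x ⊗ₜ[K] a ∈ ⨆ i, tensGr L A i) a ?_ ?_
        · intro j a ha
          exact (le_iSup (tensGr L A) (i + j)) (tmul_mem_tensGr L A hx ha rfl)
        · intro a b ha hb
          rw [TensorProduct.tmul_add]; exact add_mem ha hb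
      · intro x y hx hy
        rw [TensorProduct.add_tmul]; exact add_mem hx hy

theorem tensD_mem {n : ℤ} {z : L ⊗[K] A} (hz : z ∈ tensGr L A n) :
    tensD L A z ∈ tensGr L A (n + 1) := by
  refine tensGr_induction L A (P := fun z => tensD L A z ∈ tensGr L A (n + 1)) hz
    (by rw [map_zero]; exact zero_mem _)
    (fun z w h1 h2 => by rw [map_add]; exact add_mem h1 h2) ?_
  intro i j x a hx ha h
  rw [tensD_tmul L A hx]
  exact add_mem (tmul_mem_tensGr L A (L.d_mem _ _ hx) ha (by omega))
    (Submodule.smul_mem _ _ (tmul_mem_tensGr L A hx (A.d_mem _ _ ha) (by omega)))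

theorem tensBr_mem {m n : ℤ} {z w : L ⊗[K] A} (hz : z ∈ tensGr L A m) (hw : w ∈ tensGr L A n) :
    tensBr L A z w ∈ tensGr L A (m + n) := by
  refine tensGr_induction L A (P := fun z => tensBr L A z w ∈ tensGr L A (m + n)) hz
    (by rw [map_zero]; exact zero_mem _)
    (fun z w h1 h2 => by rw [map_add, LinearMap.add_apply]; exact add_mem h1 h2) ?_
  intro i p x a hx ha h
  refine tensGr_induction L A
    (P := fun w => tensBr L A (x ⊗ₜ a) w ∈ tensGr L A (m + n)) hw
    (by rw [map_zero]; exact zero_mem _)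
    (fun z w h1 h2 => by rw [map_add]; exact add_mem h1 h2) ?_
  intro j q y b hy hb h'
  rw [tensBr_tmul L A ha hy]
  exact Submodule.smul_mem _ _ (tmul_mem_tensGr L A (L.br_mem _ _ _ _ hx hy)
    (A.mul_mem _ _ _ _ ha hb) (by omega))

theorem tensD_tensD (z : L ⊗[K] A) : tensD L A (tensD L A z) = 0 := by
  refine graded_induction (tens_internal L A) (P := fun z => tensD L A (tensD L A z) = 0) z ?_
    (fun z w h1 h2 => by rw [map_add, map_add, h1, h2, add_zero])
  intro n z hz
  refine tensGr_induction L A (P := fun z => tensD L A (tensD L A z) = 0) hz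
    (by simp) (fun z w h1 h2 => by rw [map_add, map_add, h1, h2, add_zero]) ?_
  intro i p x a hx ha h
  rw [tensD_tmul L A hx, map_add, map_smul, tensD_tmul L A (L.d_mem _ _ hx), tensD_tmul L A hx,
    L.d_d, A.d_d, zpow_add₀ (by simp)]
  simp

theorem tensBr_symm {m n : ℤ} {z w : L ⊗[K] A} (hz : z ∈ tensGr L A m) (hw : w ∈ tensGr L A n) :
    tensBr L A z w + ((-1 : K) ^ (m * n)) • tensBr L A w z = 0 := by
  refine tensGr_induction L A
    (P := fun z => tensBr L A z w + ((-1 : K) ^ (m * n)) • tensBr L A w z = 0) hz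
    (by simp) (fun z z' h1 h2 => ?_) ?_
  · rw [map_add, map_add, LinearMap.add_apply, smul_add, add_add_add_comm, h1, h2, add_zero]
  intro i p x a hx ha h
  refine tensGr_induction L A (P := fun w => tensBr L A (x ⊗ₜ a) w +
    ((-1 : K) ^ (m * n)) • tensBr L A w (x ⊗ₜ a) = 0) hw
    (by simp) (fun w w' h1 h2 => ?_) ?_
  · rw [map_add, map_add, LinearMap.add_apply, smul_add, add_add_add_comm, h1, h2, add_zero]
  intro j q y b hy hb h'
  rw [tensBr_tmul L A ha hy, tensBr_tmul L A hb hx, eq_neg_of_add_eq_zero_left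
    (L.br_symm i j x y hx hy), A.graded_comm p q a b ha hb, TensorProduct.neg_tmul,
    TensorProduct.smul_tmul_smul, smul_neg, smul_smul, smul_smul, neg_add_eq_zero]
  congr 1
  simp only [← zpow_add₀ (show (-1 : K) ≠ 0 by simp)]
  subst h h'
  exact neg_one_zpow_congr (- i * q) (by ring)

theorem tensBr_jacobi {m n : ℤ} {X Y : L ⊗[K] A} (Z : L ⊗[K] A) (hX : X ∈ tensGr L A m)
    (hY : Y ∈ tensGr L A n) : tensBr L A X (tensBr L A Y Z) =
      tensBr L A (tensBr L A X Y) Z + ((-1 : K) ^ (m * n)) • tensBr L A Y (tensBr L A X Z) := by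
  refine tensGr_induction L A
    (P := fun X => tensBr L A X (tensBr L A Y Z) =
      tensBr L A (tensBr L A X Y) Z + ((-1 : K) ^ (m * n)) • tensBr L A Y (tensBr L A X Z)) hX
    (by simp) (fun z z' h1 h2 => ?_) ?_
  · simp only [map_add, LinearMap.add_apply, smul_add, h1, h2]; abel
  intro i p x a hx ha h
  refine tensGr_induction L A
    (P := fun Y => tensBr L A (x ⊗ₜ a) (tensBr L A Y Z) =
      tensBr L A (tensBr L A (x ⊗ₜ a) Y) Z +
        ((-1 : K) ^ (m * n)) • tensBr L A Y (tensBr L A (x ⊗ₜ a) Z)) hY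
    (by simp) (fun z z' h1 h2 => ?_) ?_
  · simp only [map_add, LinearMap.add_apply, smul_add, h1, h2]; abel
  intro j q y b hy hb h'
  refine graded_induction (tens_internal L A)
    (P := fun Z => tensBr L A (x ⊗ₜ a) (tensBr L A (y ⊗ₜ b) Z) =
      tensBr L A (tensBr L A (x ⊗ₜ a) (y ⊗ₜ b)) Z +
        ((-1 : K) ^ (m * n)) • tensBr L A (y ⊗ₜ b) (tensBr L A (x ⊗ₜ a) Z)) Z ?_
    (fun z z' h1 h2 => by simp only [map_add, smul_add, h1, h2]; abel)
  intro l Z hZ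
  refine tensGr_induction L A
    (P := fun Z => tensBr L A (x ⊗ₜ a) (tensBr L A (y ⊗ₜ b) Z) =
      tensBr L A (tensBr L A (x ⊗ₜ a) (y ⊗ₜ b)) Z +
        ((-1 : K) ^ (m * n)) • tensBr L A (y ⊗ₜ b) (tensBr L A (x ⊗ₜ a) Z)) hZ
    (by simp) (fun z z' h1 h2 => by simp only [map_add, smul_add, h1, h2]; abel) ?_
  intro k r z c hz hc _
  rw [tensBr_tmul L A hb hz, tensBr_tmul L A ha hz, tensBr_tmul L A ha hy, map_smul, map_smul,
    map_smul, LinearMap.smul_apply, tensBr_tmul L A ha (L.br_mem _ _ _ _ hy hz),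
    tensBr_tmul L A (A.mul_mem _ _ _ _ ha hb) hz, tensBr_tmul L A hb (L.br_mem _ _ _ _ hx hz),
    L.jacobi i j x y z hx hy, TensorProduct.add_tmul, ← mul_assoc, ← mul_assoc,
    A.graded_comm q p b a hb ha, smul_mul_assoc, TensorProduct.tmul_smul]
  simp only [← TensorProduct.smul_tmul', smul_add, smul_smul, ← zpow_add₀ (show (-1 : K) ≠ 0 by simp)]
  subst h h'
  refine congrArg₂ (· + ·) (congrArg (· • _) ?_) (congrArg (· • _) ?_)
  · exact neg_one_zpow_congr 0 (by ring)
  · exact neg_one_zpow_congr (- i * q - p * q) (by ring)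

theorem tensBr_leibniz {m : ℤ} {X : L ⊗[K] A} (Y : L ⊗[K] A) (hX : X ∈ tensGr L A m) :
    tensD L A (tensBr L A X Y) =
      tensBr L A (tensD L A X) Y + ((-1 : K) ^ m) • tensBr L A X (tensD L A Y) := by
  refine tensGr_induction L A
    (P := fun X => tensD L A (tensBr L A X Y) =
      tensBr L A (tensD L A X) Y + ((-1 : K) ^ m) • tensBr L A X (tensD L A Y)) hX
    (by simp) (fun z z' h1 h2 => ?_) ?_
  · simp only [map_add, LinearMap.add_apply, smul_add, h1, h2]; abel
  intro i p x a hx ha h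
  refine graded_induction (tens_internal L A)
    (P := fun Y => tensD L A (tensBr L A (x ⊗ₜ a) Y) =
      tensBr L A (tensD L A (x ⊗ₜ a)) Y + ((-1 : K) ^ m) • tensBr L A (x ⊗ₜ a) (tensD L A Y))
    Y ?_ (fun z z' h1 h2 => by simp only [map_add, smul_add, h1, h2]; abel)
  intro n Y hY
  refine tensGr_induction L A
    (P := fun Y => tensD L A (tensBr L A (x ⊗ₜ a) Y) =
      tensBr L A (tensD L A (x ⊗ₜ a)) Y + ((-1 : K) ^ m) • tensBr L A (x ⊗ₜ a) (tensD L A Y))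
    hY (by simp) (fun z z' h1 h2 => by simp only [map_add, smul_add, h1, h2]; abel) ?_
  intro j q y b hy hb _
  rw [tensBr_tmul L A ha hy, map_smul, tensD_tmul L A (L.br_mem _ _ _ _ hx hy), tensD_tmul L A hx,
    tensD_tmul L A hy, L.leibniz i x y hx, A.leibniz p a b ha, map_add, map_add, map_smul, map_smul,
    LinearMap.add_apply, LinearMap.smul_apply, tensBr_tmul L A ha hy,
    tensBr_tmul L A (A.d_mem _ _ ha) hy, tensBr_tmul L A ha (L.d_mem _ _ hy), tensBr_tmul L A ha hy]
  simp only [TensorProduct.add_tmul, TensorProduct.tmul_add, TensorProduct.tmul_smul,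
    ← TensorProduct.smul_tmul', smul_add, smul_smul, ← zpow_add₀ (show (-1 : K) ≠ 0 by simp)]
  subst h
  rw [neg_one_zpow_congr (K := K) (m := p * j + i) (n := i + p + p * (j + 1)) (-p) (by ring),
    neg_one_zpow_congr (K := K) (m := p * j + (i + j)) (n := i + (p + 1) * j) 0 (by ring),
    neg_one_zpow_congr (K := K) (m := p * j + (i + j + p)) (n := i + p + (j + p * j)) 0 (by ring)]
  abel

/-- The differential graded Lie algebra `L ⊗ A`. -/
noncomputable def tens : DGLA K where
  carrier := L ⊗[K] A
  gr := tensGr L A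
  internal := tens_internal L A
  d := tensD L A
  d_mem _ _ h := tensD_mem L A h
  d_d := tensD_tensD L A
  br := tensBr L A
  br_mem _ _ _ _ h h' := tensBr_mem L A h h'
  br_symm _ _ _ _ h h' := tensBr_symm L A h h'
  jacobi _ _ _ _ z h h' := tensBr_jacobi L A z h h'
  leibniz _ _ y h := tensBr_leibniz L A y h

theorem tensBr_isNilpotent (u : L ⊗[K] A) :
    IsNilpotent (tensBr L A u : Module.End K (L ⊗[K] A)) := by
  obtain ⟨N, hN⟩ := tensBr_nilpotent L A
  exact ⟨N, LinearMap.ext fun x => hN N le_rfl u x⟩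

variable {L A}

/-- By definition `gauge L A` is `gaugeAct` for `tens L A`, where every `ad u` is nilpotent because
`A` is. -/
theorem gauge_mem_MCSet [CharZero K] {u x : L ⊗[K] A} (hu : u ∈ tensGr L A 0)
    (hx : x ∈ MCSet L A) : gauge L A u x ∈ MCSet L A :=
  DGLA.gaugeAct_isMC (V := tens L A) hu (tensBr_isNilpotent L A u) hx

theorem gauge_neg [CharZero K] {u x : L ⊗[K] A} (hu : u ∈ tensGr L A 0)
    (hx : x ∈ MCSet L A) : gauge L A (-u) (gauge L A u x) = x :=
  DGLA.gaugeAct_neg (V := tens L A) hu (tensBr_isNilpotent L A u) hx.1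

theorem gauge_of_br_eq_zero {u : L ⊗[K] A} (hu : ∀ w, tensBr L A u w = 0) (x : L ⊗[K] A) :
    gauge L A u x = x - tensD L A u :=
  DGLA.gaugeAct_of_br_eq_zero (V := tens L A) hu x

/-- Symmetry is all that is used of the group structure: chains of gauge transformations replace the
Baker-Campbell-Hausdorff product. -/
theorem GaugeRel.symm [CharZero K] {x y : MCSet L A} (h : GaugeRel L A x y) :
    GaugeRel L A y x := by
  obtain ⟨u, hu, h⟩ := h
  exact ⟨-u, neg_mem hu, by rw [h, gauge_neg hu x.2]⟩

end
-- Graded linear algebra and contractions.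
section LinearAlgebra

variable {V W : Type u} [AddCommGroup V] [Module K V] [AddCommGroup W] [Module K W]

theorem proj_natural {gr : ℤ → Submodule K V} (h : DirectSum.IsInternal gr)
    {gr' : ℤ → Submodule K W} (h' : DirectSum.IsInternal gr')
    (φ : V →ₗ[K] W) (hφ : ∀ i, ∀ v ∈ gr i, φ v ∈ gr' i) (n : ℤ) (v : V) :
    φ (proj h n v) = proj h' n (φ v) :=
  onPieces_natural h h' φ hφ _ _ φ (fun i v => by split_ifs <;> simp) v

theorem parity_parity {gr : ℤ → Submodule K V} (h : DirectSum.IsInternal gr) (v : V) :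
    parity h (parity h v) = v := by
  refine graded_ext h (f := (parity h).comp (parity h)) (g := LinearMap.id) ?_ v
  intro i v hv
  simp [parity_apply h hv, smul_smul, ← mul_zpow]

theorem d_parity_of_degree_one {gr : ℤ → Submodule K V} (h : DirectSum.IsInternal gr)
    (d : V →ₗ[K] V) (hd : ∀ i, ∀ v ∈ gr i, d v ∈ gr (i + 1)) (v : V) :
    d (parity h v) = - parity h (d v) := by
  refine graded_ext h (f := d.comp (parity h)) (g := - (parity h).comp d) ?_ v
  intro i v hv
  simp [parity_apply h hv, parity_apply h (hd i v hv), zpow_add₀]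

theorem proj_d {gr : ℤ → Submodule K V} (h : DirectSum.IsInternal gr)
    (d : V →ₗ[K] V) (hd : ∀ i, ∀ v ∈ gr i, d v ∈ gr (i + 1)) (n : ℤ) (v : V) :
    d (proj h n v) = proj h (n + 1) (d v) := by
  refine graded_ext h (f := d.comp (proj h n)) (g := (proj h (n + 1)).comp d) ?_ v
  intro i v hv
  by_cases hi : i = n
  · subst hi; simp [proj_same h hv, proj_same h (hd _ _ hv)]
  · simp [proj_ne h hi hv, proj_ne h (show i + 1 ≠ n + 1 by omega) (hd _ _ hv)]

/-- An acyclic complex over a field is contractible. -/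
theorem exists_contraction (d : V →ₗ[K] V) (hd : ∀ v, d (d v) = 0)
    (hex : ∀ v, d v = 0 → ∃ w, d w = v) : ∃ h : V →ₗ[K] V, ∀ v, d (h v) + h (d v) = v := by
  let d' : V →ₗ[K] LinearMap.ker d := d.codRestrict _ fun v => hd v
  obtain ⟨σ, hσ⟩ := d'.exists_rightInverse_of_surjective
    (LinearMap.range_eq_top.2 fun ⟨v, hv⟩ => (hex v hv).imp fun w hw => Subtype.ext hw)
  have hσ' : ∀ z, d (σ z) = z := fun z => congrArg Subtype.val (LinearMap.congr_fun hσ z)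
  have hτ : ∀ v, ((LinearMap.id : V →ₗ[K] V) - σ.comp d') v ∈ LinearMap.ker d := fun v => by
    rw [LinearMap.mem_ker, LinearMap.sub_apply, map_sub, LinearMap.comp_apply, hσ']
    exact sub_self _
  -- With `σ` a section of `d` onto the cycles, take `h v = σ (v - σ (d v))`: then `d (h v) = v - σ
  -- (d v)` and `h (d v) = σ (d v)`.
  refine ⟨σ.comp ((LinearMap.id - σ.comp d').codRestrict _ hτ), fun v => ?_⟩
  have e1 : d' (d v) = 0 := Subtype.ext (hd v)
  have e2 : (LinearMap.id - σ.comp d').codRestrict (LinearMap.ker d) hτ (d v) = d' v :=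
    Subtype.ext (by
      change d v - σ (d' (d v)) = d v
      rw [e1, map_zero, sub_zero])
  rw [LinearMap.comp_apply, LinearMap.comp_apply, hσ', e2]
  exact sub_add_cancel _ _

/-- A contraction of an acyclic subcomplex. -/
theorem exists_contraction_on (d : V →ₗ[K] V) (hd : ∀ v, d (d v) = 0) (I : Submodule K V)
    (hI : ∀ v ∈ I, d v ∈ I) (hex : ∀ v ∈ I, d v = 0 → ∃ w ∈ I, d w = v) :
    ∃ h : V →ₗ[K] V, ∀ v ∈ I, h v ∈ I ∧ d (h v) + h (d v) = v := by
  obtain ⟨h, hh⟩ := exists_contraction (d.restrict hI) (fun v => Subtype.ext (hd v))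
    (fun v hv => by
      obtain ⟨w, hw, e⟩ := hex v v.2 (congrArg Subtype.val hv)
      exact ⟨⟨w, hw⟩, Subtype.ext e⟩)
  -- The extension to the whole space is arbitrary; only its values on `I` matter.
  obtain ⟨g, hg⟩ := LinearMap.exists_extend (I.subtype.comp h)
  have hg' : ∀ v (hv : v ∈ I), g v = h ⟨v, hv⟩ := fun v hv => LinearMap.congr_fun hg ⟨v, hv⟩
  refine ⟨g, fun v hv => ⟨by rw [hg' v hv]; exact Subtype.prop _, ?_⟩⟩
  rw [hg' v hv, hg' _ (hI v hv)]
  exact congrArg Subtype.val (hh ⟨v, hv⟩)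

end LinearAlgebra

/-! ### Fibre products and acyclic small extensions after tensoring with `L`. -/

section Tensor

variable (L : DGLA K) {A B C P : ArtDGA K}

theorem map_mem_tensGr (f : A →ₗ[K] B) (hf : ∀ i, ∀ a ∈ A.gr i, f a ∈ B.gr i) {n : ℤ}
    {z : L ⊗[K] A} (hz : z ∈ tensGr L A n) : f.lTensor L z ∈ tensGr L B n := by
  refine tensGr_induction L A (P := fun z => f.lTensor L z ∈ tensGr L B n) hz
    (by rw [map_zero]; exact zero_mem _)
    (fun z w h1 h2 => by rw [map_add]; exact add_mem h1 h2) ?_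
  exact fun i j x a hx ha h => tmul_mem_tensGr L B hx (hf _ _ ha) h

theorem proj_tensMap (f : A ⟶ B) (n : ℤ) (z : L ⊗[K] A) :
    tensMap (𝟙 L) f (proj (tens_internal L A) n z) =
      proj (tens_internal L B) n (tensMap (𝟙 L) f z) :=
  proj_natural _ _ _ (fun _ _ h => tensMap_gr _ _ h) n z

theorem exists_lift_tensMap (f : A ⟶ B) (hf : Function.Surjective (ArtDGA.lin f)) {n : ℤ}
    {z : L ⊗[K] B} (hz : z ∈ tensGr L B n) :
    ∃ w ∈ tensGr L A n, tensMap (𝟙 L) f w = z := by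
  obtain ⟨w, rfl⟩ := LinearMap.lTensor_surjective L hf z
  refine ⟨proj (tens_internal L A) n w, proj_mem _ _ _, ?_⟩
  rw [proj_tensMap]
  exact proj_same _ hz

/-- The coordinates of an element of `L ⊗ A` in a basis of `L`. -/
noncomputable def tensCoord (A : ArtDGA K) :
    L ⊗[K] A ≃ₗ[K] (Module.Basis.ofVectorSpaceIndex K L →₀ A) :=
  open Classical in TensorProduct.equivFinsuppOfBasisLeft (Module.Basis.ofVectorSpace K L)

theorem tensCoord_tensMap (f : A ⟶ B) (z : L ⊗[K] A) (i) :
    tensCoord L B (tensMap (𝟙 L) f z) i = ArtDGA.lin f (tensCoord L A z i) := by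
  induction z using TensorProduct.induction_on with
  | zero => simp
  | add z w hz hw => simp only [map_add, Finsupp.add_apply, hz, hw]
  | tmul x a =>
    change tensCoord L B (x ⊗ₜ ArtDGA.lin f a) i = _
    simp [tensCoord]

/-- In a basis of `L`, an element of `L ⊗ P` is a finitely supported family in `P`, and the
uniqueness in the fibre product applies to each coordinate. -/
theorem tens_fibre_ext {p : P ⟶ A} {q : P ⟶ B} {α : A ⟶ C} {β : B ⟶ C}
    (h : IsFibreProduct p q α β) {z w : L ⊗[K] P} (hp : tensMap (𝟙 L) p z = tensMap (𝟙 L) p w)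
    (hq : tensMap (𝟙 L) q z = tensMap (𝟙 L) q w) : z = w := by
  apply (tensCoord L P).injective
  ext i
  have hc : ∀ x, ArtDGA.lin α (ArtDGA.lin p x) = ArtDGA.lin β (ArtDGA.lin q x) := fun x => by
    have := congrArg (fun f => ArtDGA.lin f x) h.1
    simpa using this
  refine (h.2 _ _ (hc (tensCoord L P w i))).unique ⟨?_, ?_⟩ ⟨rfl, rfl⟩
  · rw [← tensCoord_tensMap, ← tensCoord_tensMap, hp]
  · rw [← tensCoord_tensMap, ← tensCoord_tensMap, hq]

theorem tens_fibre_exists {p : P ⟶ A} {q : P ⟶ B} {α : A ⟶ C} {β : B ⟶ C}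
    (h : IsFibreProduct p q α β) {n : ℤ} {a : L ⊗[K] A} {b : L ⊗[K] B} (ha : a ∈ tensGr L A n)
    (hb : b ∈ tensGr L B n) (hab : tensMap (𝟙 L) α a = tensMap (𝟙 L) β b) :
    ∃ z ∈ tensGr L P n, tensMap (𝟙 L) p z = a ∧ tensMap (𝟙 L) q z = b := by
  classical
  have key : ∀ a b, ∃ x, ArtDGA.lin α a = ArtDGA.lin β b →
      ArtDGA.lin p x = a ∧ ArtDGA.lin q x = b := fun a b => by
    by_cases hab : ArtDGA.lin α a = ArtDGA.lin β b
    · exact (h.2 a b hab).exists.imp fun x hx _ => hx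
    · exact ⟨0, fun h => (hab h).elim⟩
  choose g hg using key
  -- Vanishing at `(0, 0)` keeps the coordinatewise lift finitely supported.
  have hg0 : g 0 0 = 0 := (h.2 0 0 (by simp)).unique (hg 0 0 (by simp)) (by simp)
  let z : L ⊗[K] P := (tensCoord L P).symm
    (Finsupp.zipWith g hg0 (tensCoord L A a) (tensCoord L B b))
  have hz : ∀ i, tensCoord L P z i = g (tensCoord L A a i) (tensCoord L B b i) := fun i => by
    simp [z]
  have hc : ∀ i, ArtDGA.lin α (tensCoord L A a i) = ArtDGA.lin β (tensCoord L B b i) := fun i => by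
    rw [← tensCoord_tensMap, ← tensCoord_tensMap, hab]
  have h1 : tensMap (𝟙 L) p z = a := by
    apply (tensCoord L A).injective
    ext i
    rw [tensCoord_tensMap, hz, (hg _ _ (hc i)).1]
  have h2 : tensMap (𝟙 L) q z = b := by
    apply (tensCoord L B).injective
    ext i
    rw [tensCoord_tensMap, hz, (hg _ _ (hc i)).2]
  -- The chosen lift need not be homogeneous, but its component of degree `n` has the same images,
  -- as these are of degree `n`.
  refine ⟨proj (tens_internal L P) n z, proj_mem _ _ _, ?_, ?_⟩
  · rw [proj_tensMap, h1]; exact proj_same _ ha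
  · rw [proj_tensMap, h2]; exact proj_same _ hb

/-- `L` is flat over the field `K`, so the kernel of `L ⊗ α` is the image of `L ⊗ ker α`. -/
theorem tensMap_ker_induction (α : A ⟶ B) {P : L ⊗[K] A → Prop} {z : L ⊗[K] A}
    (hz : tensMap (𝟙 L) α z = 0) (zero : P 0) (add : ∀ z w, P z → P w → P (z + w))
    (tmul : ∀ x a, ArtDGA.lin α a = 0 → P (x ⊗ₜ a)) : P z := by
  obtain ⟨w, rfl⟩ := (Module.Flat.lTensor_exact L
    (LinearMap.exact_subtype_ker_map (ArtDGA.lin α)) z).1 hz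
  clear hz
  induction w using TensorProduct.induction_on with
  | zero => rw [map_zero]; exact zero
  | add v w hv hw => rw [map_add]; exact add _ _ hv hw
  | tmul x a => exact tmul x _ a.2

variable {L}

theorem IsAcyclicSmall.br_right {α : A ⟶ B} (h : IsAcyclicSmall α) (w : L ⊗[K] A)
    {z : L ⊗[K] A} (hz : tensMap (𝟙 L) α z = 0) : tensBr L A w z = 0 := by
  refine tensMap_ker_induction L α (P := fun z => tensBr L A w z = 0) hz (map_zero _)
    (fun z w h1 h2 => by rw [map_add, h1, h2, add_zero]) ?_
  intro x a ha
  induction w using TensorProduct.induction_on with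
  | zero => simp
  | add v w hv hw => rw [map_add, LinearMap.add_apply, hv, hw, add_zero]
  | tmul y b => simp [tensBr, h.2.1 _ a ha]

theorem IsAcyclicSmall.br_left {α : A ⟶ B} (h : IsAcyclicSmall α) (w : L ⊗[K] A) {n : ℤ}
    {z : L ⊗[K] A} (hn : z ∈ tensGr L A n) (hz : tensMap (𝟙 L) α z = 0) :
    tensBr L A z w = 0 := by
  refine graded_induction (tens_internal L A) (P := fun w => tensBr L A z w = 0) w ?_
    (fun z w h1 h2 => by rw [map_add, h1, h2, add_zero])
  intro m w hw
  have := tensBr_symm L A hn hw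
  rwa [h.br_right w hz, smul_zero, add_zero] at this

/-- If `σ` contracts the kernel `I` of `α`, then `parity ⊗ σ` contracts `L ⊗ I`: the parity cancels
the sign in the differential of the tensor product. -/
theorem IsAcyclicSmall.exact {α : A ⟶ B} (h : IsAcyclicSmall α) {n : ℤ} {z : L ⊗[K] A}
    (hn : z ∈ tensGr L A (n + 1)) (hz : tensMap (𝟙 L) α z = 0) (hd : tensD L A z = 0) :
    ∃ y ∈ tensGr L A n, tensMap (𝟙 L) α y = 0 ∧ tensD L A y = z := by
  obtain ⟨σ, hσ⟩ := exists_contraction_on A.d A.d_d (LinearMap.ker (ArtDGA.lin α))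
    (fun v hv => by rw [LinearMap.mem_ker] at hv ⊢; rw [ArtDGA.map_d, hv, map_zero])
    (fun v hv hd => h.2.2 v hv hd)
  let H : L ⊗[K] A →ₗ[K] L ⊗[K] A := TensorProduct.map (parity L.internal) σ
  have key : tensMap (𝟙 L) α (H z) = 0 ∧ tensD L A (H z) + H (tensD L A z) = z := by
    refine tensMap_ker_induction L α (P := fun z => tensMap (𝟙 L) α (H z) = 0 ∧
      tensD L A (H z) + H (tensD L A z) = z) hz (by simp) ?_ ?_
    · rintro z w ⟨h1, h2⟩ ⟨h3, h4⟩
      refine ⟨by rw [map_add, map_add, h1, h3, add_zero], ?_⟩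
      conv_rhs => rw [← h2, ← h4]
      simp only [map_add]; abel
    · intro x a ha
      obtain ⟨h1, h2⟩ := hσ a ha
      have h1' : ArtDGA.lin α (σ a) = 0 := h1
      refine ⟨by simp [tensMap, H, h1'], ?_⟩
      simp only [H, tensD, TensorProduct.map_tmul, LinearMap.add_apply, map_add, LinearMap.id_apply,
        parity_parity, d_parity_of_degree_one L.internal L.d L.d_mem]
      conv_rhs => rw [← h2]
      rw [TensorProduct.tmul_add, TensorProduct.neg_tmul]
      abel
  obtain ⟨h1, h2⟩ := key
  rw [hd, map_zero, add_zero] at h2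
  -- `σ` is not assumed homogeneous; the component of degree `n` of the primitive is again a
  -- primitive.
  refine ⟨proj (tens_internal L A) n (H z), proj_mem _ _ _, ?_, ?_⟩
  · rw [proj_tensMap, h1, map_zero]
  · rw [proj_d (tens_internal L A) (tensD L A) (fun _ _ h => tensD_mem L A h), h2]
    exact proj_same _ hn

end Tensor

/-! ### `MC_L` is a predeformation functor. -/

section MaurerCartan

variable (L : DGLA K) {A B C P : ArtDGA K}

/-- `L ⊗ P` is the fibre product of `L ⊗ A` and `L ⊗ B`, and the curvature of an element vanishes
once both of its projections do. -/
theorem MC_fibre {p : P ⟶ A} {q : P ⟶ B} {α : A ⟶ C} {β : B ⟶ C} (h : IsFibreProduct p q α β)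
    (a : (MC L).obj A) (b : (MC L).obj B) (hab : (MC L).map α a = (MC L).map β b) :
    ∃! x : (MC L).obj P, (MC L).map p x = a ∧ (MC L).map q x = b := by
  obtain ⟨z, hz, h1, h2⟩ := tens_fibre_exists L h a.2.1 b.2.1 (congrArg Subtype.val hab)
  have hmc : z ∈ MCSet L P := by
    refine ⟨hz, tens_fibre_ext L h ?_ ?_⟩
    · rw [map_add, map_smul, tensMap_d, tensMap_br, h1, map_zero]
      exact a.2.2
    · rw [map_add, map_smul, tensMap_d, tensMap_br, h2, map_zero]
      exact b.2.2
  refine ⟨⟨z, hmc⟩, ⟨Subtype.ext h1, Subtype.ext h2⟩, ?_⟩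
  rintro ⟨y, hy⟩ ⟨h3, h4⟩
  exact Subtype.ext (tens_fibre_ext L h ((congrArg Subtype.val h3).trans h1.symm)
    ((congrArg Subtype.val h4).trans h2.symm))

/-- The curvature `c` of any lift `y` lies in `L ⊗ I`. The Bianchi identity `d c = [c, y]` makes it
closed because brackets with `L ⊗ I` vanish; so `c = d z` with `z` in `L ⊗ I`, and `y - z` solves
the equation. -/
theorem MC_quasismooth [CharZero K] {α : A ⟶ B} (h : IsAcyclicSmall α) :
    Function.Surjective ((MC L).map α : (MC L).obj A → (MC L).obj B) := by
  intro x
  obtain ⟨y, hy, hyx⟩ := exists_lift_tensMap L α h.1 x.2.1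
  let c := tensD L A y + (2 : K)⁻¹ • tensBr L A y y
  have hcd : tensD L A c = tensBr L A c y := DGLA.d_curvature (V := tens L A) hy
  have hc : tensMap (𝟙 L) α c = 0 := by
    rw [map_add, map_smul, tensMap_d, tensMap_br, hyx]
    exact x.2.2
  have hc2 : c ∈ tensGr L A (1 + 1) :=
    add_mem (tensD_mem L A hy) (Submodule.smul_mem _ _ (tensBr_mem L A hy hy))
  rw [h.br_left y hc2 hc] at hcd
  obtain ⟨z, hz, hz0, hzc⟩ := h.exact hc2 hc hcd
  refine ⟨⟨y - z, sub_mem hy hz, ?_⟩, Subtype.ext ?_⟩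
  · simp only [map_sub, LinearMap.sub_apply, h.br_right _ hz0, h.br_left _ hz hz0, sub_zero, hzc]
    simp [c]
  · change tensMap (𝟙 L) α (y - z) = x.1
    rw [map_sub, hz0, sub_zero, hyx]

theorem tens_subsingleton (hA : Subsingleton A) : Subsingleton (L ⊗[K] A) :=
  subsingleton_of_forall_eq 0 fun z => by
    induction z using TensorProduct.induction_on with
    | zero => rfl
    | add z w hz hw => rw [hz, hw, add_zero]
    | tmul x a => rw [Subsingleton.elim a 0, TensorProduct.tmul_zero]

theorem MC_zero (hA : Subsingleton A) : Nonempty (Unique ((MC L).obj A)) := by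
  have := tens_subsingleton L hA
  have : Subsingleton (MCSet L A) := inferInstance
  exact ⟨{ default := ⟨0, zero_mem _, by simp⟩, uniq := fun x => this.elim x _ }⟩

theorem MC_isPredeformation [CharZero K] : IsPredeformation (MC L) where
  zero _ hA := MC_zero L hA
  surj _ _ _ _ h _ a b hab := (MC_fibre L h a b hab).exists
  bij _ _ _ _ h _ _ a b hab := MC_fibre L h a b hab
  quasismooth _ h := MC_quasismooth L h

end MaurerCartan
-- Lifting gauge equivalences, and the axioms for `Def_L`.
-- For symmetric `r`, related elements have the same set of elements reachable by chains, so this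
-- set descends to the quotient.
theorem reflTransGen_of_quot_eq {X : Type*} {r : X → X → Prop} (hr : ∀ x y, r x y → r y x)
    {x y : X} (h : Quot.mk r x = Quot.mk r y) : Relation.ReflTransGen r x y := by
  have hs : Relation.ReflTransGen r x = Relation.ReflTransGen r y :=
    congrArg (Quot.lift (Relation.ReflTransGen r) fun a b hab => funext fun c => propext
      ⟨fun hc => Relation.ReflTransGen.head (hr _ _ hab) hc,
        fun hc => Relation.ReflTransGen.head hab hc⟩) h
  rw [hs]

section Def

variable (L : DGLA K) {A B C P : ArtDGA K}

theorem Def_zero (hA : Subsingleton A) : Nonempty (Unique ((Def L).obj A)) := by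
  obtain ⟨i⟩ := MC_zero L hA
  exact ⟨{ default := Quot.mk _ i.default
           uniq := fun x => by
            induction x using Quot.ind with
            | mk x => exact congrArg (Quot.mk _) (i.uniq x) }⟩

/-- The zero morphism. -/
def zeroHom (A B : ArtDGA K) : A ⟶ B :=
  ArtDGA.Hom.mk 0 (by simp) (fun _ _ _ => zero_mem _) (by simp)

theorem lin_zeroHom (A B : ArtDGA K) : ArtDGA.lin (zeroHom A B) = 0 := rfl

variable [CharZero K]

/-- Gauge equivalences lift along `f`, with constant image under `g`, as soon as elements of
degree `0` lift to elements in the kernel of `g`. -/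
theorem exists_lift_gauge (f : A ⟶ C) (g : A ⟶ B)
    (hfg : ∀ u ∈ tensGr L C 0, ∃ v ∈ tensGr L A 0, tensMap (𝟙 L) f v = u ∧ tensMap (𝟙 L) g v = 0)
    (a : MCSet L A) (c : MCSet L C)
    (h : Quot.mk (GaugeRel L C) (mcMap (𝟙 L) f a) = Quot.mk (GaugeRel L C) c) :
    ∃ a' : MCSet L A, Quot.mk (GaugeRel L A) a = Quot.mk (GaugeRel L A) a' ∧
      mcMap (𝟙 L) f a' = c ∧ mcMap (𝟙 L) g a' = mcMap (𝟙 L) g a := by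
  -- Equality of classes is a finite chain of gauge transformations `e^u`, each lifted to some `e^v`
  -- in turn.
  have hr := reflTransGen_of_quot_eq (fun _ _ h => GaugeRel.symm h) h
  clear h
  induction hr with
  | refl => exact ⟨a, rfl, rfl, rfl⟩
  | tail _ hcd ih =>
    obtain ⟨a', h1, h2, h3⟩ := ih
    obtain ⟨u, hu, e⟩ := hcd
    obtain ⟨v, hv, hvu, hv0⟩ := hfg u hu
    refine ⟨⟨gauge L A v a'.1, gauge_mem_MCSet hv a'.2⟩, h1.trans (Quot.sound ⟨v, hv, rfl⟩),
      Subtype.ext ?_, Subtype.ext ?_⟩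
    · rw [e, ← h2]
      change tensMap (𝟙 L) f (gauge L A v a'.1) = _
      rw [tensMap_gauge, hvu]; rfl
    · rw [← h3]
      change tensMap (𝟙 L) g (gauge L A v a'.1) = tensMap (𝟙 L) g a'.1
      -- The lift `v` dies under `g`, so `e^v` induces the identity there.
      rw [tensMap_gauge, hv0, gauge_of_br_eq_zero (by simp), map_zero, sub_zero]

theorem exists_lift_gauge_of_surjective {f : A ⟶ C} (hf : Function.Surjective (ArtDGA.lin f))
    (a : MCSet L A) (c : MCSet L C)
    (h : Quot.mk (GaugeRel L C) (mcMap (𝟙 L) f a) = Quot.mk (GaugeRel L C) c) :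
    ∃ a' : MCSet L A, Quot.mk (GaugeRel L A) a = Quot.mk (GaugeRel L A) a' ∧
      mcMap (𝟙 L) f a' = c := by
  -- Taking the zero morphism for `g` makes the condition on it void.
  obtain ⟨a', h1, h2, -⟩ := exists_lift_gauge L f (zeroHom A A) (fun u hu => by
    obtain ⟨v, hv, e⟩ := exists_lift_tensMap L f hf hu
    exact ⟨v, hv, e, by simp [tensMap, lin_zeroHom]⟩) a c h
  exact ⟨a', h1, h2⟩

/-- Representatives of `a` and `b` have gauge equivalent images in `C`; as `α` is surjective, the
first can be moved in its class until the images agree, and `MC_fibre` glues. -/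
theorem Def_surj {p : P ⟶ A} {q : P ⟶ B} {α : A ⟶ C} {β : B ⟶ C} (h : IsFibreProduct p q α β)
    (hα : Function.Surjective (ArtDGA.lin α)) (a : (Def L).obj A) (b : (Def L).obj B)
    (hab : (Def L).map α a = (Def L).map β b) :
    ∃ x : (Def L).obj P, (Def L).map p x = a ∧ (Def L).map q x = b := by
  induction a using Quot.ind with | mk a =>
  induction b using Quot.ind with | mk b =>
  obtain ⟨a', h1, h2⟩ := exists_lift_gauge_of_surjective L hα a _ hab
  obtain ⟨x, hx1, hx2⟩ := (MC_fibre L h a' b h2).exists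
  refine ⟨Quot.mk _ x, ?_, ?_⟩
  · rw [h1, ← hx1]; rfl
  · rw [← hx2]; rfl

/-- After a gauge transformation two elements with the same image class differ by some `z` in `L ⊗
I`. Brackets with `z` vanish, so `z` is closed, hence `z = d u` with `u` in `L ⊗ I`, and for such
`u` the action is the translation `x ↦ x - d u`. -/
theorem Def_bijective {α : A ⟶ B} (h : IsAcyclicSmall α) :
    Function.Bijective ((Def L).map α : (Def L).obj A → (Def L).obj B) := by
  constructor
  · intro x y hxy
    induction x using Quot.ind with | mk x =>
    induction y using Quot.ind with | mk y =>
    obtain ⟨x', h1, h2⟩ := exists_lift_gauge_of_surjective L h.1 x _ hxy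
    rw [h1]
    have hz : tensMap (𝟙 L) α (x'.1 - y.1) = 0 := by
      rw [map_sub, sub_eq_zero]; exact congrArg Subtype.val h2
    have hz1 : x'.1 - y.1 ∈ tensGr L A (0 + 1) := sub_mem x'.2.1 y.2.1
    have hbr : tensBr L A x'.1 x'.1 = tensBr L A y.1 y.1 := by
      have e1 := h.br_right x'.1 hz
      have e2 := h.br_left y.1 hz1 hz
      rw [map_sub, sub_eq_zero] at e1
      rw [map_sub, LinearMap.sub_apply, sub_eq_zero] at e2
      rw [e1, e2]
    have hd : tensD L A (x'.1 - y.1) = 0 := by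
      have e1 := x'.2.2
      rw [hbr, ← y.2.2, add_left_inj] at e1
      rw [map_sub, e1, sub_self]
    obtain ⟨u, hu, hu0, hud⟩ := h.exact hz1 hz hd
    refine Quot.sound ⟨u, hu, ?_⟩
    rw [gauge_of_br_eq_zero (fun w => h.br_left w hu hu0), hud, sub_sub_cancel]
  · intro y
    induction y using Quot.ind with | mk y =>
    obtain ⟨x, hx⟩ := MC_quasismooth L h y
    exact ⟨Quot.mk _ x, congrArg (Quot.mk _) hx⟩

/-- Over zero morphisms the fibre product is the product `A × B`, where the two components can be
gauged independently by `(u, 0)` and `(0, u)`. -/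
theorem Def_prod_injective {p : P ⟶ A} {q : P ⟶ B}
    (h : IsFibreProduct p q (zeroHom A C) (zeroHom B C)) {x y : (Def L).obj P}
    (hp : (Def L).map p x = (Def L).map p y) (hq : (Def L).map q x = (Def L).map q y) : x = y := by
  have h0 : ∀ (a : L ⊗[K] A) (b : L ⊗[K] B),
      tensMap (𝟙 L) (zeroHom A C) a = tensMap (𝟙 L) (zeroHom B C) b := by
    simp [tensMap, lin_zeroHom]
  induction x using Quot.ind with | mk x =>
  induction y using Quot.ind with | mk y =>
  obtain ⟨x', h1, h2, h3⟩ := exists_lift_gauge L p q (fun u hu =>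
    tens_fibre_exists L h hu (zero_mem _) (h0 _ _)) x _ hp
  have hq' : Quot.mk _ (mcMap (𝟙 L) q x') = Quot.mk (GaugeRel L B) (mcMap (𝟙 L) q y) := by
    rw [h3]; exact hq
  obtain ⟨x'', h4, h5, h6⟩ := exists_lift_gauge L q p (fun u hu => by
    obtain ⟨v, hv, e1, e2⟩ := tens_fibre_exists L h (zero_mem _) hu (h0 _ _)
    exact ⟨v, hv, e2, e1⟩) x' _ hq'
  rw [h1, h4]
  refine congrArg (Quot.mk _) (Subtype.ext (tens_fibre_ext L h ?_ ?_))
  · exact congrArg Subtype.val (h6.trans h2)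
  · exact congrArg Subtype.val h5

end Def

/-! ### Constants and linear polynomials in `A[t, dt]_ε`; gauge equivalence implies homotopy. -/

namespace ArtDGA

variable (A : ArtDGA K) {ε : ℝ}

/-- The inclusion of constants `A ⟶ A[t, dt]_ε`. -/
noncomputable def const (hε : 0 < ε) : A ⟶ A.path ε hε :=
  Hom.mk (A := A) (B := A.path ε hε)
    { toFun := fun a => (⟨(Pi.single 0 a, 0), fun n => by
          rcases n with _ | n
          · simp only [Nat.cast_zero, zero_mul, Nat.ceil_zero]; trivial
          · simp, fun n => zero_mem _⟩ : A.Path ε)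
      map_add' := fun a b => path_ext (Pi.single_add _ _ _) (add_zero _).symm
      map_smul' := fun c a => path_ext (Pi.single_smul _ _ _) (smul_zero _).symm }
    (fun a b => by
      refine path_ext (x := (_ : A.Path ε)) ?_ ?_
      · change Pi.single 0 (a * b) = conv (Pi.single 0 a) (Pi.single 0 b)
        funext n
        rcases n with _ | n
        · simp [conv]
        · rw [Pi.single_eq_of_ne (by omega)]
          refine (Finset.sum_eq_zero fun ij hij => ?_).symm
          have := Finset.HasAntidiagonal.mem_antidiagonal.1 hij
          by_cases h : ij.1 = 0
          · rw [Pi.single_eq_of_ne (i := 0) (i' := ij.2) (by omega), mul_zero]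
          · rw [Pi.single_eq_of_ne h, zero_mul]
      · change (0 : ℕ → A) = conv _ 0 + conv 0 _
        rw [conv_zero, zero_conv, add_zero])
    (fun i a ha => ⟨fun n => by
        change (Pi.single 0 a : ℕ → A) n ∈ _
        rcases n with _ | n
        · simpa using ha
        · simp, fun n => zero_mem _⟩)
    (fun a => by
      refine path_ext (x := (_ : A.Path ε)) ?_ ?_
      · funext n
        change (Pi.single 0 (A.d a) : ℕ → A) n = A.d ((Pi.single 0 a : ℕ → A) n)
        rcases n with _ | n
        · simp
        · simp
      · funext n
        change (0 : A) = parity A.internal ((n + 1) • (Pi.single 0 a : ℕ → A) (n + 1)) + A.d 0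
        simp)

theorem const_evalZero (hε : 0 < ε) : A.const hε ≫ A.evalZero hε = 𝟙 A :=
  hom_ext fun a => Pi.single_eq_same (M := fun _ : ℕ => A) 0 a

/-- `bound` comes from an arbitrary choice; this permits computing `e₁` with any bound for the
degree of `x`. -/
theorem evalOneLin_eq (hε : 0 < ε) (x : A.Path ε) {N : ℕ} (hN : ∀ n, N ≤ n → x.1.1 n = 0) :
    A.evalOneLin hε x = ∑ n ∈ Finset.range N, x.1.1 n := by
  have hA := ((A.exists_bound ε hε).choose_spec x).1
  rw [evalOneLin_apply]
  rcases le_total N (A.bound hε) with h | h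
  · refine (Finset.sum_subset (Finset.range_mono h) fun n _ hn => hN n (by simpa using hn)).symm
  · exact Finset.sum_subset (Finset.range_mono h) fun n _ hn => hA n (by simpa [bound] using hn)

theorem const_evalOne (hε : 0 < ε) : A.const hε ≫ A.evalOne hε = 𝟙 A := by
  refine hom_ext fun a => ?_
  change A.evalOneLin hε (lin (A.const hε) a) = a
  refine (A.evalOneLin_eq hε (N := 1) _ fun n hn => Pi.single_eq_of_ne (by omega) _).trans ?_
  rw [Finset.sum_range_one]
  exact Pi.single_eq_same (M := fun _ : ℕ => A) 0 a

/-- The map `a ↦ a t` from `A` to `A[t, dt]_1`. -/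
noncomputable def mulT : A →ₗ[K] A.path 1 one_pos :=
  LinearMap.mk (AddHom.mk (fun a => (⟨(Pi.single 1 a, 0), fun n => by
          by_cases h : n = 1
          -- For `ε = 1` the coefficient of `t` is only required to lie in `A ^ 1 = A`.
          · subst h
            simp only [Nat.cast_one, mul_one, Nat.ceil_one]; trivial
          · change (Pi.single 1 a : ℕ → A) n ∈ _
            rw [Pi.single_eq_of_ne h]; exact zero_mem _, fun n => zero_mem _⟩ : A.Path 1))
      fun a b => path_ext (Pi.single_add _ _ _) (add_zero _).symm)
    fun c a => path_ext (Pi.single_smul _ _ _) (smul_zero _).symm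

theorem mulT_mem (i : ℤ) (a : A) (ha : a ∈ A.gr i) : A.mulT a ∈ (A.path 1 one_pos).gr i :=
  ⟨fun n => by
    change (Pi.single 1 a : ℕ → A) n ∈ _
    by_cases h : n = 1
    · subst h; simpa using ha
    · rw [Pi.single_eq_of_ne h]; exact zero_mem _, fun n => zero_mem _⟩

theorem mulT_evalZero : (lin (A.evalZero one_pos)).comp A.mulT = 0 :=
  LinearMap.ext fun a => Pi.single_eq_of_ne (M := fun _ : ℕ => A) (i := 1) (i' := 0) (by omega) a

theorem mulT_evalOne : (lin (A.evalOne one_pos)).comp A.mulT = LinearMap.id := by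
  refine LinearMap.ext fun a => ?_
  change A.evalOneLin one_pos (A.mulT a) = a
  refine (A.evalOneLin_eq one_pos (N := 2) _ fun n hn => Pi.single_eq_of_ne (by omega) _).trans ?_
  rw [Finset.sum_range_succ, Finset.sum_range_one]
  change (Pi.single 1 a : ℕ → A) 0 + (Pi.single 1 a : ℕ → A) 1 = a
  simp

end ArtDGA

/-- The homotopy is `e^{tu} x` with `x` constant. It is a Maurer-Cartan element over `A[t, dt]_1`,
and since the gauge action commutes with evaluations it runs from `x` to `e^u x`. -/
theorem GaugeRel.homotopic [CharZero K] {L : DGLA K} {A : ArtDGA K} {x y : MCSet L A}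
    (h : GaugeRel L A x y) : Homotopic (MC L) A x y := by
  obtain ⟨u, hu, h⟩ := h
  let U := A.mulT.lTensor L u
  have hU : U ∈ tensGr L (A.path 1 one_pos) 0 := map_mem_tensGr L _ A.mulT_mem hu
  let X := mcMap (𝟙 L) (A.const one_pos) x
  have hX : ∀ f : A.path 1 one_pos ⟶ A, A.const one_pos ≫ f = 𝟙 A → tensMap (𝟙 L) f X.1 = x.1 := by
    intro f hf
    have h1 := mcMap_comp (𝟙 L) (𝟙 L) (A.const one_pos) f x
    rw [hf, Category.comp_id, mcMap_id] at h1
    exact (congrArg Subtype.val h1).symm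
  have hU' : ∀ f : A.path 1 one_pos ⟶ A,
      tensMap (𝟙 L) f U = ((ArtDGA.lin f).comp A.mulT).lTensor L u := by
    intro f
    rw [LinearMap.lTensor_comp]; rfl
  refine ⟨1, one_pos, ⟨gauge L _ U X.1, gauge_mem_MCSet hU X.2⟩, Subtype.ext ?_, Subtype.ext ?_⟩
  · change tensMap (𝟙 L) (A.evalZero one_pos) (gauge L _ U X.1) = x.1
    rw [tensMap_gauge, hX _ (A.const_evalZero _), hU', A.mulT_evalZero, LinearMap.lTensor_zero,
      LinearMap.zero_apply, gauge_of_br_eq_zero (by simp), map_zero, sub_zero]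
  · change tensMap (𝟙 L) (A.evalOne one_pos) (gauge L _ U X.1) = y.1
    rw [tensMap_gauge, hX _ (A.const_evalOne _), hU', A.mulT_evalOne, LinearMap.lTensor_id, h]
    rfl

/-! ### Ideals, quotients and compositions of acyclic small extensions. -/

section Powers

variable {X Y : Type u} [NonUnitalRing X] [Module K X] [NonUnitalRing Y] [Module K Y]

theorem map_algPow (φ : X →ₗ[K] Y) (hφ : ∀ x y, φ (x * y) = φ x * φ y) :
    ∀ k, ∀ x ∈ algPow K X k, φ x ∈ algPow K Y k := by
  intro k
  induction k with
  | zero => exact fun _ _ => trivial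
  | succ k ih =>
    rcases k with _ | k
    · exact fun _ _ => trivial
    · intro x hx
      have h : algPow K X (k + 2) ≤ (algPow K Y (k + 2)).comap φ := by
        refine Submodule.span_le.2 ?_
        rintro _ ⟨a, b, hb, rfl⟩
        exact Submodule.subset_span ⟨φ a, φ b, ih b hb, hφ a b⟩
      exact h hx

theorem algPow_le_map (φ : X →ₗ[K] Y) (hφ : ∀ x y, φ (x * y) = φ x * φ y)
    (hs : Function.Surjective φ) : ∀ k, algPow K Y k ≤ (algPow K X k).map φ := by
  have top : ∀ y : Y, y ∈ (⊤ : Submodule K X).map φ := fun y =>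
    let ⟨x, hx⟩ := hs y
    ⟨x, trivial, hx⟩
  intro k
  induction k with
  | zero => exact fun y _ => top y
  | succ k ih =>
    rcases k with _ | k
    · exact fun y _ => top y
    · refine Submodule.span_le.2 ?_
      rintro _ ⟨a, b, hb, rfl⟩
      obtain ⟨b, hb', rfl⟩ := ih hb
      obtain ⟨a, rfl⟩ := hs a
      exact ⟨a * b, Submodule.subset_span ⟨a, b, hb', rfl⟩, hφ a b⟩

end Powers

/-- Differential graded ideals. -/
structure DGIdeal (A : ArtDGA K) where
  sub : Submodule K A
  mul_mem : ∀ a, ∀ x ∈ sub, a * x ∈ sub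
  proj_mem : ∀ n, ∀ x ∈ sub, proj A.internal n x ∈ sub
  d_mem : ∀ x ∈ sub, A.d x ∈ sub

namespace DGIdeal

variable {A B : ArtDGA K}

/-- Graded commutativity turns left multiples into right ones, but only for homogeneous elements;
this is where stability under `proj` enters. -/
theorem mul_mem_right (I : DGIdeal A) (x : A) (hx : x ∈ I.sub) (a : A) : x * a ∈ I.sub := by
  obtain ⟨s, hs⟩ := exists_finset_proj A.internal
  refine graded_induction A.internal (P := fun a => x * a ∈ I.sub) a ?_
    (fun a b ha hb => by rw [mul_add]; exact add_mem ha hb)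
  intro j a ha
  rw [← hs s subset_rfl x, Finset.sum_mul]
  refine Submodule.sum_mem _ fun i _ => ?_
  rw [A.graded_comm i j _ a (DefFun.proj_mem _ _ _) ha]
  exact Submodule.smul_mem _ _ (I.mul_mem _ _ (I.proj_mem _ _ hx))

/-- The preimage of an ideal. -/
def comap (f : A ⟶ B) (I : DGIdeal B) : DGIdeal A where
  sub := I.sub.comap (ArtDGA.lin f)
  mul_mem a x hx := by
    rw [Submodule.mem_comap, ArtDGA.map_mul]; exact I.mul_mem _ _ hx
  proj_mem n x hx := by
    rw [Submodule.mem_comap, proj_natural A.internal B.internal (ArtDGA.lin f)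
      (fun _ _ h => ArtDGA.map_gr f h)]
    exact I.proj_mem _ _ hx
  d_mem x hx := by
    rw [Submodule.mem_comap, ArtDGA.map_d]; exact I.d_mem _ hx

/-- The kernel of a morphism. -/
def ker (f : A ⟶ B) : DGIdeal A :=
  comap f ⟨⊥, fun a x hx => by simp_all, fun n x hx => by simp_all, fun x hx => by simp_all⟩

theorem mem_ker {f : A ⟶ B} {x : A} : x ∈ (ker f).sub ↔ ArtDGA.lin f x = 0 := Iff.rfl

/-- The intersection of two ideals. -/
def inter (I J : DGIdeal A) : DGIdeal A where
  sub := I.sub ⊓ J.sub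
  mul_mem a x hx := ⟨I.mul_mem a x hx.1, J.mul_mem a x hx.2⟩
  proj_mem n x hx := ⟨I.proj_mem n x hx.1, J.proj_mem n x hx.2⟩
  d_mem x hx := ⟨I.d_mem x hx.1, J.d_mem x hx.2⟩

section Quotient

variable (I : DGIdeal A)

/-- The underlying vector space of the quotient by an ideal. -/
abbrev Q : Type u := A.carrier ⧸ I.sub

/-- The quotient map. -/
abbrev toQ (a : A) : I.Q := Submodule.Quotient.mk a

theorem toQ_surjective : Function.Surjective I.toQ := Submodule.Quotient.mk_surjective _

instance : Mul I.Q where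
  mul := Quotient.map₂ (sa := I.sub.quotientRel) (sb := I.sub.quotientRel)
    (sc := I.sub.quotientRel) (fun a b => a * b) (by
      intro a a' ha b b' hb
      replace ha := (Submodule.quotientRel_def _).1 ha
      replace hb := (Submodule.quotientRel_def _).1 hb
      refine (Submodule.quotientRel_def _).2 ?_
      have e : a * b - a' * b' = a * (b - b') + (a - a') * b' := by
        rw [mul_sub, sub_mul]; abel
      rw [e]
      exact add_mem (I.mul_mem _ _ hb) (I.mul_mem_right _ ha _))

theorem toQ_mul (a b : A) : I.toQ (a * b) = I.toQ a * I.toQ b := rfl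

instance : NonUnitalRing I.Q :=
  { (inferInstance : AddCommGroup I.Q), (inferInstance : Mul I.Q) with
    left_distrib := fun x y z => by
      obtain ⟨x, rfl⟩ := I.toQ_surjective x
      obtain ⟨y, rfl⟩ := I.toQ_surjective y
      obtain ⟨z, rfl⟩ := I.toQ_surjective z
      exact congrArg I.toQ (mul_add x y z)
    right_distrib := fun x y z => by
      obtain ⟨x, rfl⟩ := I.toQ_surjective x
      obtain ⟨y, rfl⟩ := I.toQ_surjective y
      obtain ⟨z, rfl⟩ := I.toQ_surjective z
      exact congrArg I.toQ (add_mul x y z)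
    zero_mul := fun x => by
      obtain ⟨x, rfl⟩ := I.toQ_surjective x
      exact congrArg I.toQ (zero_mul x)
    mul_zero := fun x => by
      obtain ⟨x, rfl⟩ := I.toQ_surjective x
      exact congrArg I.toQ (mul_zero x)
    mul_assoc := fun x y z => by
      obtain ⟨x, rfl⟩ := I.toQ_surjective x
      obtain ⟨y, rfl⟩ := I.toQ_surjective y
      obtain ⟨z, rfl⟩ := I.toQ_surjective z
      exact congrArg I.toQ (mul_assoc x y z) }

/-- The quotient of a differential graded algebra by an ideal. -/
def quotient : ArtDGA K where
  carrier := I.Q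
  tower := ⟨fun c x y => by
    obtain ⟨x, rfl⟩ := I.toQ_surjective x
    obtain ⟨y, rfl⟩ := I.toQ_surjective y
    exact congrArg I.toQ (smul_mul_assoc c x y)⟩
  smulComm := ⟨fun c x y => by
    obtain ⟨x, rfl⟩ := I.toQ_surjective x
    obtain ⟨y, rfl⟩ := I.toQ_surjective y
    exact congrArg I.toQ (mul_smul_comm c x y).symm⟩
  gr i := (A.gr i).map I.sub.mkQ
  internal := by
    obtain ⟨s, hs⟩ := exists_finset_proj A.internal
    refine isInternal_of_proj
      (fun i => I.sub.mapQ I.sub (proj A.internal i) (fun x hx => I.proj_mem i x hx)) s ?_ ?_ ?_ ?_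
    · intro i v
      obtain ⟨v, rfl⟩ := I.toQ_surjective v
      exact ⟨_, DefFun.proj_mem A.internal i v, rfl⟩
    · rintro i _ ⟨v, hv, rfl⟩
      exact congrArg I.toQ (proj_same A.internal hv)
    · rintro i j hij _ ⟨v, hv, rfl⟩
      exact congrArg I.toQ (proj_ne A.internal hij hv)
    · intro v
      obtain ⟨v, rfl⟩ := I.toQ_surjective v
      conv_rhs => rw [← hs s subset_rfl v]
      exact (map_sum I.sub.mkQ _ _).symm
  mul_mem := by
    rintro i j _ _ ⟨a, ha, rfl⟩ ⟨b, hb, rfl⟩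
    exact ⟨a * b, A.mul_mem i j a b ha hb, rfl⟩
  graded_comm := by
    rintro i j _ _ ⟨a, ha, rfl⟩ ⟨b, hb, rfl⟩
    exact congrArg I.toQ (A.graded_comm i j a b ha hb)
  d := I.sub.mapQ I.sub A.d (fun x hx => I.d_mem x hx)
  d_mem := by
    rintro i _ ⟨a, ha, rfl⟩
    exact ⟨A.d a, A.d_mem i a ha, rfl⟩
  d_d x := by
    obtain ⟨x, rfl⟩ := I.toQ_surjective x
    exact congrArg I.toQ (A.d_d x)
  leibniz := by
    rintro i _ y ⟨a, ha, rfl⟩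
    obtain ⟨y, rfl⟩ := I.toQ_surjective y
    exact congrArg I.toQ (A.leibniz i a y ha)
  finite := inferInstance
  nilpotent := by
    obtain ⟨n, hn⟩ := A.nilpotent
    refine ⟨n, eq_bot_iff.2 ((algPow_le_map I.sub.mkQ I.toQ_mul I.toQ_surjective n).trans ?_)⟩
    rw [hn, Submodule.map_bot]

/-- The projection to the quotient. -/
def quotientMap : A ⟶ I.quotient :=
  ArtDGA.Hom.mk (A := A) (B := I.quotient) I.sub.mkQ I.toQ_mul (fun _ a ha => ⟨a, ha, rfl⟩)
    (fun _ => rfl)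

theorem quotientMap_surjective : Function.Surjective (ArtDGA.lin I.quotientMap) := I.toQ_surjective

theorem quotientMap_eq_zero {x : A} : ArtDGA.lin I.quotientMap x = 0 ↔ x ∈ I.sub :=
  Submodule.Quotient.mk_eq_zero _

/-- The morphism out of the quotient induced by a morphism vanishing on the ideal. -/
def quotientLift (f : A ⟶ B) (h : ∀ x ∈ I.sub, ArtDGA.lin f x = 0) : I.quotient ⟶ B :=
  ArtDGA.Hom.mk (A := I.quotient) (B := B) (I.sub.liftQ (ArtDGA.lin f) h)
    (fun x y => by
      obtain ⟨x, rfl⟩ := I.toQ_surjective x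
      obtain ⟨y, rfl⟩ := I.toQ_surjective y
      exact ArtDGA.map_mul f x y)
    (by rintro i _ ⟨a, ha, rfl⟩; exact ArtDGA.map_gr f ha)
    (fun x => by
      obtain ⟨x, rfl⟩ := I.toQ_surjective x
      exact ArtDGA.map_d f x)

theorem quotientMap_lift (f : A ⟶ B) (h : ∀ x ∈ I.sub, ArtDGA.lin f x = 0) :
    I.quotientMap ≫ I.quotientLift f h = f := ArtDGA.hom_ext fun _ => rfl

end Quotient

end DGIdeal

/-- `f` is surjective and its kernel has a filtration of length `n` by acyclic ideals with
`A Iₖ ⊆ Iₖ₊₁`. -/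
structure IsFilteredAcyclic {A B : ArtDGA K} (f : A ⟶ B) (n : ℕ) (I : ℕ → DGIdeal A) : Prop where
  surjective : Function.Surjective (ArtDGA.lin f)
  mem_zero : ∀ x, x ∈ (I 0).sub ↔ ArtDGA.lin f x = 0
  eq_zero : ∀ x ∈ (I n).sub, x = 0
  le : ∀ k, (I (k + 1)).sub ≤ (I k).sub
  mul_mem : ∀ k a, ∀ x ∈ (I k).sub, a * x ∈ (I (k + 1)).sub
  acyclic : ∀ k, ∀ x ∈ (I k).sub, A.d x = 0 → ∃ y ∈ (I k).sub, A.d y = x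

/-- Such an `f` is a composition of acyclic small extensions. -/
theorem IsFilteredAcyclic.bijective (F : ArtDGA K ⥤ Type u)
    (hF : ∀ {A B : ArtDGA K} (α : A ⟶ B), IsAcyclicSmall α →
      Function.Bijective (F.map α : F.obj A → F.obj B)) (n : ℕ) :
    ∀ {A B : ArtDGA K} (f : A ⟶ B) (I : ℕ → DGIdeal A), IsFilteredAcyclic f n I →
      Function.Bijective (F.map f : F.obj A → F.obj B) := by
  induction n with
  | zero =>
    intro A B f I h
    -- For `n = 0` the kernel is zero, so `f` is itself an acyclic small extension.
    have h0 : ∀ x, ArtDGA.lin f x = 0 → x = 0 := fun x hx => h.eq_zero x ((h.mem_zero x).2 hx)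
    refine hF f ⟨h.surjective, fun a x hx => by rw [h0 x hx, mul_zero], fun x hx _ => ⟨0, ?_⟩⟩
    rw [h0 x hx]; simp
  | succ n ih =>
    intro A B f I h
    have hf1 : ∀ x ∈ (I 1).sub, ArtDGA.lin f x = 0 := fun x hx => (h.mem_zero x).1 (h.le 0 hx)
    let g := (I 1).quotientLift f hf1
    -- Factor `f` through `A / I₁`. The quotient map has the shorter filtration `I₁ ⊇ I₂ ⊇ …`, and
    -- `g` has kernel `I₀ / I₁`, killed by multiplication since `A I₀ ⊆ I₁`.
    have hfg : (I 1).quotientMap ≫ g = f := (I 1).quotientMap_lift f hf1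
    have h1 := ih (I 1).quotientMap (fun k => I (k + 1))
      { surjective := (I 1).quotientMap_surjective
        mem_zero := fun x => (I 1).quotientMap_eq_zero.symm
        eq_zero := h.eq_zero
        le := fun k => h.le (k + 1)
        mul_mem := fun k => h.mul_mem (k + 1)
        acyclic := fun k => h.acyclic (k + 1) }
    have hg : ∀ x, ArtDGA.lin g (ArtDGA.lin (I 1).quotientMap x) = ArtDGA.lin f x := fun x => rfl
    have h2 : IsAcyclicSmall g := by
      refine ⟨fun b => ?_, fun a x hx => ?_, fun x hx hd => ?_⟩
      · obtain ⟨a, rfl⟩ := h.surjective b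
        exact ⟨_, hg a⟩
      · obtain ⟨a, rfl⟩ := (I 1).quotientMap_surjective a
        obtain ⟨x, rfl⟩ := (I 1).quotientMap_surjective x
        rw [← ArtDGA.map_mul]
        exact (I 1).quotientMap_eq_zero.2 (h.mul_mem 0 a x ((h.mem_zero x).2 hx))
      · obtain ⟨x, rfl⟩ := (I 1).quotientMap_surjective x
        rw [← ArtDGA.map_d] at hd
        -- A cycle modulo `I₁` is corrected to a true cycle: `d x` is a cycle of `I₁`, so it equals
        -- `d y` with `y` in `I₁`, and `x - y` is a cycle of `I₀`.
        obtain ⟨y, hy, hyx⟩ := h.acyclic 1 _ ((I 1).quotientMap_eq_zero.1 hd) (A.d_d x)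
        obtain ⟨z, hz, hzx⟩ := h.acyclic 0 (x - y) (sub_mem ((h.mem_zero x).2 hx) (h.le 0 hy))
          (by rw [map_sub, hyx, sub_self])
        refine ⟨ArtDGA.lin (I 1).quotientMap z, (h.mem_zero z).1 hz, ?_⟩
        rw [← ArtDGA.map_d, hzx, map_sub, (I 1).quotientMap_eq_zero.2 hy, sub_zero]
    have h3 : (F.map f : F.obj A → F.obj B) = F.map g ∘ F.map (I 1).quotientMap := by
      funext x
      rw [← hfg, CategoryTheory.Functor.map_comp_apply]; rfl
    rw [h3]
    exact (hF g h2).comp h1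

/-! ### Fibre products in the category. -/

theorem IsFibreProduct.snd_surjective {P A B C : ArtDGA K} {p : P ⟶ A} {q : P ⟶ B} {α : A ⟶ C}
    {β : B ⟶ C} (h : IsFibreProduct p q α β) (hα : Function.Surjective (ArtDGA.lin α)) :
    Function.Surjective (ArtDGA.lin q) := fun b =>
  let ⟨a, ha⟩ := hα (ArtDGA.lin β b)
  let ⟨x, hx⟩ := (h.2 a b ha).exists
  ⟨x, hx.2⟩

namespace ArtDGA

section FibreProduct

variable {A B C : ArtDGA K} (α : A ⟶ C) (β : B ⟶ C)

/-- The underlying algebra of the fibre product. -/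
def fibreSub : NonUnitalSubalgebra K (A × B) where
  carrier := {x | lin α x.1 = lin β x.2}
  add_mem' {x y} hx hy := by
    have hx : lin α x.1 = lin β x.2 := hx
    have hy : lin α y.1 = lin β y.2 := hy
    simp [hx, hy]
  zero_mem' := by simp
  mul_mem' {x y} hx hy := by
    have hx : lin α x.1 = lin β x.2 := hx
    have hy : lin α y.1 = lin β y.2 := hy
    simp [map_mul, hx, hy]
  smul_mem' c x hx := by
    have hx : lin α x.1 = lin β x.2 := hx
    simp [hx]

theorem fibreSub_proj_mem (n : ℤ) (x : fibreSub α β) :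
    (proj A.internal n x.1.1, proj B.internal n x.1.2) ∈ fibreSub α β := by
  change lin α _ = lin β _
  rw [proj_natural A.internal C.internal (lin α) (fun _ _ h => map_gr α h),
    proj_natural B.internal C.internal (lin β) (fun _ _ h => map_gr β h)]
  exact congrArg _ x.2

theorem fibreSub_d_mem (x : fibreSub α β) : (A.d x.1.1, B.d x.1.2) ∈ fibreSub α β := by
  change lin α _ = lin β _
  rw [map_d, map_d]
  exact congrArg _ x.2

theorem fibreSub_ext {x y : fibreSub α β} (h1 : x.1.1 = y.1.1) (h2 : x.1.2 = y.1.2) : x = y :=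
  Subtype.ext (Prod.ext h1 h2)

/-- The fibre product of differential graded algebras. -/
noncomputable def fibre : ArtDGA K where
  carrier := fibreSub α β
  gr i := ((A.gr i).prod (B.gr i)).comap (fibreSub α β).toSubmodule.subtype
  internal := by
    obtain ⟨s, hs⟩ := exists_finset_proj A.internal
    obtain ⟨t, ht⟩ := exists_finset_proj B.internal
    refine isInternal_of_proj (V := fibreSub α β) (fun n =>
      { toFun := fun x => ⟨_, fibreSub_proj_mem α β n x⟩
        map_add' := fun x y => fibreSub_ext α β (map_add _ _ _) (map_add _ _ _)
        map_smul' := fun c x => fibreSub_ext α β (map_smul _ _ _) (map_smul _ _ _) }) (s ∪ t)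
      ?_ ?_ ?_ ?_
    · exact fun i x => ⟨proj_mem _ _ _, proj_mem _ _ _⟩
    · exact fun i x hx => fibreSub_ext α β (proj_same _ hx.1) (proj_same _ hx.2)
    · exact fun i j hij x hx => fibreSub_ext α β (proj_ne _ hij hx.1) (proj_ne _ hij hx.2)
    · intro x
      refine fibreSub_ext α β ?_ ?_
      · exact (_root_.map_sum ((LinearMap.fst K A B).comp (fibreSub α β).toSubmodule.subtype)
          _ _).trans (hs _ Finset.subset_union_left _)
      · exact (_root_.map_sum ((LinearMap.snd K A B).comp (fibreSub α β).toSubmodule.subtype)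
          _ _).trans (ht _ Finset.subset_union_right _)
  mul_mem i j x y hx hy := ⟨A.mul_mem i j _ _ hx.1 hy.1, B.mul_mem i j _ _ hx.2 hy.2⟩
  graded_comm i j x y hx hy := fibreSub_ext α β (A.graded_comm i j _ _ hx.1 hy.1)
    (B.graded_comm i j _ _ hx.2 hy.2)
  d :=
    { toFun := fun x => ⟨_, fibreSub_d_mem α β x⟩
      map_add' := fun x y => fibreSub_ext α β (map_add _ _ _) (map_add _ _ _)
      map_smul' := fun c x => fibreSub_ext α β (map_smul _ _ _) (map_smul _ _ _) }
  d_mem i x hx := ⟨A.d_mem i _ hx.1, B.d_mem i _ hx.2⟩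
  d_d x := fibreSub_ext α β (A.d_d _) (B.d_d _)
  leibniz i x y hx := fibreSub_ext α β (A.leibniz i _ _ hx.1) (B.leibniz i _ _ hx.2)
  finite := inferInstanceAs (FiniteDimensional K (fibreSub α β).toSubmodule)
  nilpotent := by
    obtain ⟨m, hm⟩ := A.nilpotent
    obtain ⟨n, hn⟩ := B.nilpotent
    refine ⟨m + n, (Submodule.eq_bot_iff _).2 fun x hx => ?_⟩
    have h1 := A.pow_anti (Nat.le_add_right m n) (map_algPow
      ((LinearMap.fst K A B).comp (fibreSub α β).toSubmodule.subtype) (fun _ _ => rfl) _ x hx)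
    have h2 := B.pow_anti (Nat.le_add_left n m) (map_algPow
      ((LinearMap.snd K A B).comp (fibreSub α β).toSubmodule.subtype) (fun _ _ => rfl) _ x hx)
    rw [pow, hm] at h1
    rw [pow, hn] at h2
    exact fibreSub_ext α β h1 h2

/-- The first projection of the fibre product. -/
noncomputable def fibreFst : fibre α β ⟶ A :=
  Hom.mk (A := fibre α β) ((LinearMap.fst K A B).comp (fibreSub α β).toSubmodule.subtype)
    (fun _ _ => rfl) (fun _ _ h => h.1) (fun _ => rfl)

/-- The second projection of the fibre product. -/
noncomputable def fibreSnd : fibre α β ⟶ B :=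
  Hom.mk (A := fibre α β) ((LinearMap.snd K A B).comp (fibreSub α β).toSubmodule.subtype)
    (fun _ _ => rfl) (fun _ _ h => h.2) (fun _ => rfl)

variable {α β}

/-- The morphism to the fibre product induced by a commutative square. -/
noncomputable def fibreLift {P : ArtDGA K} (f : P ⟶ A) (g : P ⟶ B) (h : f ≫ α = g ≫ β) :
    P ⟶ fibre α β :=
  Hom.mk (B := fibre α β)
    { toFun := fun x => (⟨(lin f x, lin g x), congrArg (fun φ => lin φ x) h⟩ : fibreSub α β)
      map_add' := fun _ _ => fibreSub_ext α β (map_add _ _ _) (map_add _ _ _)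
      map_smul' := fun _ _ => fibreSub_ext α β (map_smul _ _ _) (map_smul _ _ _) }
    (fun x y => fibreSub_ext α β (map_mul f x y) (map_mul g x y))
    (fun _ _ hx => ⟨map_gr f hx, map_gr g hx⟩)
    (fun x => fibreSub_ext α β (map_d f x) (map_d g x))

variable (α β)

theorem fibre_ext {x y : fibre α β} (h1 : lin (fibreFst α β) x = lin (fibreFst α β) y)
    (h2 : lin (fibreSnd α β) x = lin (fibreSnd α β) y) : x = y := fibreSub_ext α β h1 h2

theorem fibre_isFibreProduct : IsFibreProduct (fibreFst α β) (fibreSnd α β) α β :=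
  ⟨hom_ext fun x => x.2, fun a b hab => ⟨(⟨(a, b), hab⟩ : fibreSub α β), ⟨rfl, rfl⟩,
    fun _ hy => fibreSub_ext α β hy.1 hy.2⟩⟩

end FibreProduct

end ArtDGA
-- The Poincaré lemma for `A[t, dt]_ε`; deformation functors are homotopy invariant.
namespace ArtDGA

variable (A : ArtDGA K) {ε : ℝ}

variable {A} in
theorem conv_mem_pow_succ {k : ℕ} (p : ℕ → A) {q : ℕ → A} (hq : ∀ n, q n ∈ A.pow k) (n : ℕ) :
    conv p q n ∈ A.pow (k + 1) :=
  Submodule.sum_mem _ fun ij _ => by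
    rw [Nat.add_comm]; exact A.mul_mem_pow_add (j := 1) trivial (hq _)

/-- The polynomials whose coefficients lie in `A ^ k`. -/
noncomputable def coeffIdeal (hε : 0 < ε) (k : ℕ) : DGIdeal (A.path ε hε) where
  sub :=
    { carrier := {x : A.Path ε | (∀ n, x.1.1 n ∈ A.pow k) ∧ ∀ n, x.1.2 n ∈ A.pow k}
      add_mem' := fun hx hy =>
        ⟨fun n => add_mem (hx.1 n) (hy.1 n), fun n => add_mem (hx.2 n) (hy.2 n)⟩
      zero_mem' := ⟨fun _ => zero_mem _, fun _ => zero_mem _⟩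
      smul_mem' := fun c _ hx =>
        ⟨fun n => Submodule.smul_mem _ c (hx.1 n), fun n => Submodule.smul_mem _ c (hx.2 n)⟩ }
  mul_mem a x hx := ⟨fun n => A.pow_succ_le k (conv_mem_pow_succ _ hx.1 n),
    fun n => A.pow_succ_le k (add_mem (conv_mem_pow_succ _ hx.2 n)
      (conv_mem_pow_succ _ (fun m => A.parity_pow _ _ (hx.1 m)) n))⟩
  proj_mem i x hx := by
    -- The projection defined by the grading is the coefficientwise one, for which membership in the
    -- powers is known.
    have e : proj (A.path ε hε).internal i x = A.pathProj ε i x := by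
      refine graded_ext (A.path_internal ε) (f := proj (A.path_internal ε) i)
        (g := A.pathProj ε i) ?_ x
      intro j v hv
      by_cases hj : j = i
      · subst hj
        rw [proj_same _ hv]
        exact path_ext (funext fun n => (proj_same _ (hv.1 n)).symm)
          (funext fun n => (proj_same _ (hv.2 n)).symm)
      · rw [proj_ne _ hj hv]
        exact path_ext (funext fun n => (proj_ne _ hj (hv.1 n)).symm)
          (funext fun n => (proj_ne _ (by omega) (hv.2 n)).symm)
    rw [e]
    exact ⟨fun n => A.proj_pow _ _ (hx.1 n) _, fun n => A.proj_pow _ _ (hx.2 n) _⟩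
  d_mem x hx := ⟨fun n => A.d_pow _ _ (hx.1 n),
    fun n => add_mem (A.parity_pow _ _ (nsmul_mem (hx.1 (n + 1)) _)) (A.d_pow _ _ (hx.2 n))⟩

variable {A} {hε : 0 < ε}

theorem mul_mem_coeffIdeal {k : ℕ} (a : A.path ε hε) {x : A.path ε hε}
    (hx : x ∈ (A.coeffIdeal hε k).sub) : a * x ∈ (A.coeffIdeal hε (k + 1)).sub :=
  ⟨fun n => conv_mem_pow_succ _ hx.1 n, fun n => add_mem (conv_mem_pow_succ _ hx.2 n)
    (conv_mem_pow_succ _ (fun m => A.parity_pow _ _ (hx.1 m)) n)⟩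

theorem coeffIdeal_le (k : ℕ) : (A.coeffIdeal hε (k + 1)).sub ≤ (A.coeffIdeal hε k).sub :=
  fun _ hx => ⟨fun n => A.pow_succ_le k (hx.1 n), fun n => A.pow_succ_le k (hx.2 n)⟩

/-- Since `A ^ 0 = A ^ 1 = A`, the first two steps of the filtration coincide and are everything. -/
theorem mem_coeffIdeal_of_le_one {k : ℕ} (hk : k ≤ 1) (x : A.path ε hε) :
    x ∈ (A.coeffIdeal hε k).sub :=
  ⟨fun _ => A.pow_anti (k := 1) hk trivial, fun _ => A.pow_anti (k := 1) hk trivial⟩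

theorem eq_zero_of_mem_coeffIdeal {n : ℕ} (hn : algPow K A n = ⊥) {x : A.path ε hε}
    (hx : x ∈ (A.coeffIdeal hε n).sub) : x = 0 := by
  obtain ⟨h1, h2⟩ := hx
  simp only [pow, hn, Submodule.mem_bot] at h1 h2
  exact path_ext (x := (x : A.Path ε)) (funext h1) (funext h2)

theorem const_mem_coeffIdeal {k : ℕ} {a : A} (ha : a ∈ A.pow k) :
    lin (A.const hε) a ∈ (A.coeffIdeal hε k).sub :=
  ⟨fun n => by
    change (Pi.single 0 a : ℕ → A) n ∈ _
    by_cases h : n = 0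
    · subst h; simpa using ha
    · rw [Pi.single_eq_of_ne h]; exact zero_mem _, fun n => zero_mem _⟩

theorem evalZero_mem_pow {k : ℕ} {x : A.path ε hε} (hx : x ∈ (A.coeffIdeal hε k).sub) :
    lin (A.evalZero hε) x ∈ A.pow k := hx.1 0

theorem evalOne_mem_pow {k : ℕ} {x : A.path ε hε} (hx : x ∈ (A.coeffIdeal hε k).sub) :
    lin (A.evalOne hε) x ∈ A.pow k := by
  change ∑ n ∈ Finset.range (A.bound hε), (x : A.Path ε).1.1 n ∈ _
  exact Submodule.sum_mem _ fun n _ => hx.1 n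

theorem evalZero_const (a : A) : lin (A.evalZero hε) (lin (A.const hε) a) = a :=
  congrArg (fun f => lin f a) (A.const_evalZero hε)

theorem evalOne_const (a : A) : lin (A.evalOne hε) (lin (A.const hε) a) = a :=
  congrArg (fun f => lin f a) (A.const_evalOne hε)

/-- Integration in `t` of a closed element of `A[t, dt]_ε`. -/
theorem exists_primitive [CharZero K] {k : ℕ} {x : A.path ε hε}
    (hx : x ∈ (A.coeffIdeal hε k).sub) (hd : (A.path ε hε).d x = 0) :
    ∃ y ∈ (A.coeffIdeal hε k).sub, lin (A.evalZero hε) y = 0 ∧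
      (A.path ε hε).d y = x - lin (A.const hε) (lin (A.evalZero hε) x) := by
  obtain ⟨⟨p, q⟩, hp, hq⟩ := x
  have h1 : ∀ n, A.d (p n) = 0 := fun n => congrFun (congrArg (fun z : A.Path ε => z.1.1) hd) n
  have h2 : ∀ n, parity A.internal ((n + 1) • p (n + 1)) + A.d (q n) = 0 := fun n =>
    congrFun (congrArg (fun z : A.Path ε => z.1.2) hd) n
  -- The termwise integral of `q dt`, with zero constant term; the parity undoes the sign with which
  -- `d` differentiates `tⁿ⁺¹`.
  let r : ℕ → A := fun n => Nat.casesOn n 0 fun m => ((m + 1 : ℕ) : K)⁻¹ • parity A.internal (q m)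
  have hr0 : r 0 = 0 := rfl
  have hr : ∀ n, r (n + 1) = ((n + 1 : ℕ) : K)⁻¹ • parity A.internal (q n) := fun n => rfl
  have hrs : ∀ n, (n + 1) • r (n + 1) = parity A.internal (q n) := fun n => by
    rw [hr, ← Nat.cast_smul_eq_nsmul K, smul_smul,
      mul_inv_cancel₀ (Nat.cast_ne_zero.2 n.succ_ne_zero), one_smul]
  -- The `dt` component of the closedness of `x`, divided by `n + 1`.
  have hdr : ∀ n, A.d (r (n + 1)) = p (n + 1) := fun n => by
    have h3 := eq_neg_of_add_eq_zero_right (h2 n)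
    rw [hr, map_smul, d_parity, h3, map_neg, parity_parity, neg_neg, ← Nat.cast_smul_eq_nsmul K,
      smul_smul, inv_mul_cancel₀ (Nat.cast_ne_zero.2 n.succ_ne_zero), one_smul]
  have mem : ∀ (j n : ℕ), q n ∈ A.pow j → r (n + 1) ∈ A.pow j := fun j n h => by
    rw [hr]; exact Submodule.smul_mem _ _ (A.parity_pow _ _ h)
  refine ⟨(⟨(r, 0), fun n => ?_, fun n => zero_mem _⟩ : A.Path ε), ⟨fun n => ?_, fun n => zero_mem _⟩,
    rfl, path_ext (x := (_ : A.Path ε)) (funext fun n => ?_) (funext fun n => ?_)⟩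
  · rcases n with _ | n
    · exact zero_mem _
    -- The coefficient of `tⁿ dt` already carries the weight `n + 1` demanded of the coefficient of
    -- `tⁿ⁺¹`, so integration stays inside `A[t, dt]_ε`.
    · exact mem _ n (hq n)
  · rcases n with _ | n
    · exact zero_mem _
    · exact mem k n (hx.2 n)
  · change A.d (r n) = p n - (Pi.single 0 (p 0) : ℕ → A) n
    rcases n with _ | n
    · simp [hr0]
    · simp [hdr]
  · change parity A.internal ((n + 1) • r (n + 1)) + A.d 0 = q n - 0
    rw [hrs, parity_parity, map_zero, add_zero, sub_zero]

/-- Integration preserves the ideal of coefficients in `A ^ k` and gives primitives vanishing at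
`0`; nilpotency of `A` ends the filtration. -/
theorem evalZero_isFilteredAcyclic [CharZero K] {n : ℕ} (hn : algPow K A n = ⊥) :
    IsFilteredAcyclic (A.evalZero hε) n
      fun k => DGIdeal.inter (A.coeffIdeal hε k) (DGIdeal.ker (A.evalZero hε)) where
  surjective a := ⟨_, evalZero_const a⟩
  mem_zero x := ⟨fun h => h.2, fun h => ⟨mem_coeffIdeal_of_le_one zero_le_one x, h⟩⟩
  eq_zero x hx := eq_zero_of_mem_coeffIdeal hn hx.1
  le k x hx := ⟨coeffIdeal_le k hx.1, hx.2⟩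
  mul_mem k a x hx := ⟨mul_mem_coeffIdeal a hx.1, (DGIdeal.ker (A.evalZero hε)).mul_mem a x hx.2⟩
  acyclic k x hx hd := by
    obtain ⟨y, hy, hy0, hyx⟩ := exists_primitive hx.1 hd
    refine ⟨y, ⟨hy, hy0⟩, ?_⟩
    rw [hyx, DGIdeal.mem_ker.1 hx.2, map_zero, sub_zero]

end ArtDGA

open ArtDGA

/-- `F(e₀)` is bijective and the constants are a section of `e₀`, so `x` is the image of its value
at `0` under the constants; its value at `1` is therefore the same. -/
theorem IsDeformation.eq_of_homotopic [CharZero K] {F : ArtDGA K ⥤ Type u} (hF : IsDeformation F)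
    {A : ArtDGA K} {a b : F.obj A} (h : Homotopic F A a b) : a = b := by
  obtain ⟨ε, hε, x, rfl, rfl⟩ := h
  obtain ⟨n, hn⟩ := A.nilpotent
  have hb := IsFilteredAcyclic.bijective F hF.bijective n _ _
    (evalZero_isFilteredAcyclic (hε := hε) hn)
  have hx : F.map (A.const hε) (F.map (A.evalZero hε) x) = x := by
    apply hb.injective
    rw [← Functor.map_comp_apply, const_evalZero, Functor.map_id_apply]
  have h1 : ∀ z, F.map (A.evalOne hε) (F.map (A.const hε) z) = z := fun z => by
    rw [← Functor.map_comp_apply, const_evalOne, Functor.map_id_apply]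
  conv_rhs => rw [← hx, h1]

/-! ### Mapping path objects and injectivity of `Def_L` on fibre products. -/

section FibreProduct

variable {P A B C : ArtDGA K} {p : P ⟶ A} {q : P ⟶ B} {α : A ⟶ C} {β : B ⟶ C}

/-- The mapping path object of `p : P ⟶ A`. -/
noncomputable abbrev mappingPath (p : P ⟶ A) : ArtDGA K := fibre (A.evalZero one_pos) p

/-- The constant section of the mapping path object. -/
noncomputable def mappingPathSection (p : P ⟶ A) : P ⟶ mappingPath p :=
  fibreLift (p ≫ A.const one_pos) (𝟙 P) (by
    rw [Category.assoc, const_evalZero, Category.comp_id, Category.id_comp])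

/-- The map to `A × B` given by the end point of the path and by `q`. -/
noncomputable def mappingPathEnd (p : P ⟶ A) (q : P ⟶ B) :
    mappingPath p ⟶ fibre (zeroHom A A) (zeroHom B A) :=
  fibreLift (fibreFst _ _ ≫ A.evalOne one_pos) (fibreSnd _ _ ≫ q) rfl

theorem lin_mappingPathEnd_eq_zero (p : P ⟶ A) (q : P ⟶ B) (x : mappingPath p) :
    lin (mappingPathEnd p q) x = 0 ↔ lin (A.evalOne one_pos) (lin (fibreFst _ _) x) = 0 ∧
      lin q (lin (fibreSnd _ _) x) = 0 := by
  refine ⟨fun h => ⟨congrArg (lin (fibreFst _ _)) h, congrArg (lin (fibreSnd _ _)) h⟩, fun h => ?_⟩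
  exact fibre_ext _ _ (h.1.trans (map_zero _).symm) (h.2.trans (map_zero _).symm)

theorem evalZero_mulT (a : A) : lin (A.evalZero one_pos) (A.mulT a) = 0 :=
  LinearMap.congr_fun A.mulT_evalZero a

theorem evalOne_mulT (a : A) : lin (A.evalOne one_pos) (A.mulT a) = a :=
  LinearMap.congr_fun A.mulT_evalOne a

/-- The kernel consists of pairs `(γ, z)` with `γ(0) = p z`, `γ(1) = 0`, `q z = 0`, filtered by the
coefficients of `γ`. A primitive of a closed pair is found by integrating `γ` from `1`; acyclicity
of `C` makes its value at `0` come from `P`. -/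
theorem mappingPathEnd_isFilteredAcyclic [CharZero K] (h : IsFibreProduct p q α β)
    (hα : Function.Surjective (lin α)) (hC : IsAcyclicComplex C) {n : ℕ}
    (hn : algPow K A n = ⊥) :
    IsFilteredAcyclic (mappingPathEnd p q) n fun k =>
      DGIdeal.inter (DGIdeal.comap (fibreFst (A.evalZero one_pos) p) (A.coeffIdeal one_pos k))
        (DGIdeal.ker (mappingPathEnd p q)) where
  surjective y := by
    obtain ⟨z, hz⟩ := h.snd_surjective hα (lin (fibreSnd _ _) y)
    let a : A := lin (fibreFst _ _) y
    -- The straight path `(p z)(1 - t) + a t`.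
    let γ := lin (A.const one_pos) (lin p z) - A.mulT (lin p z) + A.mulT a
    have h0 : lin (A.evalZero one_pos) γ = lin p z := by
      simp only [γ, map_add, map_sub, evalZero_const, evalZero_mulT, sub_zero, add_zero]
    have h1 : lin (A.evalOne one_pos) γ = a := by
      simp only [γ, map_add, map_sub, evalOne_const, evalOne_mulT, sub_self, zero_add]
    obtain ⟨x, ⟨hx1, hx2⟩, -⟩ := (fibre_isFibreProduct (A.evalZero one_pos) p).2 γ z h0
    refine ⟨x, fibre_ext _ _ ?_ ?_⟩
    · change lin (A.evalOne one_pos) (lin (fibreFst _ _) x) = a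
      rw [hx1, h1]
    · change lin q (lin (fibreSnd _ _) x) = _
      rw [hx2, hz]
  mem_zero x := ⟨fun h => h.2, fun h => ⟨mem_coeffIdeal_of_le_one zero_le_one _, h⟩⟩
  eq_zero x hx := by
    have e1 : lin (fibreFst _ _) x = 0 := eq_zero_of_mem_coeffIdeal hn hx.1
    have e2 := ((lin_mappingPathEnd_eq_zero p q x).1 hx.2).2
    have e3 : lin (A.evalZero one_pos) (lin (fibreFst _ _) x) = lin p (lin (fibreSnd _ _) x) :=
      x.2
    rw [e1, map_zero] at e3
    refine fibre_ext _ _ (e1.trans (map_zero _).symm) ?_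
    exact (h.2 0 0 (by simp)).unique ⟨e3.symm, e2⟩ (by simp)
  le k x hx := ⟨coeffIdeal_le k hx.1, hx.2⟩
  mul_mem k a x hx := by
    refine ⟨?_, (DGIdeal.ker (mappingPathEnd p q)).mul_mem a x hx.2⟩
    change lin (fibreFst (A.evalZero one_pos) p) (a * x) ∈ (A.coeffIdeal one_pos (k + 1)).sub
    rw [ArtDGA.map_mul]
    exact mul_mem_coeffIdeal _ hx.1
  acyclic k x hx hd := by
    obtain ⟨hx1, hx2⟩ := (lin_mappingPathEnd_eq_zero p q x).1 hx.2
    have hx3 : lin (A.evalZero one_pos) (lin (fibreFst _ _) x) = lin p (lin (fibreSnd _ _) x) :=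
      x.2
    set γ := lin (fibreFst (A.evalZero one_pos) p) x
    set z := lin (fibreSnd (A.evalZero one_pos) p) x
    have hγ : γ ∈ (A.coeffIdeal one_pos k).sub := hx.1
    have hdγ : (A.path 1 one_pos).d γ = 0 := by rw [← ArtDGA.map_d, hd, map_zero]
    have hαβ : ∀ w, lin α (lin p w) = lin β (lin q w) := fun w => congrArg (fun f => lin f w) h.1
    have hαγ : lin α (lin (A.evalZero one_pos) γ) = 0 := by rw [hx3, hαβ, hx2, map_zero]
    obtain ⟨y, hy, -, hyγ⟩ := exists_primitive hγ hdγ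
    -- Subtracting `y(1)` makes the primitive vanish at `1`. As `d (y(1)) = γ(1) - γ(0) = -γ(0)`,
    -- this also removes the constant by which `d y` differs from `γ`.
    obtain ⟨η, hη, hη1, hηd⟩ : ∃ η ∈ (A.coeffIdeal one_pos k).sub,
        lin (A.evalOne one_pos) η = 0 ∧ (A.path 1 one_pos).d η = γ := by
      refine ⟨y - lin (A.const one_pos) (lin (A.evalOne one_pos) y),
        sub_mem hy (const_mem_coeffIdeal (evalOne_mem_pow hy)), ?_, ?_⟩
      · rw [map_sub, evalOne_const, sub_self]
      · simp only [map_sub, ← ArtDGA.map_d, hyγ, evalOne_const, hx1]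
        simp
    -- To lift `(θ(0), 0)` to `P`, the value at `0` must be killed by `α`.
    obtain ⟨θ, hθ, hθ1, hθd, hθα⟩ : ∃ θ ∈ (A.coeffIdeal one_pos k).sub,
        lin (A.evalOne one_pos) θ = 0 ∧ (A.path 1 one_pos).d θ = γ ∧
        lin α (lin (A.evalZero one_pos) θ) = 0 := by
      by_cases hk : k ≤ 1
      · have hc : C.d (lin α (lin (A.evalZero one_pos) η)) = 0 := by
          rw [← ArtDGA.map_d, ← ArtDGA.map_d, hηd, hαγ]
        obtain ⟨c, hc⟩ := hC.2 _ hc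
        obtain ⟨a, rfl⟩ := hα c
        -- `a (1 - t)` vanishes at `1` and is `a` at `0`, so subtracting its differential only
        -- corrects the value at `0`. Nothing is known about the powers of `A` containing `a`,
        -- whence the restriction to `k ≤ 1`.
        refine ⟨η - (A.path 1 one_pos).d (lin (A.const one_pos) a - A.mulT a),
          mem_coeffIdeal_of_le_one hk _, ?_, ?_, ?_⟩
        · rw [map_sub, hη1, ArtDGA.map_d, map_sub, evalOne_const, evalOne_mulT, sub_self, map_zero,
            sub_zero]
        · rw [map_sub, (A.path 1 one_pos).d_d, hηd, sub_zero]
        · rw [map_sub, map_sub, ArtDGA.map_d, ArtDGA.map_d, map_sub, evalZero_const, evalZero_mulT,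
            sub_zero, hc, sub_self]
      · refine ⟨η, hη, hη1, hηd, ?_⟩
        -- For `k ≥ 2` no correction is needed: `η(0)` lies in `A ^ 2`, which `α` maps to `C ^ 2 =
        -- 0`.
        have h2 : lin (A.evalZero one_pos) η ∈ A.pow 2 :=
          A.pow_anti (by omega) (evalZero_mem_pow hη)
        have h3 : C.pow 2 = ⊥ := by
          refine Submodule.span_eq_bot.2 ?_
          rintro _ ⟨a, b, -, rfl⟩
          exact hC.1 a b
        have h4 := ArtDGA.map_pow α 2 _ h2
        rwa [h3] at h4
    obtain ⟨w, ⟨hw1, hw2⟩, -⟩ := h.2 (lin (A.evalZero one_pos) θ) 0 (by rw [hθα, map_zero])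
    obtain ⟨v, ⟨hv1, hv2⟩, -⟩ := (fibre_isFibreProduct (A.evalZero one_pos) p).2 θ w hw1.symm
    refine ⟨v, ⟨?_, (lin_mappingPathEnd_eq_zero p q v).2 ⟨by rw [hv1, hθ1], by rw [hv2, hw2]⟩⟩,
      fibre_ext _ _ ?_ ?_⟩
    · change lin (fibreFst (A.evalZero one_pos) p) v ∈ (A.coeffIdeal one_pos k).sub
      rw [hv1]; exact hθ
    · rw [ArtDGA.map_d, hv1, hθd]
    · rw [ArtDGA.map_d, hv2]
      refine (h.2 _ _ (hαβ z)).unique ⟨?_, ?_⟩ ⟨rfl, rfl⟩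
      · rw [ArtDGA.map_d, hw1, ← ArtDGA.map_d, hθd, hx3]
      · rw [ArtDGA.map_d, hw2, map_zero, hx2]

end FibreProduct

/-- Constant paths embed `P` in the mapping path object as a section of the projection to `P`, so it
suffices to compare the images there. `Def L` carries that object bijectively to `A × B`, where the
components are the images under `p` and `q`. Only `Def_bijective` is used, so there is no
circularity. -/
theorem Def_injective [CharZero K] (L : DGLA K) {P A B C : ArtDGA K} {p : P ⟶ A} {q : P ⟶ B}
    {α : A ⟶ C} {β : B ⟶ C} (h : IsFibreProduct p q α β) (hα : Function.Surjective (lin α))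
    (hC : IsAcyclicComplex C) {x y : (Def L).obj P} (hp : (Def L).map p x = (Def L).map p y)
    (hq : (Def L).map q x = (Def L).map q y) : x = y := by
  obtain ⟨n, hn⟩ := A.nilpotent
  have hb := IsFilteredAcyclic.bijective (Def L) (fun _ h => Def_bijective L h) n _ _
    (mappingPathEnd_isFilteredAcyclic h hα hC hn)
  have e1 : mappingPathSection p ≫ mappingPathEnd p q ≫ fibreFst _ _ = p := by
    change (p ≫ A.const one_pos) ≫ A.evalOne one_pos = p
    rw [Category.assoc, const_evalOne, Category.comp_id]
  have e2 : mappingPathSection p ≫ mappingPathEnd p q ≫ fibreSnd _ _ = q := rfl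
  have e3 : mappingPathSection p ≫ fibreSnd _ _ = 𝟙 P := rfl
  have hs : (Def L).map (mappingPathSection p) x = (Def L).map (mappingPathSection p) y := by
    apply hb.injective
    apply Def_prod_injective L (fibre_isFibreProduct (zeroHom A A) (zeroHom B A))
    · simpa only [← Functor.map_comp_apply, Category.assoc, e1] using hp
    · simpa only [← Functor.map_comp_apply, Category.assoc, e2] using hq
  have := congrArg ((Def L).map (fibreSnd (A.evalZero one_pos) p)) hs
  simpa only [← Functor.map_comp_apply, e3, Functor.map_id_apply] using this

theorem Def_isDeformation [CharZero K] (L : DGLA K) : IsDeformation (Def L) where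
  zero _ hA := Def_zero L hA
  surj _ _ _ _ h hα a b hab := Def_surj L h hα a b hab
  bij p q α β h hα hC a b hab := by
    obtain ⟨x, hx1, hx2⟩ := Def_surj L h hα a b hab
    exact ⟨x, ⟨hx1, hx2⟩, fun y hy => Def_injective L h hα hC (hy.1.trans hx1.symm)
      (hy.2.trans hx2.symm)⟩
  quasismooth _ h := (Def_bijective L h).surjective
  bijective _ h := Def_bijective L h

/-! ### Transport along isomorphisms and the comparison of `MC_L⁺` with `Def_L`. -/

theorem IsDeformation.of_iso {F G : ArtDGA K ⥤ Type u} (e : F ≅ G) (hG : IsDeformation G) :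
    IsDeformation F := by
  have hb : ∀ A, Function.Bijective (e.hom.app A : F.obj A → G.obj A) := fun A =>
    (isIso_iff_bijective (e.hom.app A)).1 inferInstance
  have nat : ∀ {A B : ArtDGA K} (f : A ⟶ B) (x : F.obj A),
      e.hom.app B (F.map f x) = G.map f (e.hom.app A x) := fun f x =>
    NatTrans.naturality_apply e.hom f x
  have surj : ∀ {P A B C : ArtDGA K} (p : P ⟶ A) (q : P ⟶ B) (α : A ⟶ C) (β : B ⟶ C),
      IsFibreProduct p q α β → Function.Surjective (lin α) →
      ∀ (a : F.obj A) (b : F.obj B), F.map α a = F.map β b →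
        ∃ x : F.obj P, F.map p x = a ∧ F.map q x = b := by
    intro P A B C p q α β h hα a b hab
    obtain ⟨y, hy1, hy2⟩ := hG.surj p q α β h hα (e.hom.app A a) (e.hom.app B b)
      (by rw [← nat, ← nat, hab])
    obtain ⟨x, rfl⟩ := (hb P).surjective y
    exact ⟨x, (hb A).injective (by rw [nat, hy1]), (hb B).injective (by rw [nat, hy2])⟩
  have bij : ∀ {A B : ArtDGA K} (α : A ⟶ B), IsAcyclicSmall α →
      Function.Bijective (F.map α : F.obj A → F.obj B) := by
    intro A B α h
    refine (Function.Bijective.of_comp_iff' (hb B) _).1 ?_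
    have : (e.hom.app B : F.obj B → G.obj B) ∘ (F.map α : F.obj A → F.obj B) =
        (G.map α : G.obj A → G.obj B) ∘ (e.hom.app A : F.obj A → G.obj A) :=
      funext fun x => nat α x
    rw [this]
    exact (hG.bijective α h).comp (hb A)
  exact
    { zero := fun A hA => by
        obtain ⟨i⟩ := hG.zero A hA
        exact ⟨(Equiv.ofBijective _ (hb A)).unique⟩
      surj := surj
      bij := fun p q α β h hα hC a b hab => by
        obtain ⟨x, hx1, hx2⟩ := surj p q α β h hα a b hab
        refine ⟨x, ⟨hx1, hx2⟩, fun y hy => (hb _).injective ?_⟩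
        refine (hG.bij p q α β h hα hC (e.hom.app _ a) (e.hom.app _ b)
          (by rw [← nat, ← nat, hab])).unique ⟨?_, ?_⟩ ⟨?_, ?_⟩
        · rw [← nat, hy.1]
        · rw [← nat, hy.2]
        · rw [← nat, hx1]
        · rw [← nat, hx2]
      quasismooth := fun α h => (bij α h).surjective
      bijective := bij }

section Comparison

variable [CharZero K]

/-- A homotopy in `MC L` maps to a homotopy in `Def L`, which is homotopy invariant as a deformation
functor. -/
theorem Homotopic.quot_gauge_eq {L : DGLA K} {A : ArtDGA K} {x y : MCSet L A}
    (h : Homotopic (MC L) A x y) : Quot.mk (GaugeRel L A) x = Quot.mk (GaugeRel L A) y :=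
  (Def_isDeformation L).eq_of_homotopic (h.app (defProj L))

/-- Homotopy classes of Maurer-Cartan elements agree with gauge equivalence classes. -/
noncomputable def plusEquivDef (L : DGLA K) (A : ArtDGA K) : (plus (MC L)).obj A ≃ (Def L).obj A where
  toFun := Quot.lift (Quot.mk _) fun _ _ h => Homotopic.quot_gauge_eq h
  invFun := Quot.lift (Quot.mk _) fun _ _ h => Quot.sound h.homotopic
  left_inv x := by induction x using Quot.ind; rfl
  right_inv x := by induction x using Quot.ind; rfl

/-- The isomorphism `MC_L⁺ ≅ Def_L`. -/
noncomputable def plusIsoDef (L : DGLA K) : plus (MC L) ≅ Def L :=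
  NatIso.ofComponents (fun A => (plusEquivDef L A).toIso) fun f => by
    ext x
    induction x using Quot.ind
    rfl

/-- The isomorphisms `MC_L⁺ ≅ Def_L` are natural in `L`. -/
noncomputable def plusFunctorIsoDefFunctor : MCFunctor K ⋙ plusFunctor K ≅ DefFunctor K :=
  NatIso.ofComponents (fun L => plusIsoDef L) fun φ => by
    ext A x
    induction x using Quot.ind
    rfl

/-- A morphism to a deformation functor is constant on homotopy classes, so it descends; uniqueness
holds because `F ⟶ F⁺` is surjective on each object. -/
theorem plusProj_isAssociatedDeformation {F : ArtDGA K ⥤ Type u} (h : IsDeformation (plus F)) :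
    IsAssociatedDeformation (plusProj F) := by
  refine ⟨h, fun H hH φ => ⟨{
    app := fun A => ↾(Quot.lift (φ.app A) fun _ _ hab => hH.eq_of_homotopic (hab.app φ))
    naturality := fun A B f => by
      ext x
      induction x using Quot.ind
      exact NatTrans.naturality_apply φ f _ }, rfl, fun ψ hψ => ?_⟩⟩
  ext A x
  induction x using Quot.ind with | mk x =>
  exact (congrArg (fun χ : F ⟶ H => χ.app A x) hψ).symm

end Comparison

end DefFun

theorem corollary3p4 (K : Type u) [Field K] [CharZero K] :
    (∀ L : DefFun.DGLA K, DefFun.IsPredeformation (DefFun.MC L) ∧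
      DefFun.IsAssociatedDeformation (DefFun.plusProj (DefFun.MC L))) ∧
    ∃ Φ : DefFun.MCFunctor K ⋙ DefFun.plusFunctor K ≅ DefFun.DefFunctor K,
      ∀ L : DefFun.DGLA K,
        DefFun.plusProj (DefFun.MC L) ≫ Φ.hom.app L = DefFun.defProj L :=
  ⟨fun L => ⟨DefFun.MC_isPredeformation L, DefFun.plusProj_isAssociatedDeformation
    ((DefFun.Def_isDeformation L).of_iso (DefFun.plusIsoDef L))⟩,
    DefFun.plusFunctorIsoDefFunctor, fun _ => rfl⟩
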